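/- **Setting.** Let $d\ge 2$ and equip $\mathbb R^d$ with the Lorentz product $xy=x_0y_0-\sum_{i=1}^{d-1}x_iy_i$. Let $\mathcal P=\mathcal L\ltimes\mathbb R^d$, where $\mathcal L$ is the identity component of the Lorentz group if $d>2$; if $d=2$, the reflection of the space coordinate is included, so that $\mathcal L$ consists of all Lorentz matrices $\Lambda$ with $\Lambda_{00}>0$. Let $U$ be a strongly continuous unitary representation of $\mathcal P$ on a separable Hilbert space $\mathcal H$ such that the joint spectrum of the generators $P$ of the translations $U(x)=e^{iPx}=\int e^{ipx}\,dE(p)$ is contained in $V_+=\{p: p_0\ge |\mathbf p|\}$, and let $\Omega$ be an (up to a phase unique) $U$-invariant unit vector. Put $\alpha_\lambda(F)=U(\lambda)FU(\lambda)^{-1}$. Let $\mathcal D$ be the space of all $\psi\in\mathcal H$ for which $x\mapsto U(x)\psi$ is smooth, and let $\mathfrak F$ be the unital $*$-algebra of all linear operators $F$ on $\mathcal D$ such that for some $m\in\mathbb N$ the function $x\mapsto(1+|P|^2)^{-m}\alpha_x(F)(1+|P|^2)^{-m}$ takes values in the bounded operators and is arbitrarily often differentiable in norm, where $|P|^2$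 is the sum of the squares of the generators; the involution is $F\mapsto F^*\!\restriction\!\mathcal D$. For $F\in\mathfrak F$ and a matrix $Q$ that is skew symmetric with respect to the Lorentz product, the warped convolution $F_Q=\int dE(p)\,\alpha_{Qp}(F)$ is defined on $\mathcal D$ in the sense of distributions, that is $$F_Q\psi=(2\pi)^{-d}\lim_{\varepsilon\downarrow0}\iint \chi(\varepsilon x,\varepsilon p)\,e^{-ipx}\,U(x)\,\alpha_{Qp}(F)\psi\;dx\,dp ,\qquad \psi\in\mathcal D,$$ for every Schwartz function $\chi$ on $\mathbb R^d\times\mathbb R^d$ with $\chi(0,0)=1$. The wedges are the sets $\lambda\mathcal W_0$, $\lambda\in\mathcal P$, where $\mathcal W_0=\{x:x_1\ge|x_0|\}$; $\mathcal W'$ denotes the closure of the causal complement of $\mathcal W$. A family of wedge algebras assigns to each wedge $\mathcal W$ a unital $*$-algebra $\mathfrak A(\mathcal W)\subset\mathfrak F$. Consider the properties * isotony: $\mathfrak A(\mathcal W_1)\subset\mathfrak A(\mathcal W_2)$ whenever $\mathcal W_1\subset\mathcal W_2$; * covariance: $\alpha_\lambda(\mathfrak A(\mathcal W))=\mathfrak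 A(\lambda\mathcal W)$ for all $\mathcal W$ and all $\lambda\in\mathcal P$; * locality: every element of $\mathfrak A(\mathcal W')$ commutes with every element of $\mathfrak A(\mathcal W)$; * Reeh–Schlieder property: $\mathfrak A(\mathcal W)\Omega$ is dense in $\mathcal H$ for every $\mathcal W$. For $\kappa>0$ let $Q_\kappa$ be the $d\times d$ matrix with entries $(Q_\kappa)_{01}=(Q_\kappa)_{10}=\kappa$ and all other entries $0$. For $\mathcal W=\lambda\mathcal W_0$ with $\lambda=(\Lambda,x)\in\mathcal P$ let $\mathfrak A_\kappa(\mathcal W)$ be the unital algebra generated by all $A_{\Lambda Q_\kappa\Lambda^{-1}}$ with $A\in\mathfrak A(\mathcal W)$. **Theorem.** Let $\mathfrak A(\mathcal W)\subset\mathfrak F$ be a family of wedge algebras with isotony, covariance, locality and the Reeh–Schlieder property, and let $\kappa>0$. Then: 1. For every skew symmetric $Q$ and every $F\in\mathfrak F$ the warped convolution $F_Q$ exists, $F_Q\in\mathfrak F$, and $F_Q\Omega=F\Omega$. 2. The matrices $\Lambda Q_\kappa\Lambda^{-1}$ are skew symmetric, and $\mathfrak A_\kappa(\mathcal W)$ does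 not depend on the choice of $\lambda$ with $\mathcal W=\lambda\mathcal W_0$. 3. The algebras $\mathfrak A_\kappa(\mathcal W)$ form again a family of $*$-algebras contained in $\mathfrak F$ with isotony, covariance, locality and the Reeh–Schlieder property. -/

import Mathlib

open scoped ContDiff InnerProductSpace

noncomputable section

namespace WarpedQFT

/-! ### Minkowski space and the Poincare group

The spacetime dimension is `d = n + 2 ≥ 2`; the coordinates are `x 0` (time), `x 1`, ... -/

/-- `ℝ^d` with `d = n + 2`. -/
abbrev Mink (n : ℕ) : Type := EuclideanSpace ℝ (Fin (n + 2))

/-- The metric `diag(1, -1, ..., -1)`. -/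
def eta (n : ℕ) : Matrix (Fin (n + 2)) (Fin (n + 2)) ℝ :=
  Matrix.diagonal fun i => if i = 0 then 1 else -1

/-- The Lorentz inner product `x y = x₀ y₀ - ∑ xᵢ yᵢ`. -/
def mdot {n : ℕ} (x y : Mink n) : ℝ :=
  x 0 * y 0 - ∑ i : Fin (n + 1), x i.succ * y i.succ

/-- A matrix acting on vectors. -/
def app {n : ℕ} (A : Matrix (Fin (n + 2)) (Fin (n + 2)) ℝ) (x : Mink n) : Mink n :=
  WithLp.toLp 2 (A.mulVec x.ofLp)

/-- `q · (Q p) = - p · (Q q)` for all `p, q`. -/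
def IsSkew {n : ℕ} (Q : Matrix (Fin (n + 2)) (Fin (n + 2)) ℝ) : Prop :=
  ∀ p q : Mink n, mdot q (app Q p) = -mdot p (app Q q)

theorem eta_mul_eta (n : ℕ) : eta n * eta n = 1 := by
  rw [eta, Matrix.diagonal_mul_diagonal, ← Matrix.diagonal_one]
  congr 1
  funext i
  split_ifs <;> norm_num

theorem isometry_transpose {n : ℕ} {A : Matrix (Fin (n + 2)) (Fin (n + 2)) ℝ}
    (h : A.transpose * eta n * A = eta n) : A * eta n * A.transpose = eta n := by
  have h1 : (eta n * A.transpose * eta n) * A = 1 := by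
    rw [mul_assoc, mul_assoc, ← mul_assoc A.transpose, h, eta_mul_eta]
  have h2 := mul_eq_one_comm.mp h1
  calc A * eta n * A.transpose = (A * (eta n * A.transpose * eta n)) * eta n := by
        simp only [mul_assoc, eta_mul_eta, mul_one]
    _ = eta n := by rw [h2, one_mul]

theorem isometry_col {n : ℕ} {A : Matrix (Fin (n + 2)) (Fin (n + 2)) ℝ}
    (h : A.transpose * eta n * A = eta n) :
    ∑ i : Fin (n + 1), A i.succ 0 ^ 2 = A 0 0 ^ 2 - 1 := by
  have h0 : (A.transpose * eta n * A) 0 0 = eta n 0 0 := by rw [h]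
  have h1 : (A.transpose * eta n * A) 0 0
      = A 0 0 * A 0 0 + ∑ i : Fin (n + 1), A i.succ 0 * -1 * A i.succ 0 := by
    rw [Matrix.mul_apply, eta, Fin.sum_univ_succ]
    simp [Matrix.mul_diagonal, Fin.succ_ne_zero]
  have h2 : eta n 0 0 = 1 := by simp [eta]
  have e : ∑ i : Fin (n + 1), A i.succ 0 * -1 * A i.succ 0
      = - ∑ i : Fin (n + 1), A i.succ 0 ^ 2 := by
    rw [← Finset.sum_neg_distrib]
    exact Finset.sum_congr rfl fun i _ => by ring
  rw [h1, h2, e] at h0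
  linarith

theorem time_mul_pos {n : ℕ} {A B : Matrix (Fin (n + 2)) (Fin (n + 2)) ℝ}
    (hA : A.transpose * eta n * A = eta n) (hB : B.transpose * eta n * B = eta n)
    (a : 0 < A 0 0) (b : 0 < B 0 0) : 0 < (A * B) 0 0 := by
  have cA : ∑ i : Fin (n + 1), A 0 i.succ ^ 2 = A 0 0 ^ 2 - 1 := by
    have := isometry_col (A := A.transpose)
      (by rw [Matrix.transpose_transpose]; exact isometry_transpose hA)
    simpa using this
  have cB := isometry_col hB
  have cs := Finset.sum_mul_sq_le_sq_mul_sq Finset.univ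
    (fun i : Fin (n + 1) => A 0 i.succ) (fun i => B i.succ 0)
  rw [cA, cB] at cs
  rw [Matrix.mul_apply, Fin.sum_univ_succ]
  set S := ∑ i : Fin (n + 1), A 0 i.succ * B i.succ 0
  have pA : 0 ≤ A 0 0 ^ 2 - 1 := cA ▸ Finset.sum_nonneg fun i _ => sq_nonneg _
  have pB : 0 ≤ B 0 0 ^ 2 - 1 := cB ▸ Finset.sum_nonneg fun i _ => sq_nonneg _
  have lt : S ^ 2 < (A 0 0 * B 0 0) ^ 2 := by nlinarith
  linarith [(abs_lt.mp (abs_lt_of_sq_lt_sq lt (mul_pos a b).le)).1]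

/-- The group `𝓛`. For `d > 2` it is the identity component of the Lorentz group, i.e. the
Lorentz matrices `Λ` with `Λ₀₀ > 0` and `det Λ = 1`. For `d = 2` the reflection of the space
coordinate is included, which leaves the Lorentz matrices with `Λ₀₀ > 0`. -/
def lorentz (n : ℕ) : Subgroup (Matrix.GeneralLinearGroup (Fin (n + 2)) ℝ) where
  carrier := {g | g.val.transpose * eta n * g.val = eta n ∧ 0 < g.val 0 0 ∧
    (n = 0 ∨ g.val.det = 1)}
  one_mem' := by simp
  mul_mem' := by
    rintro g h ⟨g1, g2, g3⟩ ⟨h1, h2, h3⟩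
    refine ⟨?_, ?_, ?_⟩
    · rw [Units.val_mul, Matrix.transpose_mul]
      calc h.val.transpose * g.val.transpose * eta n * (g.val * h.val)
          = h.val.transpose * (g.val.transpose * eta n * g.val) * h.val := by
            simp only [mul_assoc]
        _ = eta n := by rw [g1, h1]
    · exact time_mul_pos g1 h1 g2 h2
    · rcases g3 with g3 | g3
      · exact Or.inl g3
      rcases h3 with h3 | h3
      · exact Or.inl h3
      · right
        rw [Units.val_mul, Matrix.det_mul, g3, h3, one_mul]
  inv_mem' := by
    rintro g ⟨g1, g2, g3⟩
    have hinv : (g⁻¹).val = eta n * g.val.transpose * eta n := by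
      have h1 : (eta n * g.val.transpose * eta n) * g.val = 1 := by
        rw [mul_assoc, mul_assoc, ← mul_assoc g.val.transpose, g1, eta_mul_eta]
      calc (g⁻¹).val = (eta n * g.val.transpose * eta n) * g.val * (g⁻¹).val := by
            rw [h1, one_mul]
        _ = _ := by rw [mul_assoc, ← Units.val_mul]; simp
    refine ⟨?_, ?_, ?_⟩
    · calc (g⁻¹).val.transpose * eta n * (g⁻¹).val
          = (g⁻¹).val.transpose * (g.val.transpose * eta n * g.val) * (g⁻¹).val := by rw [g1]
        _ = (g.val * (g⁻¹).val).transpose * eta n * (g.val * (g⁻¹).val) := by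
            rw [Matrix.transpose_mul]; simp only [mul_assoc]
        _ = eta n := by rw [← Units.val_mul]; simp
    · rw [hinv]
      simpa [eta, Matrix.mul_diagonal, Matrix.diagonal_mul] using g2
    · rcases g3 with g3 | g3
      · exact Or.inl g3
      · right
        have : (g.val * (g⁻¹).val).det = 1 := by rw [← Units.val_mul]; simp
        rwa [Matrix.det_mul, g3, one_mul] at this

/-- The group `𝓟 = 𝓛 ⋉ ℝ^d` of the transformations `x ↦ Λ x + a`. -/
@[ext]
structure Poincare (n : ℕ) where
  lor : lorentz n
  tr : Mink n

namespace Poincare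

variable {n : ℕ}

/-- The matrix `Λ` of `(Λ, a)`. -/
def mat (g : Poincare n) : Matrix (Fin (n + 2)) (Fin (n + 2)) ℝ := g.lor.val.val

/-- The pure translation `(1, a)`. -/
def trans (a : Mink n) : Poincare n := ⟨1, a⟩

theorem app_one (x : Mink n) : app 1 x = x := by simp [app]

theorem app_mul (A B : Matrix (Fin (n + 2)) (Fin (n + 2)) ℝ) (x : Mink n) :
    app (A * B) x = app A (app B x) := by simp [app, Matrix.mulVec_mulVec]

theorem app_add (A : Matrix (Fin (n + 2)) (Fin (n + 2)) ℝ) (x y : Mink n) :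
    app A (x + y) = app A x + app A y := by
  simp only [app, WithLp.ofLp_add, Matrix.mulVec_add, WithLp.toLp_add]

theorem app_neg (A : Matrix (Fin (n + 2)) (Fin (n + 2)) ℝ) (x : Mink n) :
    app A (-x) = -app A x := by
  simp only [app, WithLp.ofLp_neg, Matrix.mulVec_neg, WithLp.toLp_neg]

instance : Mul (Poincare n) := ⟨fun g h => ⟨g.lor * h.lor, app g.mat h.tr + g.tr⟩⟩
instance : One (Poincare n) := ⟨⟨1, 0⟩⟩
instance : Inv (Poincare n) := ⟨fun g => ⟨g.lor⁻¹, -app (g.lor⁻¹).val.val g.tr⟩⟩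

theorem mul_def (g h : Poincare n) : g * h = ⟨g.lor * h.lor, app g.mat h.tr + g.tr⟩ := rfl
theorem one_def : (1 : Poincare n) = ⟨1, 0⟩ := rfl
theorem inv_def (g : Poincare n) :
    g⁻¹ = ⟨g.lor⁻¹, -app (g.lor⁻¹).val.val g.tr⟩ := rfl

instance : Group (Poincare n) :=
  Group.ofLeftAxioms
    (fun g h k => by
      ext1
      · exact mul_assoc _ _ _
      · show app (g.lor * h.lor).val.val k.tr + (app g.mat h.tr + g.tr)
          = app g.mat (app h.mat k.tr + h.tr) + g.tr
        rw [app_add, ← app_mul, add_assoc]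
        rfl)
    (fun g => by
      ext1
      · exact one_mul _
      · show app (1 : Matrix (Fin (n + 2)) (Fin (n + 2)) ℝ) g.tr + 0 = g.tr
        rw [app_one, add_zero])
    (fun g => by
      ext1
      · exact inv_mul_cancel _
      · show app (g.lor⁻¹).val.val g.tr + -app (g.lor⁻¹).val.val g.tr = 0
        rw [add_neg_cancel])

/-- The topology of matrix entries and translation vectors. -/
instance : TopologicalSpace (Poincare n) :=
  TopologicalSpace.induced (fun g => (g.mat, g.tr)) inferInstance

/-- The image `λ S` of a region. -/
def image (g : Poincare n) (S : Set (Mink n)) : Set (Mink n) :=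
  (fun x => app g.mat x + g.tr) '' S

theorem trans_add (x y : Mink n) : trans (x + y) = trans x * trans y := by
  ext1
  · exact (one_mul _).symm
  · show x + y = app (1 : Matrix (Fin (n + 2)) (Fin (n + 2)) ℝ) y + x
    rw [app_one, add_comm]

theorem trans_mul (g : Poincare n) (x : Mink n) :
    trans x * g = g * trans (app (g.lor⁻¹).val.val x) := by
  ext1
  · exact (one_mul _).trans (mul_one _).symm
  · show app (1 : Matrix (Fin (n + 2)) (Fin (n + 2)) ℝ) g.tr + x
      = app g.mat (app (g.lor⁻¹).val.val x) + g.tr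
    have : g.mat * (g.lor⁻¹).val.val = 1 := by
      show g.lor.val.val * (g.lor⁻¹).val.val = 1
      rw [← Units.val_mul, ← Subgroup.coe_mul]
      simp
    rw [← app_mul, this, app_one, app_one, add_comm]

end Poincare

open Poincare

/-! ### Wedges -/

/-- The closed forward light cone `V₊`. -/
def forwardCone (n : ℕ) : Set (Mink n) :=
  {p | Real.sqrt (∑ i : Fin (n + 1), p i.succ ^ 2) ≤ p 0}

/-- The standard wedge `{x : x₁ ≥ |x₀|}`. -/
def standardWedge (n : ℕ) : Set (Mink n) := {x | |x 0| ≤ x 1}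

/-- The wedges are the Poincare transforms of the standard wedge. -/
def IsWedge {n : ℕ} (W : Set (Mink n)) : Prop := ∃ g : Poincare n, W = g.image (standardWedge n)

/-- The closure of the causal complement (the points spacelike to all of `W`). -/
def causalCompl {n : ℕ} (W : Set (Mink n)) : Set (Mink n) :=
  closure {x | ∀ y ∈ W, mdot (x - y) (x - y) < 0}

/-- The matrix `Q_κ`. -/
def stdQ (n : ℕ) (κ : ℝ) : Matrix (Fin (n + 2)) (Fin (n + 2)) ℝ :=
  Matrix.of fun i j => if (i = 0 ∧ j = 1) ∨ (i = 1 ∧ j = 0) then κ else 0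

/-- `Λ Q_κ Λ⁻¹` for the Poincare transformation `(Λ, a)`. -/
def rotQ {n : ℕ} (κ : ℝ) (g : Poincare n) : Matrix (Fin (n + 2)) (Fin (n + 2)) ℝ :=
  g.mat * stdQ n κ * g.mat⁻¹

/-! ### Unitary representations and smooth operators -/

variable {n : ℕ} {H : Type*} [NormedAddCommGroup H] [InnerProductSpace ℂ H]

/-- The orbit `x ↦ U(x) ψ` under the translations. -/
def orbit (U : Poincare n →* (H ≃ₗᵢ[ℂ] H)) (ψ : H) (x : Mink n) : H := U (trans x) ψ

/-- The joint spectrum of the generators `P` of the translations, `U(x) = exp (i P x)` with the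
Lorentz product `P x`: the support of the spectral measure `dE`, where
`∫ f(x) U(x) dx = ∫ (∫ f(x) exp (i p x) dx) dE(p)`. -/
def jointSpectrum (U : Poincare n →* (H ≃ₗᵢ[ℂ] H)) : Set (Mink n) :=
  {p | ∀ N ∈ nhds p, ∃ f : SchwartzMap (Mink n) ℂ,
    (∀ q, q ∉ N → ∫ x : Mink n, f x * Complex.exp (Complex.I * (mdot q x : ℂ)) = 0) ∧
    ∃ ψ : H, ∫ x : Mink n, f x • U (trans x) ψ ≠ 0}

/-- The space `𝓓` of the vectors which transform smoothly under the translations. -/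
def smoothVectors (U : Poincare n →* (H ≃ₗᵢ[ℂ] H)) : Submodule ℂ H where
  carrier := {ψ | ContDiff ℝ ∞ (orbit U ψ)}
  add_mem' := by
    intro φ ψ hφ hψ
    have : orbit U (φ + ψ) = fun x => orbit U φ x + orbit U ψ x := by
      funext x; simp [orbit]
    show ContDiff ℝ ∞ _
    rw [this]
    exact ContDiff.add hφ hψ
  zero_mem' := by
    have : orbit U (0 : H) = fun _ => 0 := by funext x; simp [orbit]
    show ContDiff ℝ ∞ _
    rw [this]
    exact contDiff_const
  smul_mem' := by
    intro c ψ hψ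
    have : orbit U (c • ψ) = fun x => c • orbit U ψ x := by funext x; simp [orbit]
    show ContDiff ℝ ∞ _
    rw [this]
    exact ContDiff.const_smul c hψ

theorem orbit_apply_trans (U : Poincare n →* (H ≃ₗᵢ[ℂ] H)) (ψ : H) (x y : Mink n) :
    U (trans y) (orbit U ψ x) = orbit U ψ (y + x) := by
  simp [orbit, trans_add]

theorem contDiff_app (A : Matrix (Fin (n + 2)) (Fin (n + 2)) ℝ) :
    ContDiff ℝ ∞ (app A : Mink n → Mink n) := by
  have : (app A : Mink n → Mink n) = (Matrix.toEuclideanLin A).toContinuousLinearMap := by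
    funext x; rfl
  rw [this]
  exact ContinuousLinearMap.contDiff _

theorem map_mem_smoothVectors (U : Poincare n →* (H ≃ₗᵢ[ℂ] H)) (g : Poincare n) {ψ : H}
    (hψ : ψ ∈ smoothVectors U) : U g ψ ∈ smoothVectors U := by
  have e : orbit U (U g ψ) = fun x => U g (orbit U ψ (app (g.lor⁻¹).val.val x)) := by
    funext x
    show (U (trans x) * U g) ψ = (U g * U (trans _)) ψ
    rw [← map_mul, ← map_mul, trans_mul]
  show ContDiff ℝ ∞ _
  rw [e]
  have hψ' : ContDiff ℝ ∞ (orbit U ψ) := hψ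
  let L : H →L[ℝ] H := ((U g).toContinuousLinearEquiv : H →L[ℂ] H).restrictScalars ℝ
  exact L.contDiff.comp (hψ'.comp (contDiff_app _))

/-- `U(λ)` as a linear automorphism of `𝓓`. -/
def smoothAct (U : Poincare n →* (H ≃ₗᵢ[ℂ] H)) (g : Poincare n) :
    smoothVectors U ≃ₗ[ℂ] smoothVectors U where
  toFun ψ := ⟨U g ψ, map_mem_smoothVectors U g ψ.2⟩
  invFun ψ := ⟨U g⁻¹ ψ, map_mem_smoothVectors U g⁻¹ ψ.2⟩
  map_add' φ ψ := by ext; simp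
  map_smul' c ψ := by ext; simp
  left_inv ψ := by
    ext
    show (U g⁻¹ * U g) (ψ : H) = ψ
    rw [← map_mul]; simp
  right_inv ψ := by
    ext
    show (U g * U g⁻¹) (ψ : H) = ψ
    rw [← map_mul]; simp

/-- Linear operators on the domain `𝓓`. -/
abbrev Op (U : Poincare n →* (H ≃ₗᵢ[ℂ] H)) : Type _ := Module.End ℂ (smoothVectors U)

/-- The adjoint action `α_λ(F) = U(λ) F U(λ)⁻¹`. -/
def alpha (U : Poincare n →* (H ≃ₗᵢ[ℂ] H)) (g : Poincare n) (F : Op U) : Op U :=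
  (smoothAct U g).toLinearMap ∘ₗ F ∘ₗ (smoothAct U g).symm.toLinearMap

/-- The derivative of `x ↦ U(x) ψ` at `0` in the coordinate direction `μ`, which is
`± i P_μ ψ`. -/
def partialU (U : Poincare n →* (H ≃ₗᵢ[ℂ] H)) (μ : Fin (n + 2)) : Op U where
  toFun ψ := ⟨fderiv ℝ (orbit U ψ) 0 (EuclideanSpace.single μ 1), by
    have hψ : ContDiff ℝ ∞ (orbit U (ψ : H)) := ψ.2
    have e : orbit U (fderiv ℝ (orbit U (ψ : H)) 0 (EuclideanSpace.single μ 1))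
        = fun x => fderiv ℝ (orbit U (ψ : H)) x (EuclideanSpace.single μ 1) := by
      funext x
      let L : H →L[ℝ] H :=
        ((U (trans x)).toContinuousLinearEquiv : H →L[ℂ] H).restrictScalars ℝ
      have h0 : HasFDerivAt (orbit U (ψ : H)) (fderiv ℝ (orbit U (ψ : H)) 0) 0 :=
        (hψ.differentiable (by simp) 0).hasFDerivAt
      have h1 : HasFDerivAt (fun y => orbit U (ψ : H) (x + y))
          (L.comp (fderiv ℝ (orbit U (ψ : H)) 0)) 0 := by
        have := L.hasFDerivAt.comp (0 : Mink n) h0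
        refine this.congr_of_eventuallyEq (Filter.Eventually.of_forall fun y => ?_)
        exact (orbit_apply_trans U (ψ : H) y x).symm
      have h2 : HasFDerivAt (fun y => orbit U (ψ : H) (x + y))
          (fderiv ℝ (orbit U (ψ : H)) x) 0 := by
        have hx : HasFDerivAt (orbit U (ψ : H)) (fderiv ℝ (orbit U (ψ : H)) x) (x + 0) := by
          rw [add_zero]; exact (hψ.differentiable (by simp) x).hasFDerivAt
        have := hx.comp (0 : Mink n) ((hasFDerivAt_id (0 : Mink n)).const_add x)
        rw [ContinuousLinearMap.comp_id] at this
        exact this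
      have := h1.unique h2
      rw [← this]
      rfl
    show ContDiff ℝ ∞ _
    rw [e]
    exact (hψ.fderiv_right (m := ∞) (by simp)).clm_apply contDiff_const⟩
  map_add' φ ψ := by
    have hφ : ContDiff ℝ ∞ (orbit U (φ : H)) := φ.2
    have hψ : ContDiff ℝ ∞ (orbit U (ψ : H)) := ψ.2
    ext
    have : orbit U ((φ + ψ : smoothVectors U) : H)
        = orbit U (φ : H) + orbit U (ψ : H) := by
      funext x; simp [orbit]
    show fderiv ℝ (orbit U ((φ + ψ : smoothVectors U) : H)) 0 _ = _
    rw [this, fderiv_add (hφ.differentiable (by simp) 0) (hψ.differentiable (by simp) 0)]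
    rfl
  map_smul' c ψ := by
    have hψ : ContDiff ℝ ∞ (orbit U (ψ : H)) := ψ.2
    ext
    have : orbit U ((c • ψ : smoothVectors U) : H) = c • orbit U (ψ : H) := by
      funext x; simp [orbit]
    show fderiv ℝ (orbit U ((c • ψ : smoothVectors U) : H)) 0 _ = _
    rw [this, fderiv_const_smul (hψ.differentiable (by simp) 0)]
    rfl

/-- The operator `1 + |P|²` on `𝓓`, where `|P|²` is the sum of the squares of the generators. -/
def energyOp (U : Poincare n →* (H ≃ₗᵢ[ℂ] H)) : Op U :=
  1 - ∑ μ : Fin (n + 2), partialU U μ * partialU U μ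

/-- The set `𝔉` of smooth operators: for some `m` the function
`x ↦ (1 + |P|²)^(-m) α_x(F) (1 + |P|²)^(-m)` has values in the bounded operators and is
arbitrarily often differentiable in norm. The bounded operator `B x` is the value at `x`, the
equation determines it because `1 + |P|²` is a symmetric bijection of the dense space `𝓓`. -/
def smoothOps (U : Poincare n →* (H ≃ₗᵢ[ℂ] H)) : Set (Op U) :=
  {F | ∃ (m : ℕ) (B : Mink n → H →L[ℂ] H), ContDiff ℝ ∞ B ∧
    ∀ (x : Mink n) (φ ψ : smoothVectors U),
      ⟪(((energyOp U ^ m) φ : smoothVectors U) : H),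
        B x (((energyOp U ^ m) ψ : smoothVectors U) : H)⟫_ℂ
      = ⟪(φ : H), ((alpha U (trans x) F ψ : smoothVectors U) : H)⟫_ℂ}

/-! ### Warped convolutions -/

/-- `G = F_Q = ∫ dE(p) α_{Qp}(F)` on `𝓓`. The spectral measure enters as the operator-valued
distribution whose Fourier transform is `U`, that is
`dE(p) = (2π)^(-d) (∫ exp (-i p x) U(x) dx) dp`, so the integral is the oscillatory integral
`(2π)^(-d) ∬ exp (-i p x) U(x) α_{Qp}(F) ψ dx dp`: the common limit, for all Schwartz cutoffs
`χ` with `χ 0 = 1`, of the absolutely convergent integrals with the factor `χ (ε x, ε p)`. -/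
def IsWarped (U : Poincare n →* (H ≃ₗᵢ[ℂ] H)) (Q : Matrix (Fin (n + 2)) (Fin (n + 2)) ℝ)
    (F G : Op U) : Prop :=
  ∀ (ψ : smoothVectors U) (χ : SchwartzMap (Mink n × Mink n) ℂ), χ 0 = 1 →
    (∀ ε : ℝ, 0 < ε → MeasureTheory.Integrable (fun z : Mink n × Mink n =>
      (χ (ε • z) * Complex.exp (-Complex.I * (mdot z.2 z.1 : ℂ))) •
        U (trans z.1) ((alpha U (trans (app Q z.2)) F ψ : smoothVectors U) : H))) ∧
    Filter.Tendsto (fun ε : ℝ => (((2 * Real.pi) ^ (n + 2) : ℝ) : ℂ)⁻¹ •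
      ∫ z : Mink n × Mink n,
        (χ (ε • z) * Complex.exp (-Complex.I * (mdot z.2 z.1 : ℂ))) •
          U (trans z.1) ((alpha U (trans (app Q z.2)) F ψ : smoothVectors U) : H))
      (nhdsWithin 0 (Set.Ioi 0)) (nhds (G ψ : H))

open Classical in
/-- The warped convolution `F_Q` (with the value `0` if the defining integral diverges). -/
def warp (U : Poincare n →* (H ≃ₗᵢ[ℂ] H)) (Q : Matrix (Fin (n + 2)) (Fin (n + 2)) ℝ)
    (F : Op U) : Op U :=
  if h : ∃ G, IsWarped U Q F G then h.choose else 0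

/-! ### Vacuum and wedge algebras -/

/-- A unit vector invariant under `U`, unique up to a phase. -/
structure IsVacuum (U : Poincare n →* (H ≃ₗᵢ[ℂ] H)) (Ω : H) : Prop where
  norm_eq : ‖Ω‖ = 1
  invariant : ∀ g, U g Ω = Ω
  unique : ∀ ψ : H, ‖ψ‖ = 1 → (∀ g, U g ψ = ψ) → ∃ c : ℂ, ‖c‖ = 1 ∧ ψ = c • Ω

theorem IsVacuum.mem {U : Poincare n →* (H ≃ₗᵢ[ℂ] H)} {Ω : H} (h : IsVacuum U Ω) :
    Ω ∈ smoothVectors U := by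
  have : orbit U Ω = fun _ => Ω := by funext x; exact h.invariant _
  show ContDiff ℝ ∞ _
  rw [this]
  exact contDiff_const

/-- The vacuum as an element of `𝓓`. -/
def vac {U : Poincare n →* (H ≃ₗᵢ[ℂ] H)} {Ω : H} (h : IsVacuum U Ω) : smoothVectors U :=
  ⟨Ω, h.mem⟩

/-- A family of unital *-algebras `𝔄(W) ⊂ 𝔉`, indexed by the wedges (its values on other sets
play no role), with isotony, covariance, locality and the Reeh-Schlieder property. The
involution is `A ↦ A* ↾ 𝓓`. -/
structure IsWedgeFamily {U : Poincare n →* (H ≃ₗᵢ[ℂ] H)} {Ω : H} (hΩ : IsVacuum U Ω)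
    (𝔄 : Set (Mink n) → Subalgebra ℂ (Op U)) : Prop where
  smooth : ∀ W, IsWedge W → ∀ A ∈ 𝔄 W, A ∈ smoothOps U
  star : ∀ W, IsWedge W → ∀ A ∈ 𝔄 W, ∃ B ∈ 𝔄 W, ∀ φ ψ : smoothVectors U,
    ⟪(φ : H), (A ψ : H)⟫_ℂ = ⟪(B φ : H), (ψ : H)⟫_ℂ
  isotony : ∀ W₁ W₂, IsWedge W₁ → IsWedge W₂ → W₁ ⊆ W₂ → 𝔄 W₁ ≤ 𝔄 W₂
  covariance : ∀ W, IsWedge W → ∀ g : Poincare n,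
    alpha U g '' (𝔄 W : Set (Op U)) = (𝔄 (g.image W) : Set (Op U))
  locality : ∀ W, IsWedge W → ∀ A ∈ 𝔄 W, ∀ B ∈ 𝔄 (causalCompl W), A * B = B * A
  reehSchlieder : ∀ W, IsWedge W → Dense {v : H | ∃ A ∈ 𝔄 W, v = (A (vac hΩ) : H)}

/-- The deformed algebra `𝔄_κ(W)`, generated by the operators `A_{Λ Q_κ Λ⁻¹}` with `A ∈ 𝔄(W)`,
where `W = λ W₀` and `λ = (Λ, a)`. -/
def deformed {U : Poincare n →* (H ≃ₗᵢ[ℂ] H)} (κ : ℝ)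
    (𝔄 : Set (Mink n) → Subalgebra ℂ (Op U)) (W : Set (Mink n)) : Subalgebra ℂ (Op U) :=
  Algebra.adjoin ℂ {B | ∃ g : Poincare n, W = g.image (standardWedge n) ∧
    ∃ A ∈ 𝔄 W, B = warp U (rotQ κ g) A}

end WarpedQFT

end

open WarpedQFT

/-!
The warped convolution `F_Q ψ` is an oscillatory integral over the pairs `(x, p)` with the phase
`p x`, which is a nondegenerate quadratic form. The proof rests on a small calculus of such
integrals. For a nondegenerate quadratic form `q` and a symbol `a`, that is, a smooth function all
of whose derivatives are bounded, the integral `osc q μ a` of `exp (-i q) a` is the limit of the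
integrals with a cutoff `χ (ε z)`. The limit exists and does not depend on the cutoff
(`tendsto_oscReg`), it is bounded by finitely many derivatives of the symbol (`norm_osc_le`), it is
continuous under pointwise convergence of bounded families of symbols (`tendsto_osc`), and it is
invariant under the linear maps which preserve `q` (`osc_comp_clm_of_invariant`). All this follows
from the estimate `norm_integral_oscFactor_smul_le`.

To apply the calculus, the smooth operators are characterized without reference to forms: `F` is
smooth if and only if all iterated commutators of `F` with the generators of the translations are
bounded by a fixed power of `1 + |P|²` (`exists_mem_tame_of_mem_smoothOps`,
`mem_smoothOps_of_mem_tame`). It follows that `(u, v) ↦ U(u) F U(v) ψ`, called `sandwich F ψ`, is a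
symbol. Hence the vectors `warpVec Q F ψ` exist, and they are values of the warped convolution
(`isWarped_of_warpVec`). Warping commutes with the commutators (`ad_warp`), so `norm_osc_le` shows
that `F_Q` is again smooth (`warp_mem_tame`, `warp_mem_smoothOps`). If `ψ` is the vacuum, the
symbol does not depend on `p`, and the integral is the value of the symbol at `x = 0` (`osc_fst`),
so `F_Q Ω = F Ω`.

The matrices `Q = Λ Q_κ Λ⁻¹` satisfy `Q³ = κ² Q` (`rotQ_cube`). For such matrices `x` and `Q p` may
be exchanged (`osc_exchange`), which turns `∫ dE(p) α_{Qp}(F)` into `∫ α_{Qp}(F) dE(p)`, and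
therefore the adjoint of `F_Q` is `(F*)_Q` (`inner_warp_of_adjoint`). Covariance,
`α_g(F_Q) = (α_g F)_{Λ Q Λ⁻¹}`, is the invariance of the phase under Lorentz transformations
(`alpha_warp`).

For locality, the matrix elements of `F_Q G_{-Q}` and `G_{-Q} F_Q` are written as one oscillatory
integral over `((x, p), (y, k))` of matrix elements of `α_{Qp}(F) α_{-Qk}(G)`, respectively of
`α_{-Qk}(G) α_{Qp}(F)`, between `U(x) φ` and `U(y) ψ`. By the spectrum condition only the momenta
`p` and `k` in the forward cone contribute (`osc_eq_zero_of_forwardCone`), so `F_Q` and `G_{-Q}`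
commute if the translated operators commute for these momenta (`warp_mul_warp_neg`). For `F` in the
algebra of a wedge and `G` in the one of its causal complement they do so: the translations by
`Q p` map the wedge into itself (`image_trans_rotQ_subset`), the causal complement is the image of
the wedge under a rotation by `π` (`causalCompl_wedge`), and this rotation reverses the sign of `Q`
(`rotQ_mul_wedgeFlip`). Independence of the choice of `Λ` and isotony hold since `Q` is the same for
wedges which are contained in one another (`rotQ_eq_of_subset`). The Reeh-Schlieder property is
inherited because of `F_Q Ω = F Ω`.
-/

set_option linter.unusedSectionVars false

namespace WarpedQFT

/-! ### Oscillatory integrals -/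

section Oscillatory

open MeasureTheory Filter Topology

variable {Z : Type*} [NormedAddCommGroup Z] [NormedSpace ℝ Z]
  {V : Type*} [NormedAddCommGroup V] [NormedSpace ℂ V]

/-- A nondegenerate quadratic form `q z = β z z`, given by a bilinear form `β`. -/
def IsPhase (q : Z → ℝ) : Prop :=
  ∃ β : Z →L[ℝ] Z →L[ℝ] ℝ, (∀ z, q z = β z z) ∧ ∀ k, (∀ w, β w k + β k w = 0) → k = 0

/-- The oscillating factor `exp (-i q)`. -/
noncomputable def oscFactor (q : Z → ℝ) (z : Z) : ℂ := Complex.exp (-Complex.I * (q z : ℂ))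

theorem norm_oscFactor (q : Z → ℝ) (z : Z) : ‖oscFactor q z‖ = 1 := by
  rw [oscFactor, Complex.norm_exp]
  simp

theorem IsPhase.contDiff {q : Z → ℝ} (hq : IsPhase q) : ContDiff ℝ ∞ q := by
  obtain ⟨β, h, -⟩ := hq
  have : q = fun z => β z z := funext h
  rw [this]
  fun_prop

theorem IsPhase.contDiff_oscFactor {q : Z → ℝ} (hq : IsPhase q) :
    ContDiff ℝ ∞ (oscFactor q) := by
  have h1 : ContDiff ℝ ∞ fun z => (q z : ℂ) := Complex.ofRealCLM.contDiff.comp hq.contDiff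
  exact Complex.contDiff_exp.comp (contDiff_const.mul h1)

theorem IsPhase.continuous_oscFactor {q : Z → ℝ} (hq : IsPhase q) :
    Continuous (oscFactor q) := hq.contDiff_oscFactor.continuous

variable [FiniteDimensional ℝ Z]

/-- A nondegenerate bilinear form separates vectors quantitatively, since an injective linear map on
a finite dimensional space is bounded below. -/
theorem exists_bilin_lower_bound {B : Z →L[ℝ] Z →L[ℝ] ℝ}
    (hB : ∀ k, (∀ w, B w k = 0) → k = 0) :
    ∃ c > 0, ∀ k : Z, ∃ v : Z, ‖v‖ ≤ 1 ∧ c * ‖k‖ ≤ |B v k| := by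
  have hinj : LinearMap.ker (B.flip : Z →ₗ[ℝ] (Z →L[ℝ] ℝ)) = ⊥ := by
    rw [LinearMap.ker_eq_bot']
    intro k hk
    apply hB
    intro w
    have := DFunLike.congr_fun hk w
    simpa using this
  obtain ⟨K, hK, hanti⟩ := LinearMap.exists_antilipschitzWith _ hinj
  refine ⟨(2 * K : ℝ)⁻¹, by positivity, fun k => ?_⟩
  rcases eq_or_ne k 0 with rfl | hk
  · exact ⟨0, by simp⟩
  have h1 : ‖k‖ ≤ K * ‖B.flip k‖ := by
    simpa using ZeroHomClass.bound_of_antilipschitz (B.flip : Z →ₗ[ℝ] (Z →L[ℝ] ℝ)) hanti k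
  have hpos : 0 < ‖k‖ := norm_pos_iff.2 hk
  have hK' : (0 : ℝ) < K := by exact_mod_cast hK
  have hlt : ‖k‖ * (2 * K : ℝ)⁻¹ < ‖B.flip k‖ := by
    rw [mul_inv_lt_iff₀ (by positivity)]
    nlinarith
  obtain ⟨v, hv, hv'⟩ := (B.flip k).exists_lt_apply_of_lt_opNorm hlt
  refine ⟨v, hv.le, ?_⟩
  rw [mul_comm]
  simpa using hv'.le

variable [MeasurableSpace Z] [BorelSpace Z] {μ : Measure Z} [μ.IsAddHaarMeasure]

/-- Decay of the Fourier integral, measured with a nondegenerate bilinear form. -/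
theorem fourierIntegral_decay {B : Z →L[ℝ] Z →L[ℝ] ℝ}
    (hB : ∀ k, (∀ w, B w k = 0) → k = 0) (N : ℕ) :
    ∃ C > 0, ∀ (φ : Z → V), ContDiff ℝ ∞ φ → HasCompactSupport φ → ∀ k : Z,
      (1 + ‖k‖) ^ N * ‖VectorFourier.fourierIntegral Real.fourierChar μ B.toLinearMap₁₂ φ k‖ ≤
        C * ∑ j ∈ Finset.range (N + 1), ∫ v, ‖iteratedFDeriv ℝ j φ v‖ ∂μ := by
  obtain ⟨c, hc, hlow⟩ := exists_bilin_lower_bound hB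
  refine ⟨2 ^ N * (1 + c⁻¹ ^ N * 2 ^ N), by positivity, fun φ hφ hsupp k => ?_⟩
  set S := ∑ j ∈ Finset.range (N + 1), ∫ v, ‖iteratedFDeriv ℝ j φ v‖ ∂μ with hS
  have hS0 : ∫ v, ‖φ v‖ ∂μ ≤ S := by
    have := Finset.single_le_sum (f := fun j => ∫ v, ‖iteratedFDeriv ℝ j φ v‖ ∂μ)
      (s := Finset.range (N + 1)) (fun j _ => integral_nonneg fun _ => norm_nonneg _)
      (Finset.mem_range.2 (Nat.succ_pos N))
    simpa using this
  have hint : ∀ (k n : ℕ), (k : ℕ∞) ≤ 0 → (n : ℕ∞) ≤ ⊤ →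
      Integrable (fun v ↦ ‖v‖ ^ k * ‖iteratedFDeriv ℝ n φ v‖) μ := by
    intro k n _ _
    apply Continuous.integrable_of_hasCompactSupport
    · have := hφ.continuous_iteratedFDeriv (m := n) (by exact_mod_cast le_top)
      fun_prop
    · exact ((hsupp.iteratedFDeriv n).norm).mul_left
  set F := ‖VectorFourier.fourierIntegral Real.fourierChar μ B.toLinearMap₁₂ φ k‖ with hF
  have h0 : F ≤ S := (VectorFourier.norm_fourierIntegral_le_integral_norm _ _ _ _ _).trans hS0
  obtain ⟨v, hv, hvk⟩ := hlow k
  have h1 := VectorFourier.pow_mul_norm_iteratedFDeriv_fourierIntegral_le (K := 0) (N := ⊤) B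
    (μ := μ) (by exact_mod_cast hφ) hint (k := 0) (n := N) le_rfl le_top v k
  have h2 : (c * ‖k‖) ^ N * F ≤ 2 ^ N * S := by
    have e : ∑ p ∈ Finset.range (0 + 1) ×ˢ Finset.range (N + 1),
          ∫ v, ‖v‖ ^ p.1 * ‖iteratedFDeriv ℝ p.2 φ v‖ ∂μ = S := by
      rw [Finset.sum_product]
      simp [hS]
    rw [e] at h1
    have hFnn : 0 ≤ F := norm_nonneg _
    have hSnn : 0 ≤ S := le_trans hFnn h0
    calc (c * ‖k‖) ^ N * F ≤ |B v k| ^ N * F := by gcongr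
      _ ≤ ‖v‖ ^ N * (2 * Real.pi * ‖B‖) ^ 0 * (2 * (0 : ℕ) + 2) ^ N * S := by
          simpa using h1
      _ ≤ 1 * (2 ^ N * S) := by
          simp only [pow_zero, mul_one, Nat.cast_zero, mul_zero, zero_add, mul_assoc]
          gcongr
          exact pow_le_one₀ (norm_nonneg _) hv
      _ = _ := one_mul _
  have hFnn : 0 ≤ F := norm_nonneg _
  have h3 : ‖k‖ ^ N * F ≤ c⁻¹ ^ N * 2 ^ N * S := by
    rw [mul_pow, mul_assoc] at h2
    rw [inv_pow, mul_assoc, ← div_eq_inv_mul, le_div_iff₀' (by positivity)]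
    exact h2
  have h4 : (1 + ‖k‖) ^ N ≤ 2 ^ N * (1 + ‖k‖ ^ N) := by
    have := add_pow_le (zero_le_one (α := ℝ)) (norm_nonneg k) N
    refine this.trans ?_
    simp only [one_pow]
    gcongr
    · norm_num
    · omega
  calc (1 + ‖k‖) ^ N * F ≤ 2 ^ N * (1 + ‖k‖ ^ N) * F := by gcongr
    _ = 2 ^ N * (F + ‖k‖ ^ N * F) := by ring
    _ ≤ 2 ^ N * (S + c⁻¹ ^ N * 2 ^ N * S) := by gcongr
    _ = _ := by ring

end Oscillatory

section Oscillatory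

open MeasureTheory Filter Topology
open scoped Convolution

variable {Z : Type*} [NormedAddCommGroup Z] [NormedSpace ℝ Z]
  {V : Type*} [NormedAddCommGroup V] [NormedSpace ℂ V]

theorem norm_iteratedFDeriv_smul_le_of_bounds {g : Z → ℂ} {f : Z → V} (hg : ContDiff ℝ ∞ g)
    (hf : ContDiff ℝ ∞ f) {K : ℕ} {z : Z} {A M : ℝ} (hA : ∀ j ≤ K, ‖iteratedFDeriv ℝ j g z‖ ≤ A)
    (hM : ∀ j ≤ K, ‖iteratedFDeriv ℝ j f z‖ ≤ M) :
    ∀ j ≤ K, ‖iteratedFDeriv ℝ j (fun z => g z • f z) z‖ ≤ 2 ^ K * (A * M) := by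
  intro j hj
  have hA0 : 0 ≤ A := (norm_nonneg _).trans (hA 0 (Nat.zero_le _))
  have hM0 : 0 ≤ M := (norm_nonneg _).trans (hM 0 (Nat.zero_le _))
  refine (norm_iteratedFDeriv_smul_le (N := ∞) hg hf z (by exact_mod_cast le_top)).trans ?_
  calc ∑ i ∈ Finset.range (j + 1), (j.choose i : ℝ) * ‖iteratedFDeriv ℝ i g z‖ *
        ‖iteratedFDeriv ℝ (j - i) f z‖
      ≤ ∑ i ∈ Finset.range (j + 1), (j.choose i : ℝ) * (A * M) := by
        refine Finset.sum_le_sum fun i hi => ?_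
        rw [mul_assoc]
        have := Finset.mem_range.1 hi
        gcongr
        · exact hA i (by omega)
        · exact hM _ (by omega)
    _ = 2 ^ j * (A * M) := by
        rw [← Finset.sum_mul]
        congr 1
        exact_mod_cast Nat.sum_range_choose j
    _ ≤ _ := by
        gcongr
        norm_num

variable [FiniteDimensional ℝ Z]

variable [MeasurableSpace Z] [BorelSpace Z] {μ : Measure Z} [μ.IsAddHaarMeasure]

variable (Z) in
/-- The number of derivatives which control oscillatory integrals on `Z`. The decay of order
`dim Z + 1` is integrable, and one further power compensates a linear growth of the symbol. -/
noncomputable def oscOrder : ℕ := Module.finrank ℝ Z + 2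

/-- The basic estimate for oscillatory integrals. A partition of unity by the translates of a bump
function reduces it to the decay of Fourier integrals of functions of compact support: near `k` the
phase is `q k` plus the linear
function given by the polar form of `q` at `k`, up to the fixed factor `exp (-i q)`. -/
theorem norm_integral_oscFactor_smul_le [CompleteSpace V] {q : Z → ℝ} (hq : IsPhase q) :
    ∃ C > 0, ∀ (f : Z → V) (M : ℝ), ContDiff ℝ ∞ f → Integrable f μ →
      (∀ j ≤ oscOrder Z, ∀ z, ‖iteratedFDeriv ℝ j f z‖ ≤ M * (1 + ‖z‖)) →
      ‖∫ z, oscFactor q z • f z ∂μ‖ ≤ C * M := by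
  obtain ⟨β, hβ, hnd⟩ := id hq
  set N := oscOrder Z with hN
  let B : Z →L[ℝ] Z →L[ℝ] ℝ := (2 * Real.pi)⁻¹ • (β + β.flip)
  have hB : ∀ k, (∀ w, B w k = 0) → k = 0 := by
    intro k hk
    refine hnd k fun w => ?_
    have := hk w
    have h2 : (2 * Real.pi)⁻¹ * (β w k + β k w) = 0 := this
    exact (mul_eq_zero.1 h2).resolve_left (by positivity)
  obtain ⟨C, hC, hdec⟩ := fourierIntegral_decay (V := V) (μ := μ) hB N
  let b : ContDiffBump (0 : Z) := default
  let ρ : Z → ℝ := b.normed μ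
  have hρs : ContDiff ℝ ∞ ρ := b.contDiff_normed
  have hρc : HasCompactSupport ρ := b.hasCompactSupport_normed
  have hρ1 : ∫ z, ρ z ∂μ = 1 := b.integral_normed
  let G : Z → ℂ := fun w => oscFactor q w * (ρ w : ℂ)
  have hρs' : ContDiff ℝ ∞ fun w => (ρ w : ℂ) := Complex.ofRealCLM.contDiff.comp hρs
  have hGs : ContDiff ℝ ∞ G := hq.contDiff_oscFactor.mul hρs'
  have hGc : HasCompactSupport G := (hρc.comp_left (g := fun x : ℝ => (x : ℂ)) (by simp)).mul_left
  let W : ℕ → Z → ℝ := fun j w => ∑ i ∈ Finset.range (j + 1),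
    (j.choose i : ℝ) * (‖iteratedFDeriv ℝ i G w‖ * (1 + ‖w‖))
  have hW : ∀ j, Integrable (W j) μ := by
    intro j
    refine integrable_finsetSum _ fun i _ => Integrable.const_mul ?_ _
    apply Continuous.integrable_of_hasCompactSupport
    · have := hGs.continuous_iteratedFDeriv (m := i) (by exact_mod_cast le_top)
      fun_prop
    · exact ((hGc.iteratedFDeriv i).norm).mul_right
  let S : ℝ := ∑ j ∈ Finset.range (N + 1), ∫ w, W j w ∂μ
  have hS : 0 ≤ S := Finset.sum_nonneg fun j _ => integral_nonneg fun w =>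
    Finset.sum_nonneg fun i _ => by positivity
  let I : ℝ := ∫ k : Z, (1 + ‖k‖) ^ (-(Module.finrank ℝ Z + 1 : ℝ)) ∂μ
  have hIint : Integrable (fun k : Z => (1 + ‖k‖) ^ (-(Module.finrank ℝ Z + 1 : ℝ))) μ :=
    integrable_one_add_norm (by linarith)
  have hI : 0 ≤ I := integral_nonneg fun k => by positivity
  refine ⟨C * S * I + 1, by positivity, fun f M hf hfi hfM => ?_⟩
  have hM : 0 ≤ M := by
    have := (norm_nonneg _).trans (hfM 0 (Nat.zero_le _) 0)
    simpa using this
  let φ : Z → Z → V := fun k w => G w • f (w + k)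
  have hfk : ∀ k, ContDiff ℝ ∞ fun w => f (w + k) := fun k =>
    hf.comp (contDiff_id.add contDiff_const)
  have hφs : ∀ k, ContDiff ℝ ∞ (φ k) := fun k => hGs.smul (hfk k)
  have hφc : ∀ k, HasCompactSupport (φ k) := fun k => hGc.smul_right
  have hφb : ∀ k, ∑ j ∈ Finset.range (N + 1), ∫ v, ‖iteratedFDeriv ℝ j (φ k) v‖ ∂μ
      ≤ M * (1 + ‖k‖) * S := by
    intro k
    rw [Finset.mul_sum]
    refine Finset.sum_le_sum fun j hj => ?_
    rw [← integral_const_mul]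
    refine integral_mono_of_nonneg (Eventually.of_forall fun _ => norm_nonneg _)
      ((hW j).const_mul _) (Eventually.of_forall fun w => ?_)
    refine (norm_iteratedFDeriv_smul_le (N := ∞) hGs (hfk k) w (by exact_mod_cast le_top)).trans ?_
    simp only [W, Finset.mul_sum]
    refine Finset.sum_le_sum fun i hi => ?_
    have h1 : ‖iteratedFDeriv ℝ (j - i) (fun w => f (w + k)) w‖
        ≤ M * ((1 + ‖w‖) * (1 + ‖k‖)) := by
      rw [iteratedFDeriv_comp_add_right]
      have hj' := Finset.mem_range.1 hj
      refine (hfM (j - i) (by omega) _).trans ?_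
      gcongr
      nlinarith [norm_add_le w k, norm_nonneg w, norm_nonneg k,
        mul_nonneg (norm_nonneg w) (norm_nonneg k)]
    calc (j.choose i : ℝ) * ‖iteratedFDeriv ℝ i G w‖ *
          ‖iteratedFDeriv ℝ (j - i) (fun w => f (w + k)) w‖
        ≤ (j.choose i : ℝ) * ‖iteratedFDeriv ℝ i G w‖ * (M * ((1 + ‖w‖) * (1 + ‖k‖))) := by
          gcongr
      _ = _ := by ring
  let F : Z → V := fun z => oscFactor q z • f z
  have hFi : Integrable F μ := by
    refine hfi.bdd_smul 1 hq.continuous_oscFactor.aestronglyMeasurable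
      (Eventually.of_forall fun z => (norm_oscFactor q z).le)
  have hρi : Integrable ρ μ := hρs.continuous.integrable_of_hasCompactSupport hρc
  let L : V →L[ℝ] ℝ →L[ℝ] V := (ContinuousLinearMap.lsmul ℝ ℝ).flip
  -- convolution with `ρ` inserts the partition of unity by the translates of `ρ`
  have hconv : ∫ k, (F ⋆[L, μ] ρ) k ∂μ = ∫ z, F z ∂μ := by
    rw [integral_convolution L hFi hρi, hρ1]
    simp [L]
  have hpt : ∀ k, ‖(F ⋆[L, μ] ρ) k‖ ≤
      C * S * M * (1 + ‖k‖) ^ (-(Module.finrank ℝ Z + 1 : ℝ)) := by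
    intro k
    -- the value at `k` is a Fourier integral, since `q (w + k) = q w + q k + 2 π B w k`
    have e1 : (F ⋆[L, μ] ρ) k = oscFactor q k •
        VectorFourier.fourierIntegral Real.fourierChar μ B.toLinearMap₁₂ (φ k) k := by
      rw [convolution, ← integral_add_right_eq_self _ k, VectorFourier.fourierIntegral,
        ← integral_smul]
      refine integral_congr_ae (Eventually.of_forall fun w => ?_)
      have e2 : ρ (k - (w + k)) = ρ w := by
        have : k - (w + k) = -w := by abel
        rw [this]
        exact b.normed_neg w
      have e3 : oscFactor q (w + k) = oscFactor q k * oscFactor q w *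
          (Real.fourierChar (-(B w k)) : ℂ) := by
        simp only [oscFactor, Real.fourierChar_apply, ← Complex.exp_add]
        congr 1
        have : q (w + k) = q w + q k + 2 * Real.pi * B w k := by
          simp only [hβ, B]
          simp
          field_simp
          ring
        rw [this]
        push_cast
        ring
      simp only [L, F, φ, G, ContinuousLinearMap.flip_apply, ContinuousLinearMap.lsmul_apply,
        e2, e3, Circle.smul_def]
      rw [← Complex.coe_smul, smul_smul, smul_smul, smul_smul]
      congr 1
      simp
      ring
    rw [e1, norm_smul, norm_oscFactor, one_mul]
    have h := (hdec (φ k) (hφs k) (hφc k) k).trans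
      (mul_le_mul_of_nonneg_left (hφb k) hC.le)
    set Y := ‖VectorFourier.fourierIntegral Real.fourierChar μ B.toLinearMap₁₂ (φ k) k‖
    have hp : 0 < 1 + ‖k‖ := by positivity
    have e4 : (1 + ‖k‖) ^ (-(Module.finrank ℝ Z + 1 : ℝ)) =
        ((1 + ‖k‖) ^ (Module.finrank ℝ Z + 1))⁻¹ := by
      rw [Real.rpow_neg hp.le]
      congr 1
      exact_mod_cast Real.rpow_natCast (1 + ‖k‖) (Module.finrank ℝ Z + 1)
    rw [e4, ← div_eq_mul_inv, le_div_iff₀ (by positivity)]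
    have e5 : (1 + ‖k‖) ^ N = (1 + ‖k‖) ^ (Module.finrank ℝ Z + 1) * (1 + ‖k‖) := by
      rw [← pow_succ]; rfl
    rw [e5] at h
    have h' : ((1 + ‖k‖) ^ (Module.finrank ℝ Z + 1) * Y) * (1 + ‖k‖)
        ≤ (C * S * M) * (1 + ‖k‖) := by linarith
    have := le_of_mul_le_mul_right h' hp
    linarith
  calc ‖∫ z, F z ∂μ‖ = ‖∫ k, (F ⋆[L, μ] ρ) k ∂μ‖ := by rw [hconv]
    _ ≤ ∫ k, C * S * M * (1 + ‖k‖) ^ (-(Module.finrank ℝ Z + 1 : ℝ)) ∂μ :=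
        norm_integral_le_of_norm_le (hIint.const_mul _) (Eventually.of_forall hpt)
    _ = C * S * M * I := integral_const_mul _ _
    _ ≤ (C * S * I + 1) * M := by nlinarith

end Oscillatory

section Oscillatory

open MeasureTheory Filter Topology

variable {Z : Type*} [NormedAddCommGroup Z] [NormedSpace ℝ Z]
  {V : Type*} [NormedAddCommGroup V] [NormedSpace ℂ V]

/-- Symbols: smooth functions all of whose derivatives are bounded. -/
def IsSymbol (a : Z → V) : Prop :=
  ContDiff ℝ ∞ a ∧ ∀ j, ∃ C, ∀ z, ‖iteratedFDeriv ℝ j a z‖ ≤ C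

/-- `M` bounds the function `a` together with its derivatives up to the order `K`. -/
def SymBound (K : ℕ) (M : ℝ) (a : Z → V) : Prop :=
  ∀ j ≤ K, ∀ z, ‖iteratedFDeriv ℝ j a z‖ ≤ M

theorem SymBound.nonneg {K : ℕ} {M : ℝ} {a : Z → V} (h : SymBound K M a) : 0 ≤ M :=
  (norm_nonneg _).trans (h 0 (Nat.zero_le _) 0)

theorem SymBound.norm_le {K : ℕ} {M : ℝ} {a : Z → V} (h : SymBound K M a) (z : Z) :
    ‖a z‖ ≤ M := by
  simpa using h 0 (Nat.zero_le _) z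

theorem IsSymbol.symBound {a : Z → V} (ha : IsSymbol a) (K : ℕ) : ∃ M, SymBound K M a := by
  choose C hC using ha.2
  refine ⟨∑ j ∈ Finset.range (K + 1), |C j|, fun j hj z => ?_⟩
  exact ((hC j z).trans (le_abs_self _)).trans
    (Finset.single_le_sum (f := fun j => |C j|) (fun _ _ => abs_nonneg _)
      (Finset.mem_range.2 (by omega)))

theorem isSymbol_of_symBound {a : Z → V} (h : ContDiff ℝ ∞ a) (hb : ∀ K, ∃ M, SymBound K M a) :
    IsSymbol a := ⟨h, fun j => (hb j).imp fun _ hM => hM j le_rfl⟩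

theorem IsSymbol.continuous {a : Z → V} (ha : IsSymbol a) : Continuous a := ha.1.continuous

theorem IsSymbol.exists_norm_le {a : Z → V} (ha : IsSymbol a) : ∃ M, ∀ z, ‖a z‖ ≤ M := by
  obtain ⟨M, hM⟩ := ha.2 0
  exact ⟨M, fun z => by simpa using hM z⟩

theorem isSymbol_const (v : V) : IsSymbol fun _ : Z => v := by
  refine ⟨contDiff_const, fun j => ⟨‖v‖, fun z => ?_⟩⟩
  rcases Nat.eq_zero_or_pos j with rfl | hj
  · simp
  · rw [iteratedFDeriv_const_of_ne hj.ne']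
    simp

theorem SymBound.smul {K : ℕ} {A M : ℝ} {g : Z → ℂ} {a : Z → V} (hg : ContDiff ℝ ∞ g)
    (ha : ContDiff ℝ ∞ a) (hA : SymBound K A g) (hM : SymBound K M a) :
    SymBound K (2 ^ K * (A * M)) fun z => g z • a z := fun j hj z =>
  norm_iteratedFDeriv_smul_le_of_bounds hg ha (fun i hi => hA i hi z) (fun i hi => hM i hi z) j hj

theorem IsSymbol.smul {g : Z → ℂ} {a : Z → V} (hg : IsSymbol g) (ha : IsSymbol a) :
    IsSymbol fun z => g z • a z := by
  refine isSymbol_of_symBound (hg.1.smul ha.1) fun K => ?_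
  obtain ⟨A, hA⟩ := hg.symBound K
  obtain ⟨M, hM⟩ := ha.symBound K
  exact ⟨_, SymBound.smul hg.1 ha.1 hA hM⟩

theorem SymBound.add {K : ℕ} {A M : ℝ} {a b : Z → V} (ha : ContDiff ℝ ∞ a)
    (hb : ContDiff ℝ ∞ b) (hA : SymBound K A a) (hM : SymBound K M b) :
    SymBound K (A + M) fun z => a z + b z := fun j hj z => by
  have := iteratedFDeriv_add_apply (𝕜 := ℝ) (i := j) (x := z) (f := a) (g := b)
    (ha.contDiffAt.of_le (by exact_mod_cast le_top))
    (hb.contDiffAt.of_le (by exact_mod_cast le_top))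
  have e : (fun z => a z + b z) = a + b := rfl
  rw [e, this]
  exact (norm_add_le _ _).trans (add_le_add (hA j hj z) (hM j hj z))

theorem IsSymbol.add {a b : Z → V} (ha : IsSymbol a) (hb : IsSymbol b) :
    IsSymbol fun z => a z + b z := by
  refine isSymbol_of_symBound (ha.1.add hb.1) fun K => ?_
  obtain ⟨A, hA⟩ := ha.symBound K
  obtain ⟨M, hM⟩ := hb.symBound K
  exact ⟨_, SymBound.add ha.1 hb.1 hA hM⟩

theorem IsSymbol.clm_comp {W : Type*} [NormedAddCommGroup W] [NormedSpace ℂ W]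
    (L : V →L[ℝ] W) {a : Z → V} (ha : IsSymbol a) : IsSymbol fun z => L (a z) := by
  refine ⟨L.contDiff.comp ha.1, fun j => ?_⟩
  obtain ⟨C, hC⟩ := ha.2 j
  refine ⟨‖L‖ * C, fun z => ?_⟩
  refine (L.norm_iteratedFDeriv_comp_left (N := ∞) ha.1.contDiffAt
    (by exact_mod_cast le_top)).trans ?_
  gcongr
  exact hC z

theorem norm_iteratedFDeriv_comp_clm_le {Y : Type*} [NormedAddCommGroup Y] [NormedSpace ℝ Y]
    {a : Z → V} (ha : ContDiff ℝ ∞ a) (L : Y →L[ℝ] Z) (j : ℕ) (y : Y) :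
    ‖iteratedFDeriv ℝ j (fun y => a (L y)) y‖ ≤ ‖iteratedFDeriv ℝ j a (L y)‖ * ‖L‖ ^ j := by
  have e : (fun y => a (L y)) = a ∘ L := rfl
  rw [e, L.iteratedFDeriv_comp_right ha y (by exact_mod_cast le_top)]
  refine (ContinuousMultilinearMap.norm_compContinuousLinearMap_le _ _).trans ?_
  simp

theorem SymBound.comp_clm {Y : Type*} [NormedAddCommGroup Y] [NormedSpace ℝ Y] {K : ℕ} {M R : ℝ}
    {a : Z → V} (ha : ContDiff ℝ ∞ a) (hM : SymBound K M a) {L : Y →L[ℝ] Z} (hL : ‖L‖ ≤ R)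
    (hR : 1 ≤ R) : SymBound K (M * R ^ K) fun y => a (L y) := by
  intro j hj y
  have := hM.nonneg
  refine (norm_iteratedFDeriv_comp_clm_le ha L j y).trans ?_
  gcongr
  · exact hM j hj _
  · exact (pow_le_pow_left₀ (norm_nonneg _) hL j).trans (pow_le_pow_right₀ hR hj)

theorem IsSymbol.comp_clm {Y : Type*} [NormedAddCommGroup Y] [NormedSpace ℝ Y]
    {a : Z → V} (ha : IsSymbol a) (L : Y →L[ℝ] Z) : IsSymbol fun y => a (L y) := by
  refine isSymbol_of_symBound (ha.1.comp L.contDiff) fun K => ?_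
  obtain ⟨M, hM⟩ := ha.symBound K
  exact ⟨_, SymBound.comp_clm ha.1 hM (le_max_left ‖L‖ 1) (le_max_right _ _)⟩

theorem SymBound.comp_add {K : ℕ} {M : ℝ} {a : Z → V} (hM : SymBound K M a) (c : Z) :
    SymBound K M fun y => a (y + c) := by
  intro j hj y
  rw [iteratedFDeriv_comp_add_right]
  exact hM j hj _

theorem IsSymbol.comp_add {a : Z → V} (ha : IsSymbol a) (c : Z) :
    IsSymbol fun y => a (y + c) := by
  refine isSymbol_of_symBound (ha.1.comp (contDiff_id.add contDiff_const)) fun K => ?_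
  obtain ⟨M, hM⟩ := ha.symBound K
  exact ⟨_, hM.comp_add c⟩

theorem IsSymbol.bilin {V₁ V₂ : Type*} [NormedAddCommGroup V₁] [NormedSpace ℂ V₁]
    [NormedAddCommGroup V₂] [NormedSpace ℂ V₂] (B : V₁ →L[ℝ] V₂ →L[ℝ] V) {a : Z → V₁}
    {b : Z → V₂} (ha : IsSymbol a) (hb : IsSymbol b) : IsSymbol fun z => B (a z) (b z) := by
  refine ⟨by have := ha.1; have := hb.1; fun_prop, fun j => ?_⟩
  obtain ⟨A, hA⟩ := ha.symBound j
  obtain ⟨M, hM⟩ := hb.symBound j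
  refine ⟨‖B‖ * ∑ i ∈ Finset.range (j + 1), (j.choose i : ℝ) * A * M, fun z => ?_⟩
  refine (B.norm_iteratedFDeriv_le_of_bilinear (N := ∞) ha.1 hb.1 z
    (by exact_mod_cast le_top)).trans ?_
  have := hA.nonneg
  gcongr with i hi
  · exact hA i (by have := Finset.mem_range.1 hi; omega) z
  · exact hM _ (by omega) z

theorem IsSymbol.inner {H : Type*} [NormedAddCommGroup H] [InnerProductSpace ℂ H]
    {a b : Z → H} (ha : IsSymbol a) (hb : IsSymbol b) : IsSymbol fun z => ⟪a z, b z⟫_ℂ := by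
  let B : H →L[ℝ] H →L[ℝ] ℂ := (isBoundedBilinearMap_inner (𝕜 := ℂ) (E := H)).toContinuousLinearMap
  exact IsSymbol.bilin B ha hb

/-- A smooth function with compact support is a symbol. -/
theorem isSymbol_of_hasCompactSupport {a : Z → V} (ha : ContDiff ℝ ∞ a)
    (hc : HasCompactSupport a) : IsSymbol a := by
  refine ⟨ha, fun j => ?_⟩
  exact (hc.iteratedFDeriv j).exists_bound_of_continuous
    (ha.continuous_iteratedFDeriv (m := j) (by exact_mod_cast le_top))

theorem _root_.SchwartzMap.isSymbol (χ : SchwartzMap Z V) : IsSymbol χ := by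
  refine ⟨χ.smooth _, fun j => ?_⟩
  obtain ⟨C, hC⟩ := χ.decay 0 j
  exact ⟨C, fun z => by simpa using hC.2 z⟩

/-- A cutoff `χ (ε z)` differs from `1` by a quantity of order `ε`, at the price of a linear growth
in `z`. This is why the basic estimate admits linear growth. -/
theorem cutoff_sub_one_bound {χ : Z → ℂ} (hχ : IsSymbol χ) (h0 : χ 0 = 1) (K : ℕ) :
    ∃ C > 0, ∀ ε : ℝ, 0 < ε → ε ≤ 1 → ∀ j ≤ K, ∀ z,
      ‖iteratedFDeriv ℝ j (fun z => χ (ε • z) - 1) z‖ ≤ C * ε * (1 + ‖z‖) := by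
  obtain ⟨M, hM⟩ := hχ.symBound (K + 1)
  have hM0 := hM.nonneg
  refine ⟨M + 1, by positivity, fun ε hε hε1 j hj z => ?_⟩
  rcases Nat.eq_zero_or_pos j with rfl | hj0
  · rw [norm_iteratedFDeriv_zero]
    have h1 : ‖χ (ε • z) - χ 0‖ ≤ M * ‖ε • z - 0‖ := by
      refine Convex.norm_image_sub_le_of_norm_fderiv_le (𝕜 := ℝ) (s := Set.univ)
        (fun y _ => hχ.1.differentiable (by simp) y) (fun y _ => ?_) convex_univ
        (Set.mem_univ _) (Set.mem_univ _)
      have := hM 1 (by omega) y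
      rwa [← norm_iteratedFDeriv_fderiv, norm_iteratedFDeriv_zero] at this
    rw [h0, sub_zero, norm_smul, Real.norm_of_nonneg hε.le] at h1
    refine h1.trans ?_
    nlinarith [norm_nonneg z, mul_nonneg hM0 hε.le, mul_nonneg hε.le (norm_nonneg z)]
  · let L : Z →L[ℝ] Z := ε • ContinuousLinearMap.id ℝ Z
    have hL : ‖L‖ ≤ ε := by
      refine ContinuousLinearMap.opNorm_le_bound _ hε.le fun y => ?_
      simp [L, norm_smul, abs_of_pos hε]
    have hs : ContDiff ℝ ∞ fun z => χ (L z) := hχ.1.comp L.contDiff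
    have e : iteratedFDeriv ℝ j (fun z => χ (ε • z) - 1) z
        = iteratedFDeriv ℝ j (fun z => χ (L z)) z := by
      have h := iteratedFDeriv_add_apply (𝕜 := ℝ) (i := j) (x := z)
        (f := fun z => χ (L z)) (g := fun _ => (-1 : ℂ))
        (hs.contDiffAt.of_le (by exact_mod_cast le_top)) contDiffAt_const
      rw [iteratedFDeriv_const_of_ne hj0.ne', Pi.zero_apply, add_zero] at h
      rw [← h]
      rfl
    rw [e]
    refine (norm_iteratedFDeriv_comp_clm_le hχ.1 L j z).trans ?_
    have h2 : ‖L‖ ^ j ≤ ε := by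
      calc ‖L‖ ^ j ≤ ε ^ j := pow_le_pow_left₀ (norm_nonneg _) hL j
        _ ≤ ε ^ 1 := pow_le_pow_of_le_one hε.le hε1 hj0
        _ = ε := pow_one _
    calc ‖iteratedFDeriv ℝ j χ (L z)‖ * ‖L‖ ^ j ≤ M * ε := by
          gcongr
          exact hM j (by omega) _
      _ ≤ (M + 1) * ε * (1 + ‖z‖) := by
          nlinarith [norm_nonneg z, mul_nonneg hM0 hε.le,
            mul_nonneg (mul_nonneg hM0 hε.le) (norm_nonneg z), mul_nonneg hε.le (norm_nonneg z)]

variable [FiniteDimensional ℝ Z] [MeasurableSpace Z] [BorelSpace Z]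

variable (Z) in
/-- A fixed smooth cutoff function with compact support. -/
noncomputable def stdCutoff (z : Z) : ℂ := ((default : ContDiffBump (0 : Z)) z : ℝ)

theorem contDiff_stdCutoff : ContDiff ℝ ∞ (stdCutoff Z) :=
  Complex.ofRealCLM.contDiff.comp (default : ContDiffBump (0 : Z)).contDiff

theorem hasCompactSupport_stdCutoff : HasCompactSupport (stdCutoff Z) :=
  (default : ContDiffBump (0 : Z)).hasCompactSupport.comp_left (g := fun x : ℝ => (x : ℂ)) (by simp)

theorem isSymbol_stdCutoff : IsSymbol (stdCutoff Z) :=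
  isSymbol_of_hasCompactSupport contDiff_stdCutoff hasCompactSupport_stdCutoff

theorem stdCutoff_zero : stdCutoff Z 0 = 1 := by
  rw [stdCutoff, ContDiffBump.one_of_mem_closedBall]
  · simp
  · exact Metric.mem_closedBall_self (default : ContDiffBump (0 : Z)).rIn_pos.le

/-- The regularized oscillatory integral `∫ exp (-i q z) χ (ε z) a z dz`. -/
noncomputable def oscReg (q : Z → ℝ) (μ : Measure Z) (χ : Z → ℂ) (a : Z → V) (ε : ℝ) : V :=
  ∫ z, oscFactor q z • (χ (ε • z) • a z) ∂μ

/-- The oscillatory integral `∫ exp (-i q z) a z dz` of a symbol `a`, defined as the limit of the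
integrals with a cutoff. It does not depend on the cutoff, see `tendsto_oscReg`. -/
noncomputable def osc (q : Z → ℝ) (μ : Measure Z) (a : Z → V) : V :=
  limUnder (𝓝[>] (0 : ℝ)) (oscReg q μ (stdCutoff Z) a)

/-- A function `χ` which may serve as a cutoff for the oscillatory integral of `a`. -/
structure IsCutoff (μ : Measure Z) (χ : Z → ℂ) (a : Z → V) : Prop where
  isSymbol : IsSymbol χ
  zero : χ 0 = 1
  integrable : ∀ ε : ℝ, 0 < ε → Integrable (fun z => χ (ε • z) • a z) μ

variable {μ : Measure Z} [μ.IsAddHaarMeasure]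

theorem integrable_comp_pos_smul {E : Type*} [NormedAddCommGroup E] {f : Z → E}
    (hf : Integrable f μ) {ε : ℝ} (hε : 0 < ε) : Integrable (fun z => f (ε • z)) μ :=
  (integrable_comp_smul_iff μ f hε.ne').2 hf

theorem isCutoff_of_integrable {χ : Z → ℂ} (hχ : IsSymbol χ) (h0 : χ 0 = 1)
    (hi : Integrable χ μ) {a : Z → V} (ha : IsSymbol a) : IsCutoff μ χ a := by
  refine ⟨hχ, h0, fun ε hε => ?_⟩
  obtain ⟨M, hM⟩ := ha.exists_norm_le
  exact (integrable_comp_pos_smul hi hε).smul_bdd M ha.continuous.aestronglyMeasurable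
    (Eventually.of_forall hM)

theorem isCutoff_stdCutoff {a : Z → V} (ha : IsSymbol a) : IsCutoff μ (stdCutoff Z) a :=
  isCutoff_of_integrable isSymbol_stdCutoff stdCutoff_zero
    (contDiff_stdCutoff.continuous.integrable_of_hasCompactSupport hasCompactSupport_stdCutoff) ha

theorem integrable_oscFactor_smul {q : Z → ℝ} (hq : IsPhase q) {f : Z → V}
    (hf : Integrable f μ) : Integrable (fun z => oscFactor q z • f z) μ :=
  hf.bdd_smul 1 hq.continuous_oscFactor.aestronglyMeasurable
    (Eventually.of_forall fun z => (norm_oscFactor q z).le)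

variable [CompleteSpace V]

/-- The Cauchy estimate for the regularized integrals, for two cutoffs at the same time. -/
theorem oscReg_sub_le {q : Z → ℝ} (hq : IsPhase q) {χ χ' : Z → ℂ} (hχ : IsSymbol χ)
    (h0 : χ 0 = 1) (hχ' : IsSymbol χ') (h0' : χ' 0 = 1) :
    ∃ C > 0, ∀ (a : Z → V) (M : ℝ), ContDiff ℝ ∞ a → SymBound (oscOrder Z) M a →
      IsCutoff μ χ a → IsCutoff μ χ' a → ∀ ε ε' : ℝ, 0 < ε → ε ≤ 1 → 0 < ε' → ε' ≤ 1 →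
      ‖oscReg q μ χ a ε - oscReg q μ χ' a ε'‖ ≤ C * (ε + ε') * M := by
  obtain ⟨C, hC, hkey⟩ := norm_integral_oscFactor_smul_le (V := V) (μ := μ) hq
  obtain ⟨A, hA, hAb⟩ := cutoff_sub_one_bound hχ h0 (oscOrder Z)
  obtain ⟨A', hA', hAb'⟩ := cutoff_sub_one_bound hχ' h0' (oscOrder Z)
  set K := oscOrder Z
  refine ⟨C * (2 ^ K * (A + A')), by positivity,
    fun a M ha hM hc hc' ε ε' hε hε1 hε' hε1' => ?_⟩
  let G : Z → ℂ := fun z => χ (ε • z) - χ' (ε' • z)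
  have hs : ContDiff ℝ ∞ fun z => χ (ε • z) := hχ.1.comp (contDiff_const.smul contDiff_id)
  have hs' : ContDiff ℝ ∞ fun z => χ' (ε' • z) := hχ'.1.comp (contDiff_const.smul contDiff_id)
  have hG : ContDiff ℝ ∞ G := hs.sub hs'
  have hGb : ∀ z, ∀ j ≤ K, ‖iteratedFDeriv ℝ j G z‖ ≤ (A + A') * (ε + ε') * (1 + ‖z‖) := by
    intro z j hj
    have e : G = (fun z => χ (ε • z) - 1) - fun z => χ' (ε' • z) - 1 := by
      funext z; simp [G]
    have s1 : ContDiff ℝ ∞ fun z => χ (ε • z) - 1 := hs.sub contDiff_const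
    have s2 : ContDiff ℝ ∞ fun z => χ' (ε' • z) - 1 := hs'.sub contDiff_const
    rw [e, iteratedFDeriv_sub_apply (s1.contDiffAt.of_le (by exact_mod_cast le_top))
      (s2.contDiffAt.of_le (by exact_mod_cast le_top))]
    refine (norm_sub_le _ _).trans ?_
    refine (add_le_add (hAb ε hε hε1 j hj z) (hAb' ε' hε' hε1' j hj z)).trans ?_
    have : 0 ≤ A * ε' + A' * ε := by positivity
    have h1 : 0 ≤ 1 + ‖z‖ := by positivity
    nlinarith [mul_nonneg this h1]
  have hi : Integrable (fun z => G z • a z) μ := by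
    have := (hc.integrable ε hε).sub (hc'.integrable ε' hε')
    refine this.congr (Eventually.of_forall fun z => ?_)
    simp [G, sub_smul]
  have e : oscReg q μ χ a ε - oscReg q μ χ' a ε' = ∫ z, oscFactor q z • (G z • a z) ∂μ := by
    have b1 := integrable_oscFactor_smul hq (hc.integrable ε hε)
    have b2 := integrable_oscFactor_smul hq (hc'.integrable ε' hε')
    rw [oscReg, oscReg, ← integral_sub b1 b2]
    refine integral_congr_ae (Eventually.of_forall fun z => ?_)
    simp [G, sub_smul, smul_sub]
  rw [e]
  refine (hkey _ (2 ^ K * ((A + A') * (ε + ε') * M)) (hG.smul ha) hi fun j hj z => ?_).trans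
    (le_of_eq (by ring))
  refine (norm_iteratedFDeriv_smul_le_of_bounds hG ha (hGb z) (fun i hi => hM i hi z) j hj).trans
    (le_of_eq (by ring))

theorem tendsto_oscReg_stdCutoff {q : Z → ℝ} (hq : IsPhase q) {a : Z → V} (ha : IsSymbol a) :
    Tendsto (oscReg q μ (stdCutoff Z) a) (𝓝[>] (0 : ℝ)) (𝓝 (osc q μ a)) := by
  obtain ⟨C, hC, h⟩ := oscReg_sub_le (V := V) (μ := μ) hq isSymbol_stdCutoff stdCutoff_zero
    isSymbol_stdCutoff stdCutoff_zero
  obtain ⟨M, hM⟩ := ha.symBound (oscOrder Z)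
  have hM0 := hM.nonneg
  have hc : Cauchy (map (oscReg q μ (stdCutoff Z) a) (𝓝[>] (0 : ℝ))) := by
    rw [Metric.cauchy_iff]
    refine ⟨inferInstance, fun δ hδ => ?_⟩
    let r := min 1 (δ / (2 * C * (M + 1)))
    have hr : 0 < r := by positivity
    refine ⟨oscReg q μ (stdCutoff Z) a '' Set.Ioo 0 r,
      image_mem_map (Ioo_mem_nhdsGT hr), ?_⟩
    rintro _ ⟨ε, ⟨h1, h2⟩, rfl⟩ _ ⟨ε', ⟨h1', h2'⟩, rfl⟩
    rw [dist_eq_norm]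
    refine (h a M ha.1 hM (isCutoff_stdCutoff ha) (isCutoff_stdCutoff ha) ε ε' h1
      (h2.le.trans (min_le_left _ _)) h1' (h2'.le.trans (min_le_left _ _))).trans_lt ?_
    have hlt : ε + ε' < 2 * (δ / (2 * C * (M + 1))) := by
      have := min_le_right 1 (δ / (2 * C * (M + 1)))
      linarith
    calc C * (ε + ε') * M ≤ C * (ε + ε') * (M + 1) := by gcongr; linarith
      _ < C * (2 * (δ / (2 * C * (M + 1)))) * (M + 1) := by gcongr
      _ = δ := by field_simp
  exact tendsto_nhds_limUnder (cauchy_map_iff_exists_tendsto.1 hc)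

/-- The rate of convergence to the oscillatory integral is uniform for bounded sets of symbols. -/
theorem oscReg_sub_osc_le {q : Z → ℝ} (hq : IsPhase q) {χ : Z → ℂ} (hχ : IsSymbol χ)
    (h0 : χ 0 = 1) :
    ∃ C > 0, ∀ (a : Z → V) (M : ℝ), IsSymbol a → SymBound (oscOrder Z) M a → IsCutoff μ χ a →
      ∀ ε : ℝ, 0 < ε → ε ≤ 1 → ‖oscReg q μ χ a ε - osc q μ a‖ ≤ C * ε * M := by
  obtain ⟨C, hC, h⟩ := oscReg_sub_le (V := V) (μ := μ) hq hχ h0 isSymbol_stdCutoff stdCutoff_zero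
  refine ⟨C, hC, fun a M ha hM hc ε hε hε1 => ?_⟩
  have h1 : Tendsto (fun ε' => ‖oscReg q μ χ a ε - oscReg q μ (stdCutoff Z) a ε'‖) (𝓝[>] (0 : ℝ))
      (𝓝 ‖oscReg q μ χ a ε - osc q μ a‖) :=
    (tendsto_const_nhds.sub (tendsto_oscReg_stdCutoff hq ha)).norm
  have h2 : Tendsto (fun ε' : ℝ => C * (ε + ε') * M) (𝓝[>] (0 : ℝ)) (𝓝 (C * (ε + 0) * M)) := by
    apply Tendsto.mono_left _ nhdsWithin_le_nhds
    exact Continuous.tendsto (by fun_prop) 0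
  rw [add_zero] at h2
  refine le_of_tendsto_of_tendsto h1 h2 ?_
  filter_upwards [Ioo_mem_nhdsGT (zero_lt_one (α := ℝ))] with ε' hε'
  exact h a M ha.1 hM hc (isCutoff_stdCutoff ha) ε ε' hε hε1 hε'.1 hε'.2.le

theorem tendsto_oscReg {q : Z → ℝ} (hq : IsPhase q) {χ : Z → ℂ} {a : Z → V} (ha : IsSymbol a)
    (hχ : IsCutoff μ χ a) : Tendsto (oscReg q μ χ a) (𝓝[>] (0 : ℝ)) (𝓝 (osc q μ a)) := by
  obtain ⟨C, hC, h⟩ := oscReg_sub_osc_le (V := V) (μ := μ) hq hχ.isSymbol hχ.zero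
  obtain ⟨M, hM⟩ := ha.symBound (oscOrder Z)
  have h2 : Tendsto (fun ε : ℝ => C * ε * M) (𝓝[>] (0 : ℝ)) (𝓝 (C * 0 * M)) := by
    apply Tendsto.mono_left _ nhdsWithin_le_nhds
    exact Continuous.tendsto (by fun_prop) 0
  rw [tendsto_iff_norm_sub_tendsto_zero]
  refine squeeze_zero' (Eventually.of_forall fun _ => norm_nonneg _) ?_ (by simpa using h2)
  filter_upwards [Ioo_mem_nhdsGT (zero_lt_one (α := ℝ))] with ε hε
  exact h a M ha hM hχ ε hε.1 hε.2.le

/-- An oscillatory integral is bounded by finitely many derivatives of the symbol. -/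
theorem norm_osc_le {q : Z → ℝ} (hq : IsPhase q) :
    ∃ C > 0, ∀ (a : Z → V) (M : ℝ), IsSymbol a → SymBound (oscOrder Z) M a →
      ‖osc q μ a‖ ≤ C * M := by
  obtain ⟨C, hC, h⟩ := oscReg_sub_osc_le (V := V) (μ := μ) hq isSymbol_stdCutoff stdCutoff_zero
  obtain ⟨C', hC', h'⟩ := norm_integral_oscFactor_smul_le (V := V) (μ := μ) hq
  obtain ⟨A, hA⟩ := (isSymbol_stdCutoff (Z := Z)).symBound (oscOrder Z)
  have hA0 := hA.nonneg
  refine ⟨C + C' * (2 ^ oscOrder Z * A), by positivity, fun a M ha hM => ?_⟩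
  have hM0 := hM.nonneg
  have hc := isCutoff_stdCutoff (μ := μ) ha
  have h1 := h a M ha hM hc 1 one_pos le_rfl
  have h2 : ‖oscReg q μ (stdCutoff Z) a 1‖ ≤ C' * (2 ^ oscOrder Z * (A * M)) := by
    simp only [oscReg, one_smul]
    refine h' _ _ (contDiff_stdCutoff.smul ha.1)
      (by simpa using hc.integrable 1 one_pos) fun j hj z => ?_
    refine (SymBound.smul contDiff_stdCutoff ha.1 hA hM j hj z).trans ?_
    exact le_mul_of_one_le_right (by positivity) (by linarith [norm_nonneg z])
  have h3 := norm_sub_le (oscReg q μ (stdCutoff Z) a 1)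
    (oscReg q μ (stdCutoff Z) a 1 - osc q μ a)
  rw [sub_sub_cancel] at h3
  linarith

/-- Continuity of the oscillatory integral: pointwise convergence suffices for symbols which are
uniformly bounded together with their derivatives. -/
theorem tendsto_osc {q : Z → ℝ} (hq : IsPhase q) {ι : Type*} {l : Filter ι}
    [l.IsCountablyGenerated] {a : ι → Z → V} {b : Z → V} {M : ℝ}
    (ha : ∀ᶠ i in l, IsSymbol (a i) ∧ SymBound (oscOrder Z) M (a i))
    (hb : IsSymbol b) (hab : ∀ z, Tendsto (fun i => a i z) l (𝓝 (b z))) :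
    Tendsto (fun i => osc q μ (a i)) l (𝓝 (osc q μ b)) := by
  obtain ⟨C, hC, h⟩ := oscReg_sub_osc_le (V := V) (μ := μ) hq isSymbol_stdCutoff stdCutoff_zero
  obtain ⟨M', hM'⟩ := hb.symBound (oscOrder Z)
  have hM0 := hM'.nonneg
  rw [Metric.tendsto_nhds]
  intro δ hδ
  -- a cutoff parameter for which the regularized integrals are uniformly close to their limits
  obtain ⟨ε, hε, hε1, hεδ⟩ : ∃ ε : ℝ, 0 < ε ∧ ε ≤ 1 ∧ C * ε * (|M| + M') < δ / 2 := by
    refine ⟨min 1 (δ / (4 * C * (|M| + M' + 1))), by positivity, min_le_left _ _, ?_⟩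
    have hX : 0 ≤ |M| + M' := by positivity
    generalize |M| + M' = X at hX
    calc C * min 1 (δ / (4 * C * (X + 1))) * X
        ≤ C * (δ / (4 * C * (X + 1))) * (X + 1) := by
          gcongr
          · exact min_le_right _ _
          · linarith
      _ = δ / 4 := by field_simp
      _ < δ / 2 := by linarith
  have hconv : Tendsto (fun i => oscReg q μ (stdCutoff Z) (a i) ε) l
      (𝓝 (oscReg q μ (stdCutoff Z) b ε)) := by
    have hint : Integrable (fun z => stdCutoff Z (ε • z)) μ :=
      integrable_comp_pos_smul
        (contDiff_stdCutoff.continuous.integrable_of_hasCompactSupport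
          hasCompactSupport_stdCutoff) hε
    refine tendsto_integral_filter_of_dominated_convergence
      (fun z => ‖stdCutoff Z (ε • z)‖ * M) ?_ ?_ (hint.norm.mul_const M) ?_
    · filter_upwards [ha] with i hi
      refine Continuous.aestronglyMeasurable ?_
      have h1 := hq.continuous_oscFactor
      have h2 := hi.1.continuous
      have h3 : Continuous (stdCutoff Z) := contDiff_stdCutoff.continuous
      fun_prop
    · filter_upwards [ha] with i hi
      refine Eventually.of_forall fun z => ?_
      rw [norm_smul, norm_smul, norm_oscFactor, one_mul]
      gcongr
      exact hi.2.norm_le z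
    · refine Eventually.of_forall fun z => ?_
      exact ((hab z).const_smul _).const_smul _
  filter_upwards [ha, Metric.tendsto_nhds.1 hconv (δ / 2) (half_pos hδ)] with i hi hi2
  have h1 := h (a i) M hi.1 hi.2 (isCutoff_stdCutoff hi.1) ε hε hε1
  have h2 := h b M' hb hM' (isCutoff_stdCutoff hb) ε hε hε1
  have h3 : C * ε * M ≤ C * ε * |M| := by gcongr; exact le_abs_self _
  rw [dist_eq_norm] at hi2 ⊢
  have e : osc q μ (a i) - osc q μ b =
      -(oscReg q μ (stdCutoff Z) (a i) ε - osc q μ (a i)) +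
      (oscReg q μ (stdCutoff Z) (a i) ε - oscReg q μ (stdCutoff Z) b ε) +
      (oscReg q μ (stdCutoff Z) b ε - osc q μ b) := by abel
  rw [e]
  refine (norm_add₃_le).trans_lt ?_
  rw [norm_neg]
  nlinarith

end Oscillatory

section Oscillatory

open MeasureTheory Filter Topology

variable {Z : Type*} [NormedAddCommGroup Z] [NormedSpace ℝ Z]
  {V : Type*} [NormedAddCommGroup V] [NormedSpace ℂ V]
  [FiniteDimensional ℝ Z] [MeasurableSpace Z] [BorelSpace Z] {μ : Measure Z} [μ.IsAddHaarMeasure]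
  [CompleteSpace V]

theorem osc_clm {W : Type*} [NormedAddCommGroup W] [NormedSpace ℂ W] [CompleteSpace W]
    {q : Z → ℝ} (hq : IsPhase q) (L : V →L[ℂ] W) {a : Z → V} (ha : IsSymbol a) :
    osc q μ (fun z => L (a z)) = L (osc q μ a) := by
  have hLa : IsSymbol fun z => L (a z) := ha.clm_comp (L.restrictScalars ℝ)
  have h1 := tendsto_oscReg_stdCutoff (μ := μ) hq hLa
  have h2 := (L.continuous.tendsto _).comp (tendsto_oscReg_stdCutoff (μ := μ) hq ha)
  refine tendsto_nhds_unique_of_eventuallyEq h1 h2 ?_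
  filter_upwards [self_mem_nhdsWithin] with ε hε
  have hi := integrable_oscFactor_smul hq ((isCutoff_stdCutoff (μ := μ) ha).integrable ε hε)
  simp only [oscReg, Function.comp_apply]
  rw [← L.integral_comp_comm hi]
  simp

theorem osc_add {q : Z → ℝ} (hq : IsPhase q) {a b : Z → V} (ha : IsSymbol a) (hb : IsSymbol b) :
    osc q μ (fun z => a z + b z) = osc q μ a + osc q μ b := by
  have h1 := tendsto_oscReg_stdCutoff (μ := μ) hq (ha.add hb)
  have h2 := (tendsto_oscReg_stdCutoff (μ := μ) hq ha).add
    (tendsto_oscReg_stdCutoff (μ := μ) hq hb)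
  refine tendsto_nhds_unique_of_eventuallyEq h1 h2 ?_
  filter_upwards [self_mem_nhdsWithin] with ε hε
  have hi := integrable_oscFactor_smul hq ((isCutoff_stdCutoff (μ := μ) ha).integrable ε hε)
  have hi' := integrable_oscFactor_smul hq ((isCutoff_stdCutoff (μ := μ) hb).integrable ε hε)
  simp only [oscReg]
  rw [← integral_add hi hi']
  simp

theorem osc_smul {q : Z → ℝ} (hq : IsPhase q) (c : ℂ) {a : Z → V} (ha : IsSymbol a) :
    osc q μ (fun z => c • a z) = c • osc q μ a :=
  osc_clm hq (c • ContinuousLinearMap.id ℂ V) ha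

/-- The oscillatory integral vanishes if the regularized integrals do so. -/
theorem osc_eq_zero {q : Z → ℝ} (hq : IsPhase q) {χ : Z → ℂ} {a : Z → V} (ha : IsSymbol a)
    (hχ : IsCutoff μ χ a) (h : ∀ᶠ ε in 𝓝[>] (0 : ℝ), oscReg q μ χ a ε = 0) : osc q μ a = 0 :=
  tendsto_nhds_unique_of_eventuallyEq (tendsto_oscReg hq ha hχ) tendsto_const_nhds h

theorem IsPhase.comp_equiv {q : Z → ℝ} (hq : IsPhase q) (T : Z ≃L[ℝ] Z) :
    IsPhase fun z => q (T z) := by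
  obtain ⟨β, h, hnd⟩ := hq
  refine ⟨β.bilinearComp (T : Z →L[ℝ] Z) (T : Z →L[ℝ] Z), fun z => by simp [h], fun k hk => ?_⟩
  have : T k = 0 := hnd _ fun w => by
    have := hk (T.symm w)
    simpa using this
  simpa using this

theorem integral_comp_equiv (T : Z ≃L[ℝ] Z) (f : Z → V) :
    ∫ z, f (T z) ∂μ = ((|LinearMap.det (T : Z →ₗ[ℝ] Z)|⁻¹ : ℝ) : ℂ) • ∫ z, f z ∂μ := by
  have hdet : LinearMap.det (T : Z →ₗ[ℝ] Z) ≠ 0 := by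
    have := (LinearEquiv.isUnit_det' T.toLinearEquiv).ne_zero
    exact this
  have h := Measure.map_linearMap_addHaar_eq_smul_addHaar μ hdet
  have h1 : ∫ z, f (T z) ∂μ = ∫ z, f z ∂(μ.map T) :=
    (T.toHomeomorph.measurableEmbedding.integral_map f).symm
  have h2 : μ.map T = ENNReal.ofReal |(LinearMap.det (T : Z →ₗ[ℝ] Z))⁻¹| • μ := h
  rw [h1, h2, integral_smul_measure, ENNReal.toReal_ofReal (abs_nonneg _), abs_inv,
    Complex.coe_smul]

/-- Linear substitutions in oscillatory integrals. -/
theorem osc_comp_equiv {q : Z → ℝ} (hq : IsPhase q) (T : Z ≃L[ℝ] Z) {a : Z → V}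
    (ha : IsSymbol a) : osc (fun z => q (T z)) μ (fun z => a (T z)) =
      ((|LinearMap.det (T : Z →ₗ[ℝ] Z)|⁻¹ : ℝ) : ℂ) • osc q μ a := by
  have hT : IsSymbol fun z => a (T z) := ha.comp_clm (T : Z →L[ℝ] Z)
  have hc : IsCutoff μ (fun z => stdCutoff Z (T z)) fun z => a (T z) := by
    refine isCutoff_of_integrable (isSymbol_stdCutoff.comp_clm (T : Z →L[ℝ] Z))
      (by simp [stdCutoff_zero]) ?_ hT
    refine Continuous.integrable_of_hasCompactSupport ?_ ?_
    · exact contDiff_stdCutoff.continuous.comp T.continuous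
    · exact hasCompactSupport_stdCutoff.comp_homeomorph T.toHomeomorph
  have h1 := tendsto_oscReg (hq.comp_equiv T) hT hc
  have h2 := (tendsto_oscReg_stdCutoff (μ := μ) hq ha).const_smul
    ((|LinearMap.det (T : Z →ₗ[ℝ] Z)|⁻¹ : ℝ) : ℂ)
  refine tendsto_nhds_unique_of_eventuallyEq h1 h2 (Eventually.of_forall fun ε => ?_)
  simp only [oscReg]
  rw [← integral_comp_equiv]
  simp [oscFactor]

/-- Substitutions which preserve the phase. The determinant is a sign, since the oscillatory
integral of the function `1` is not zero. -/
theorem osc_comp_equiv_of_invariant {q : Z → ℝ} (hq : IsPhase q)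
    (h1 : osc q μ (fun _ => (1 : ℂ)) ≠ 0) (T : Z ≃L[ℝ] Z) (hT : ∀ z, q (T z) = q z) {a : Z → V}
    (ha : IsSymbol a) : osc q μ (fun z => a (T z)) = osc q μ a := by
  have e : (fun z => q (T z)) = q := funext hT
  have h2 := osc_comp_equiv (μ := μ) hq T (isSymbol_const (1 : ℂ))
  have h3 := osc_comp_equiv (μ := μ) hq T ha
  rw [e] at h2 h3
  rw [h3]
  have : ((|LinearMap.det (T : Z →ₗ[ℝ] Z)|⁻¹ : ℝ) : ℂ) = 1 := by
    have h4 : (((|LinearMap.det (T : Z →ₗ[ℝ] Z)|⁻¹ : ℝ) : ℂ) - 1) *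
        osc q μ (fun _ => (1 : ℂ)) = 0 := by
      rw [sub_mul, one_mul, sub_eq_zero]
      exact h2.symm
    exact sub_eq_zero.1 ((mul_eq_zero.1 h4).resolve_right h1)
  rw [this, one_smul]

/-- The phase of a scalar product of two oscillatory integrals. -/
def pairPhase (q : Z → ℝ) (w : Z × Z) : ℝ := -q w.1 + q w.2

theorem IsPhase.pairPhase {q : Z → ℝ} (hq : IsPhase q) : IsPhase (pairPhase q) := by
  obtain ⟨β, h, hnd⟩ := hq
  refine ⟨-β.bilinearComp (ContinuousLinearMap.fst ℝ Z Z) (ContinuousLinearMap.fst ℝ Z Z) +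
    β.bilinearComp (ContinuousLinearMap.snd ℝ Z Z) (ContinuousLinearMap.snd ℝ Z Z),
    fun z => by simp [h, WarpedQFT.pairPhase], fun k hk => ?_⟩
  refine Prod.ext (hnd _ fun w => ?_) (hnd _ fun w => ?_)
  · have := hk (w, 0)
    simp at this
    linarith
  · have := hk (0, w)
    simpa using this

/-- The scalar product of two oscillatory integrals is an oscillatory integral over the
product space. -/
theorem inner_osc_osc {H : Type*} [NormedAddCommGroup H] [InnerProductSpace ℂ H]
    [CompleteSpace H] {q : Z → ℝ} (hq : IsPhase q) {a b : Z → H} (ha : IsSymbol a)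
    (hb : IsSymbol b) : ⟪osc q μ a, osc q μ b⟫_ℂ =
      osc (pairPhase q) (μ.prod μ) (fun w : Z × Z => ⟪a w.1, b w.2⟫_ℂ) := by
  have hab : IsSymbol fun w : Z × Z => ⟪a w.1, b w.2⟫_ℂ :=
    (ha.comp_clm (ContinuousLinearMap.fst ℝ Z Z)).inner
      (hb.comp_clm (ContinuousLinearMap.snd ℝ Z Z))
  have hstdi : Integrable (stdCutoff Z) μ :=
    contDiff_stdCutoff.continuous.integrable_of_hasCompactSupport hasCompactSupport_stdCutoff
  let χ : Z × Z → ℂ := fun w => stdCutoff Z w.1 • stdCutoff Z w.2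
  have hc : IsCutoff (μ.prod μ) χ fun w : Z × Z => ⟪a w.1, b w.2⟫_ℂ := by
    refine isCutoff_of_integrable ?_ (by simp [χ, stdCutoff_zero]) ?_ hab
    · exact (isSymbol_stdCutoff.comp_clm (ContinuousLinearMap.fst ℝ Z Z)).smul
        (isSymbol_stdCutoff.comp_clm (ContinuousLinearMap.snd ℝ Z Z))
    · exact hstdi.mul_prod hstdi
  have h1 := tendsto_oscReg (hq.pairPhase) hab hc
  have h2 := (tendsto_oscReg_stdCutoff (μ := μ) hq ha).inner (𝕜 := ℂ)
    (tendsto_oscReg_stdCutoff (μ := μ) hq hb)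
  refine tendsto_nhds_unique_of_eventuallyEq h2 h1 ?_
  filter_upwards [self_mem_nhdsWithin] with ε hε
  have hia := integrable_oscFactor_smul hq ((isCutoff_stdCutoff (μ := μ) ha).integrable ε hε)
  have hib := integrable_oscFactor_smul hq ((isCutoff_stdCutoff (μ := μ) hb).integrable ε hε)
  have hi := integrable_oscFactor_smul hq.pairPhase (hc.integrable ε hε)
  have hpt : ∀ z z', ⟪oscFactor q z • (stdCutoff Z (ε • z) • a z),
      oscFactor q z' • (stdCutoff Z (ε • z') • b z')⟫_ℂ =
      oscFactor (pairPhase q) (z, z') • (χ (ε • (z, z')) • ⟪a z, b z'⟫_ℂ) := by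
    intro z z'
    have e1 : (starRingEnd ℂ) (oscFactor q z) * oscFactor q z' =
        oscFactor (pairPhase q) (z, z') := by
      simp only [oscFactor, ← Complex.exp_conj, ← Complex.exp_add]
      congr 1
      simp [pairPhase]
      ring
    have e2 : (starRingEnd ℂ) (stdCutoff Z (ε • z)) = stdCutoff Z (ε • z) := by
      simp [stdCutoff]
    simp only [inner_smul_left, inner_smul_right, e2, ← e1, χ, Prod.smul_mk, smul_eq_mul]
    ring
  simp only [oscReg]
  rw [integral_prod _ hi]
  rw [← inner_conj_symm, ← integral_inner hia, ← integral_conj]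
  refine integral_congr_ae (Eventually.of_forall fun z => ?_)
  simp only [inner_conj_symm]
  rw [← integral_inner hib]
  exact integral_congr_ae (Eventually.of_forall fun z' => hpt z z')

end Oscillatory

/-! ### The Lorentz product as a phase -/

section Mink

open MeasureTheory Filter Topology

variable {n : ℕ}

instance : (volume : Measure (Mink n × Mink n)).IsAddHaarMeasure :=
  inferInstanceAs ((volume : Measure (Mink n)).prod volume).IsAddHaarMeasure

/-- The phase `p x` on the space of the pairs `(x, p)`. -/
def minkPhase (z : Mink n × Mink n) : ℝ := mdot z.2 z.1

/-- The reflection of the space coordinates, as a Euclidean isometry. -/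
noncomputable def spaceReflection (n : ℕ) : Mink n ≃ₗᵢ[ℝ] Mink n :=
  LinearIsometryEquiv.piLpCongrRight 2 fun i =>
    if i = 0 then LinearIsometryEquiv.refl ℝ ℝ else LinearIsometryEquiv.neg ℝ

theorem mdot_eq_inner (x y : Mink n) : mdot x y = ⟪x, spaceReflection n y⟫_ℝ := by
  rw [PiLp.inner_apply, Fin.sum_univ_succ]
  simp [mdot, spaceReflection, Fin.succ_ne_zero, sub_eq_add_neg, mul_comm]

theorem mdot_comm (x y : Mink n) : mdot x y = mdot y x := by
  simp [mdot, mul_comm]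

/-- The Lorentz product as a continuous bilinear form. -/
noncomputable def mdotL (n : ℕ) : Mink n →L[ℝ] Mink n →L[ℝ] ℝ :=
  (innerSL ℝ).bilinearComp (ContinuousLinearMap.id ℝ (Mink n))
    ((spaceReflection n).toContinuousLinearEquiv : Mink n →L[ℝ] Mink n)

theorem mdotL_apply (x y : Mink n) : mdotL n x y = mdot x y := by
  rw [mdot_eq_inner]; rfl

theorem eq_zero_of_mdot {x : Mink n} (h : ∀ y, mdot y x = 0) : x = 0 := by
  have := h (spaceReflection n x)
  rw [mdot_eq_inner, inner_self_eq_zero] at this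
  simpa using this

theorem isPhase_minkPhase : IsPhase (minkPhase (n := n)) := by
  refine ⟨(mdotL n).bilinearComp (ContinuousLinearMap.snd ℝ _ _) (ContinuousLinearMap.fst ℝ _ _),
    fun z => by simp [mdotL_apply, minkPhase], fun k hk => ?_⟩
  refine Prod.ext (eq_zero_of_mdot fun y => ?_) (eq_zero_of_mdot fun y => ?_)
  · have := hk (0, y)
    simpa [mdotL_apply, mdot] using this
  · have := hk (y, 0)
    rw [mdot_comm]
    simpa [mdotL_apply, mdot] using this

open FourierTransform in
/-- The Fourier transform `x ↦ ∫ b p exp (-i p x) dp` with respect to the Lorentz product. -/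
noncomputable def minkFourier (b : SchwartzMap (Mink n) ℂ) : SchwartzMap (Mink n) ℂ :=
  SchwartzMap.compCLMOfContinuousLinearEquiv ℂ
    ((spaceReflection n).toContinuousLinearEquiv.trans
      (ContinuousLinearEquiv.smulLeft (Units.mk0 (2 * Real.pi)⁻¹ (by positivity)))) (𝓕 b)

open FourierTransform in
theorem minkFourier_eq (b : SchwartzMap (Mink n) ℂ) (x : Mink n) :
    minkFourier b x = (𝓕 b) ((2 * Real.pi)⁻¹ • spaceReflection n x) := rfl

open FourierTransform in
theorem minkFourier_apply (b : SchwartzMap (Mink n) ℂ) (x : Mink n) :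
    minkFourier b x = ∫ p : Mink n, Complex.exp (-Complex.I * (mdot p x : ℂ)) * b p := by
  rw [minkFourier_eq, SchwartzMap.fourier_coe, Real.fourier_eq']
  refine integral_congr_ae (Eventually.of_forall fun p => ?_)
  simp only [smul_eq_mul]
  congr 2
  rw [mdot_eq_inner, inner_smul_right]
  have : (-2 * Real.pi * ((2 * Real.pi)⁻¹ * ⟪p, spaceReflection n x⟫_ℝ))
      = -⟪p, spaceReflection n x⟫_ℝ := by field_simp
  rw [this]
  push_cast
  ring

open FourierTransform in
/-- Fourier inversion with respect to the Lorentz product. -/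
theorem integral_minkFourier (b : SchwartzMap (Mink n) ℂ) (p : Mink n) :
    ∫ x : Mink n, minkFourier b x * Complex.exp (Complex.I * (mdot p x : ℂ)) =
      ((2 * Real.pi) ^ (n + 2) : ℝ) * b p := by
  let g : Mink n → ℂ := fun y => Complex.exp (((2 * Real.pi * ⟪y, p⟫_ℝ : ℝ) : ℂ) * Complex.I) •
    (𝓕 b) y
  have h1 : ∀ x, minkFourier b x * Complex.exp (Complex.I * (mdot p x : ℂ)) =
      g ((2 * Real.pi)⁻¹ • spaceReflection n x) := by
    intro x
    simp only [g, smul_eq_mul]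
    rw [minkFourier_eq, mul_comm]
    congr 2
    rw [mdot_eq_inner, inner_smul_left, real_inner_comm]
    have : (2 * Real.pi * ((starRingEnd ℝ) (2 * Real.pi)⁻¹ * ⟪spaceReflection n x, p⟫_ℝ))
        = ⟪spaceReflection n x, p⟫_ℝ := by
      simp only [conj_trivial]; field_simp
    rw [this]
    ring
  simp_rw [h1]
  rw [(spaceReflection n).measurePreserving.integral_comp
    (spaceReflection n).toHomeomorph.measurableEmbedding (fun y => g ((2 * Real.pi)⁻¹ • y)),
    Measure.integral_comp_inv_smul]
  have h2 : ∫ y, g y = b p := by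
    have : (𝓕⁻ (𝓕 b)) p = b p := by rw [FourierPair.fourierInv_fourier_eq]
    rw [← this, SchwartzMap.fourierInv_coe, Real.fourierInv_eq']
  rw [h2, finrank_euclideanSpace_fin, abs_of_pos (by positivity), Complex.real_smul]

/-- A normalized Schwartz function with compact support. -/
theorem exists_schwartz_bump (r : ℝ) (hr : 0 < r) : ∃ b : SchwartzMap (Mink n) ℂ,
    (∀ p, r ≤ ‖p‖ → b p = 0) ∧ ∫ p, b p = 1 := by
  let f : ContDiffBump (0 : Mink n) := ⟨r / 2, r, by positivity, by linarith⟩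
  have h1 : HasCompactSupport fun p => (f.normed volume p : ℂ) :=
    f.hasCompactSupport_normed.comp_left (g := fun x : ℝ => (x : ℂ)) (by simp)
  have h2 : ContDiff ℝ ∞ fun p => (f.normed volume p : ℂ) :=
    Complex.ofRealCLM.contDiff.comp f.contDiff_normed
  refine ⟨h1.toSchwartzMap h2, fun p hp => ?_, ?_⟩
  · show (f.normed volume p : ℂ) = 0
    have : p ∉ Function.support (f.normed volume) := by
      rw [f.support_normed_eq]
      simpa [f] using hp
    simpa using this
  · show ∫ p, (f.normed volume p : ℂ) = 1
    rw [integral_complex_ofReal, f.integral_normed]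
    simp

/-- The normalization: the delta distribution `(2π)^(-d) ∫ exp (-i p x) dp` has integral one. With a
product cutoff, the `p`-integral is the Fourier transform of the cutoff. -/
theorem osc_minkPhase_one :
    osc minkPhase volume (fun _ : Mink n × Mink n => (1 : ℂ)) = ((2 * Real.pi) ^ (n + 2) : ℝ) := by
  have hc0 : HasCompactSupport (stdCutoff (Mink n)) := hasCompactSupport_stdCutoff
  obtain ⟨ρ, hρ0⟩ : ∃ ρ : SchwartzMap (Mink n) ℂ, ρ 0 = 1 :=
    ⟨hc0.toSchwartzMap contDiff_stdCutoff, stdCutoff_zero⟩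
  have hi : Integrable (fun x => ρ x) (volume : Measure (Mink n)) := ρ.integrable
  obtain ⟨χ, hχ⟩ : ∃ χ : Mink n × Mink n → ℂ, χ = fun z => ρ z.1 • ρ z.2 := ⟨_, rfl⟩
  have hχi : Integrable χ ((volume : Measure (Mink n)).prod volume) := by
    rw [hχ]
    exact Integrable.mul_prod hi hi
  have hχs : IsSymbol χ := by
    rw [hχ]
    exact (ρ.isSymbol.comp_clm (ContinuousLinearMap.fst ℝ (Mink n) (Mink n))).smul
      (ρ.isSymbol.comp_clm (ContinuousLinearMap.snd ℝ (Mink n) (Mink n)))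
  have hc : IsCutoff volume χ (fun _ : Mink n × Mink n => (1 : ℂ)) :=
    isCutoff_of_integrable hχs (by simp [hχ, hρ0]) hχi (isSymbol_const _)
  have h1 := tendsto_oscReg isPhase_minkPhase (isSymbol_const (1 : ℂ)) hc
  -- the regularized integral with the cutoff `ρ (ε x) ρ (ε p)` is the left hand side: the
  -- `p`-integral is `ε^(-d)` times the Fourier transform of `ρ` at `x / ε`
  have h2 : Tendsto (fun ε : ℝ => ∫ x : Mink n, ρ ((ε ^ 2) • x) * minkFourier ρ x) (𝓝[>] 0)
      (𝓝 (∫ x : Mink n, 1 * minkFourier ρ x)) := by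
    obtain ⟨M, hM⟩ := ρ.isSymbol.exists_norm_le
    refine tendsto_integral_filter_of_dominated_convergence (fun x => M * ‖minkFourier ρ x‖)
      ?_ ?_ (((minkFourier ρ).integrable (μ := volume)).norm.const_mul M) ?_
    · refine Eventually.of_forall fun ε => Continuous.aestronglyMeasurable ?_
      have := ρ.continuous
      have := (minkFourier ρ).continuous
      fun_prop
    · refine Eventually.of_forall fun ε => Eventually.of_forall fun x => ?_
      rw [norm_mul]
      gcongr
      exact hM _
    · refine Eventually.of_forall fun x => ?_
      refine Tendsto.mul_const _ ?_
      apply Tendsto.mono_left _ nhdsWithin_le_nhds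
      have h : Continuous fun ε : ℝ => ρ ((ε ^ 2) • x) := by
        have := ρ.continuous
        fun_prop
      have := h.tendsto 0
      simpa [hρ0] using this
  have h3 : ∫ x : Mink n, 1 * minkFourier ρ x = ((2 * Real.pi) ^ (n + 2) : ℝ) := by
    have := integral_minkFourier ρ 0
    rw [hρ0, mul_one] at this
    rw [← this]
    congr 1
    funext x
    simp [mdot]
  rw [← h3]
  refine tendsto_nhds_unique_of_eventuallyEq h1 h2 ?_
  filter_upwards [self_mem_nhdsWithin] with ε hε
  have hε : 0 < ε := hε
  have hi' := integrable_oscFactor_smul isPhase_minkPhase (hc.integrable ε hε)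
  rw [oscReg]
  rw [show (volume : Measure (Mink n × Mink n)) = (volume : Measure (Mink n)).prod volume from rfl]
    at hi' ⊢
  rw [integral_prod _ hi']
  have h4 : ∀ x : Mink n, ∫ p : Mink n, oscFactor minkPhase (x, p) • (χ (ε • (x, p)) • (1 : ℂ)) =
      ((ε ^ (n + 2))⁻¹ : ℝ) • (ρ (ε • x) * minkFourier ρ (ε⁻¹ • x)) := by
    intro x
    obtain ⟨g, hg⟩ : ∃ g : Mink n → ℂ,
        ∀ p, g p = Complex.exp (-Complex.I * (mdot p (ε⁻¹ • x) : ℂ)) * ρ p := ⟨_, fun _ => rfl⟩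
    have e : ∀ p : Mink n, oscFactor minkPhase (x, p) • (χ (ε • (x, p)) • (1 : ℂ)) =
        ρ (ε • x) * g (ε • p) := by
      intro p
      rw [hg]
      have : mdot (ε • p) (ε⁻¹ • x) = mdot p x := by
        rw [← mdotL_apply, ← mdotL_apply]
        simp
        field_simp
      simp only [this, hχ, oscFactor, minkPhase, smul_eq_mul, Prod.smul_mk]
      ring
    simp_rw [e]
    rw [integral_const_mul, Measure.integral_comp_smul]
    simp_rw [hg]
    rw [← minkFourier_apply, finrank_euclideanSpace_fin, abs_of_pos (by positivity)]
    simp only [Complex.real_smul]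
    ring
  simp_rw [h4]
  rw [integral_smul]
  obtain ⟨g, hg⟩ : ∃ g : Mink n → ℂ, ∀ y, g y = ρ ((ε ^ 2) • y) * minkFourier ρ y :=
    ⟨_, fun _ => rfl⟩
  have h5 : ∀ x : Mink n, ρ (ε • x) * minkFourier ρ (ε⁻¹ • x) = g (ε⁻¹ • x) := by
    intro x
    rw [hg]
    simp only [smul_smul]
    congr 3
    field_simp
  simp_rw [h5]
  rw [Measure.integral_comp_inv_smul, finrank_euclideanSpace_fin, abs_of_pos (by positivity),
    smul_smul, inv_mul_cancel₀ (by positivity), one_smul]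
  simp_rw [hg]

end Mink

/-! ### Families of functions which are closed under differentiation -/

section Families

open Filter Topology

variable {Z : Type*} [NormedAddCommGroup Z] [NormedSpace ℝ Z]
  {V : Type*} [NormedAddCommGroup V] [NormedSpace ℂ V] {ι κ : Type*} [Fintype κ]

/-- A set of continuous functionals which determines the norm. -/
structure IsNorming (N : Set (V →L[ℝ] ℂ)) : Prop where
  norm_le_one : ∀ l ∈ N, ‖l‖ ≤ 1
  le_of_forall : ∀ (v : V) (M : ℝ), 0 ≤ M → (∀ l ∈ N, ‖l v‖ ≤ M) → ‖v‖ ≤ M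

/-- Weak differentiability implies differentiability for families of bounded functions which are
closed under weak differentiation: boundedness of the first derivatives gives Lipschitz
continuity, and then boundedness of the second derivatives gives differentiability. -/
theorem hasFDerivAt_of_weak {N : Set (V →L[ℝ] ℂ)} (hN : IsNorming N) {a : ι → Z → V}
    {s : κ → ι → ι} {ℓ : κ → Z →L[ℝ] ℝ} (hb : ∀ i, ∃ M, ∀ z, ‖a i z‖ ≤ M)
    (hw : ∀ i, ∀ l ∈ N, ∀ z,
      HasFDerivAt (fun z => l (a i z)) (∑ k, (ℓ k).smulRight (l (a (s k i) z))) z) :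
    ∀ i z, HasFDerivAt (a i) (∑ k, (ℓ k).smulRight (a (s k i) z)) z := by
  -- all members of the family are Lipschitz continuous, hence so are their derivatives
  have hlip : ∀ i, ∃ L, 0 ≤ L ∧ ∀ x y, ‖a i y - a i x‖ ≤ L * ‖y - x‖ := by
    intro i
    choose M hM using hb
    have hM0 : ∀ j, 0 ≤ M j := fun j => (norm_nonneg _).trans (hM j 0)
    have hL : 0 ≤ ∑ k, ‖ℓ k‖ * M (s k i) :=
      Finset.sum_nonneg fun k _ => mul_nonneg (norm_nonneg _) (hM0 _)
    refine ⟨∑ k, ‖ℓ k‖ * M (s k i), hL, fun x y => ?_⟩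
    refine hN.le_of_forall _ _ (by positivity) fun l hl => ?_
    rw [map_sub]
    refine Convex.norm_image_sub_le_of_norm_hasFDerivWithin_le (𝕜 := ℝ) (s := Set.univ)
      (fun z _ => (hw i l hl z).hasFDerivWithinAt) (fun z _ => ?_) convex_univ
      (Set.mem_univ _) (Set.mem_univ _)
    refine (norm_sum_le _ _).trans (Finset.sum_le_sum fun k _ => ?_)
    rw [ContinuousLinearMap.norm_smulRight_apply]
    gcongr
    refine (l.le_opNorm _).trans ?_
    calc ‖l‖ * ‖a (s k i) z‖ ≤ 1 * M (s k i) := by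
          gcongr
          · exact hN.norm_le_one l hl
          · exact hM _ z
      _ = _ := one_mul _
  choose L hL0 hL using hlip
  intro i z
  have hC : 0 ≤ ∑ k, ‖ℓ k‖ * L (s k i) :=
    Finset.sum_nonneg fun k _ => mul_nonneg (norm_nonneg _) (hL0 _)
  have key : ∀ h : Z, ‖a i (z + h) - a i z - (∑ k, (ℓ k).smulRight (a (s k i) z)) h‖ ≤
      (∑ k, ‖ℓ k‖ * L (s k i)) * ‖h‖ ^ 2 := by
    intro h
    refine hN.le_of_forall _ _ (by positivity) fun l hl => ?_
    have e : l (a i (z + h) - a i z - (∑ k, (ℓ k).smulRight (a (s k i) z)) h) =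
        l (a i (z + h)) - l (a i z) -
          (∑ k, (ℓ k).smulRight (l (a (s k i) z))) ((z + h) - z) := by
      simp
    rw [e]
    have hz : z ∈ Metric.closedBall z ‖h‖ := Metric.mem_closedBall_self (norm_nonneg _)
    have hzh : z + h ∈ Metric.closedBall z ‖h‖ := by simp
    refine (Convex.norm_image_sub_le_of_norm_hasFDerivWithin_le' (𝕜 := ℝ)
      (s := Metric.closedBall z ‖h‖) (C := (∑ k, ‖ℓ k‖ * L (s k i)) * ‖h‖)
      (fun y _ => (hw i l hl y).hasFDerivWithinAt) (fun y hy => ?_) (convex_closedBall z ‖h‖)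
      hz hzh).trans (le_of_eq (by rw [add_sub_cancel_left]; ring))
    rw [← Finset.sum_sub_distrib, Finset.sum_mul]
    refine (norm_sum_le _ _).trans (Finset.sum_le_sum fun k _ => ?_)
    have e2 : (ℓ k).smulRight (l (a (s k i) y)) - (ℓ k).smulRight (l (a (s k i) z)) =
        (ℓ k).smulRight (l (a (s k i) y - a (s k i) z)) := by
      ext x; simp [mul_sub]
    rw [e2, ContinuousLinearMap.norm_smulRight_apply, mul_assoc]
    gcongr
    refine (l.le_opNorm _).trans ?_
    have h1 : ‖y - z‖ ≤ ‖h‖ := by simpa [dist_eq_norm] using hy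
    calc ‖l‖ * ‖a (s k i) y - a (s k i) z‖ ≤ 1 * (L (s k i) * ‖h‖) := by
          gcongr
          · exact hN.norm_le_one l hl
          · exact (hL _ z y).trans (mul_le_mul_of_nonneg_left h1 (hL0 _))
      _ = _ := one_mul _
  rw [hasFDerivAt_iff_isLittleO_nhds_zero]
  refine Asymptotics.IsBigO.trans_isLittleO (g := fun h : Z => ‖h‖ ^ 2) ?_
    (Asymptotics.isLittleO_norm_pow_id one_lt_two)
  refine Asymptotics.IsBigO.of_bound (∑ k, ‖ℓ k‖ * L (s k i)) (Eventually.of_forall fun h => ?_)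
  rw [norm_pow, norm_norm]
  exact key h

variable {a : ι → Z → V} {s : κ → ι → ι} {ℓ : κ → Z →L[ℝ] ℝ}

theorem fderiv_family (h : ∀ i z, HasFDerivAt (a i) (∑ k, (ℓ k).smulRight (a (s k i) z)) z)
    (i : ι) : fderiv ℝ (a i) =
      fun z => ∑ k, ContinuousLinearMap.smulRightL ℝ Z V (ℓ k) (a (s k i) z) :=
  funext fun z => (h i z).fderiv

/-- A family which is closed under taking partial derivatives consists of smooth functions. -/
theorem contDiff_family (h : ∀ i z, HasFDerivAt (a i) (∑ k, (ℓ k).smulRight (a (s k i) z)) z)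
    (i : ι) : ContDiff ℝ ∞ (a i) := by
  rw [contDiff_infty]
  intro m
  induction m generalizing i with
  | zero =>
    exact contDiff_zero.2 (continuous_iff_continuousAt.2 fun z => (h i z).continuousAt)
  | succ m ih =>
    have : ((m + 1 : ℕ) : ℕ∞ω) = (m : ℕ∞ω) + 1 := by push_cast; rfl
    rw [this, contDiff_succ_iff_fderiv]
    refine ⟨fun z => (h i z).differentiableAt, by simp, ?_⟩
    rw [fderiv_family h]
    exact ContDiff.sum fun k _ => (ContinuousLinearMap.contDiff _).comp (ih _)

theorem norm_iteratedFDeriv_succ_family_le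
    (h : ∀ i z, HasFDerivAt (a i) (∑ k, (ℓ k).smulRight (a (s k i) z)) z) (i : ι) (j : ℕ) (z : Z) :
    ‖iteratedFDeriv ℝ (j + 1) (a i) z‖ ≤
      ∑ k, ‖ℓ k‖ * ‖iteratedFDeriv ℝ j (a (s k i)) z‖ := by
  rw [← norm_iteratedFDeriv_fderiv, fderiv_family h]
  have hs : ∀ k, ContDiff ℝ ∞ (a (s k i)) := fun k => contDiff_family h _
  have hs' : ∀ k, ContDiff ℝ ∞ fun z => ContinuousLinearMap.smulRightL ℝ Z V (ℓ k) (a (s k i) z) :=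
    fun k => (ContinuousLinearMap.contDiff _).comp (hs k)
  rw [iteratedFDeriv_fun_sum_apply (fun k _ => ((hs' k).contDiffAt.of_le
    (by exact_mod_cast le_top)))]
  refine (norm_sum_le _ _).trans (Finset.sum_le_sum fun k _ => ?_)
  refine ((ContinuousLinearMap.smulRightL ℝ Z V (ℓ k)).norm_iteratedFDeriv_comp_left (N := ∞)
    (hs k).contDiffAt (by exact_mod_cast le_top)).trans ?_
  gcongr
  refine ContinuousLinearMap.opNorm_le_bound _ (norm_nonneg _) fun v => ?_
  exact (ContinuousLinearMap.norm_smulRight_apply _ _).le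

end Families

/-! ### Smooth vectors -/

section SmoothVectors

open Filter Topology MeasureTheory Poincare

variable {n : ℕ} {H : Type*} [NormedAddCommGroup H] [InnerProductSpace ℂ H]
  {U : Poincare n →* (H ≃ₗᵢ[ℂ] H)}

theorem trans_zero : trans (0 : Mink n) = 1 := rfl

theorem orbit_zero (ψ : H) : orbit U ψ 0 = ψ := by
  simp [orbit, trans_zero]

theorem map_trans_trans (x y : Mink n) (ψ : H) :
    U (trans x) (U (trans y) ψ) = U (trans (x + y)) ψ := by
  rw [trans_add, map_mul]; rfl

theorem norm_map (g : Poincare n) (ψ : H) : ‖U g ψ‖ = ‖ψ‖ := (U g).norm_map ψ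

theorem inner_map_trans (x : Mink n) (φ ψ : H) :
    ⟪φ, U (trans x) ψ⟫_ℂ = ⟪U (trans (-x)) φ, ψ⟫_ℂ := by
  rw [← (U (trans x)).inner_map_map (U (trans (-x)) φ) ψ, map_trans_trans, add_neg_cancel,
    trans_zero, map_one]
  rfl

theorem coe_smoothAct (g : Poincare n) (ψ : smoothVectors U) :
    (smoothAct U g ψ : H) = U g ψ := rfl

theorem coe_smoothAct_symm (g : Poincare n) (ψ : smoothVectors U) :
    ((smoothAct U g).symm ψ : H) = U g⁻¹ ψ := rfl

theorem trans_inv (x : Mink n) : (trans x)⁻¹ = trans (-x) := by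
  rw [inv_eq_iff_mul_eq_one, ← trans_add, add_neg_cancel, trans_zero]

/-- The coordinate functions on Minkowski space. -/
noncomputable def coord (μ : Fin (n + 2)) : Mink n →L[ℝ] ℝ := EuclideanSpace.proj μ

theorem coord_apply (μ : Fin (n + 2)) (x : Mink n) : coord μ x = x μ := rfl

theorem sum_coord_single (x : Mink n) :
    ∑ μ, coord μ x • (EuclideanSpace.single μ (1 : ℝ) : Mink n) = x := by
  ext i
  simp [coord_apply, Finset.sum_apply, Pi.single_apply]

theorem contDiff_orbit (ψ : smoothVectors U) : ContDiff ℝ ∞ (orbit U (ψ : H)) := ψ.2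

theorem fderiv_orbit (ψ : smoothVectors U) (x h : Mink n) :
    fderiv ℝ (orbit U (ψ : H)) x h = U (trans x) (fderiv ℝ (orbit U (ψ : H)) 0 h) := by
  let L : H →L[ℝ] H :=
    ((U (trans x)).toContinuousLinearEquiv : H →L[ℂ] H).restrictScalars ℝ
  have h0 : HasFDerivAt (orbit U (ψ : H)) (fderiv ℝ (orbit U (ψ : H)) 0) 0 :=
    ((contDiff_orbit ψ).differentiable (by simp) 0).hasFDerivAt
  have h1 : HasFDerivAt (fun y => orbit U (ψ : H) (x + y))
      (L.comp (fderiv ℝ (orbit U (ψ : H)) 0)) 0 := by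
    have := L.hasFDerivAt.comp (0 : Mink n) h0
    refine this.congr_of_eventuallyEq (Filter.Eventually.of_forall fun y => ?_)
    exact (orbit_apply_trans U (ψ : H) y x).symm
  have h2 : HasFDerivAt (fun y => orbit U (ψ : H) (x + y))
      (fderiv ℝ (orbit U (ψ : H)) x) 0 := by
    have hx : HasFDerivAt (orbit U (ψ : H)) (fderiv ℝ (orbit U (ψ : H)) x) (x + 0) := by
      rw [add_zero]; exact ((contDiff_orbit ψ).differentiable (by simp) x).hasFDerivAt
    have := hx.comp (0 : Mink n) ((hasFDerivAt_id (0 : Mink n)).const_add x)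
    rwa [ContinuousLinearMap.comp_id] at this
  rw [← h1.unique h2]
  rfl

theorem coe_partialU (μ : Fin (n + 2)) (ψ : smoothVectors U) :
    (partialU U μ ψ : H) = fderiv ℝ (orbit U (ψ : H)) 0 (EuclideanSpace.single μ 1) := rfl

theorem orbit_partialU (μ : Fin (n + 2)) (ψ : smoothVectors U) (x : Mink n) :
    orbit U (partialU U μ ψ : H) x =
      fderiv ℝ (orbit U (ψ : H)) x (EuclideanSpace.single μ 1) :=
  (fderiv_orbit ψ x _).symm

theorem hasFDerivAt_orbit (ψ : smoothVectors U) (x : Mink n) :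
    HasFDerivAt (orbit U (ψ : H))
      (∑ μ, (coord μ).smulRight (orbit U (partialU U μ ψ : H) x)) x := by
  have h := ((contDiff_orbit ψ).differentiable (by simp) x).hasFDerivAt
  have e : ∑ μ, (coord μ).smulRight (orbit U (partialU U μ ψ : H) x) =
      fderiv ℝ (orbit U (ψ : H)) x := by
    ext1 y
    conv_rhs => rw [← sum_coord_single y]
    rw [map_sum]
    simp [orbit_partialU]
  rwa [e]

theorem partialU_comm (μ ν : Fin (n + 2)) : partialU U μ * partialU U ν =
    partialU U ν * partialU U μ := by
  have key : ∀ (μ ν : Fin (n + 2)) (ψ : smoothVectors U), (partialU U μ (partialU U ν ψ) : H) =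
      fderiv ℝ (fderiv ℝ (orbit U (ψ : H))) 0 (EuclideanSpace.single μ 1)
        (EuclideanSpace.single ν 1) := by
    intro μ ν ψ
    have h : orbit U (partialU U ν ψ : H) = fun x => fderiv ℝ (orbit U (ψ : H)) x
      (EuclideanSpace.single ν 1) := funext fun x => orbit_partialU ν ψ x
    rw [coe_partialU, h, fderiv_clm_apply]
    · simp
    · exact ((contDiff_orbit ψ).fderiv_right (m := ∞) (by simp)).differentiable (by simp) 0
    · exact differentiableAt_const _
  ext ψ
  show (partialU U μ (partialU U ν ψ) : H) = (partialU U ν (partialU U μ ψ) : H)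
  rw [key, key]
  have : IsSymmSndFDerivAt ℝ (orbit U (ψ : H)) 0 :=
    (contDiff_orbit ψ).contDiffAt.isSymmSndFDerivAt (by
      simp only [minSmoothness_of_isRCLikeNormedField]; exact WithTop.coe_le_coe.2 le_top)
  exact this _ _

theorem partialU_smoothAct (μ : Fin (n + 2)) (x : Mink n) (ψ : smoothVectors U) :
    partialU U μ (smoothAct U (trans x) ψ) = smoothAct U (trans x) (partialU U μ ψ) := by
  ext
  have e : orbit U (smoothAct U (trans x) ψ : H) = fun y => orbit U (ψ : H) (y + x) := by
    funext y
    rw [coe_smoothAct, orbit, map_trans_trans]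
    rfl
  rw [coe_partialU, e, fderiv_comp_add_right, zero_add, coe_smoothAct, ← orbit_partialU]
  rfl

theorem inner_partialU (μ : Fin (n + 2)) (φ ψ : smoothVectors U) :
    ⟪(partialU U μ φ : H), (ψ : H)⟫_ℂ = -⟪(φ : H), (partialU U μ ψ : H)⟫_ℂ := by
  have h1 := (hasFDerivAt_orbit φ 0).inner ℂ (hasFDerivAt_orbit ψ 0)
  have h2 : (fun x => ⟪orbit U (φ : H) x, orbit U (ψ : H) x⟫_ℂ) =
      fun _ => ⟪(φ : H), (ψ : H)⟫_ℂ := by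
    funext x
    exact (U (trans x)).inner_map_map _ _
  rw [h2] at h1
  have h3 := DFunLike.congr_fun (h1.unique (hasFDerivAt_const _ _))
    (EuclideanSpace.single μ (1 : ℝ) : Mink n)
  simp [fderivInnerCLM_apply, orbit_zero, coord_apply] at h3
  rw [eq_neg_iff_add_eq_zero, add_comm]
  exact h3

theorem energyOp_apply (ψ : smoothVectors U) :
    energyOp U ψ = ψ - ∑ μ, partialU U μ (partialU U μ ψ) := by
  simp [energyOp]

theorem energyOp_comm_partialU (μ : Fin (n + 2)) :
    energyOp U * partialU U μ = partialU U μ * energyOp U := by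
  rw [energyOp, sub_mul, mul_sub, one_mul, mul_one, Finset.sum_mul, Finset.mul_sum]
  congr 1
  refine Finset.sum_congr rfl fun ν _ => ?_
  rw [mul_assoc, partialU_comm ν μ, ← mul_assoc, partialU_comm ν μ, mul_assoc]

theorem energyOp_pow_partialU (k : ℕ) (μ : Fin (n + 2)) (ψ : smoothVectors U) :
    (energyOp U ^ k) (partialU U μ ψ) = partialU U μ ((energyOp U ^ k) ψ) := by
  have h : Commute (energyOp U) (partialU U μ) := energyOp_comm_partialU μ
  exact DFunLike.congr_fun (h.pow_left k).eq ψ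

theorem energyOp_smoothAct (x : Mink n) (ψ : smoothVectors U) :
    energyOp U (smoothAct U (trans x) ψ) = smoothAct U (trans x) (energyOp U ψ) := by
  simp only [energyOp_apply, map_sub, map_sum, partialU_smoothAct]

theorem energyOp_pow_succ_apply (k : ℕ) (ψ : smoothVectors U) :
    (energyOp U ^ (k + 1)) ψ = energyOp U ((energyOp U ^ k) ψ) := by
  rw [pow_succ']; rfl

theorem energyOp_pow_succ_apply' (k : ℕ) (ψ : smoothVectors U) :
    (energyOp U ^ (k + 1)) ψ = (energyOp U ^ k) (energyOp U ψ) := by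
  rw [pow_succ]; rfl

theorem energyOp_pow_smoothAct (k : ℕ) (x : Mink n) (ψ : smoothVectors U) :
    (energyOp U ^ k) (smoothAct U (trans x) ψ) = smoothAct U (trans x) ((energyOp U ^ k) ψ) := by
  induction k with
  | zero => rfl
  | succ k ih => rw [energyOp_pow_succ_apply, ih, energyOp_smoothAct, ← energyOp_pow_succ_apply]

theorem inner_energyOp (φ ψ : smoothVectors U) :
    ⟪(energyOp U φ : H), (ψ : H)⟫_ℂ = ⟪(φ : H), (energyOp U ψ : H)⟫_ℂ := by
  simp only [energyOp_apply, Submodule.coe_sub, Submodule.coe_sum, inner_sub_left,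
    inner_sub_right, sum_inner, inner_sum, inner_partialU, neg_neg]

theorem re_inner_energyOp (ψ : smoothVectors U) :
    (⟪(ψ : H), (energyOp U ψ : H)⟫_ℂ).re = ‖ψ‖ ^ 2 + ∑ μ, ‖partialU U μ ψ‖ ^ 2 := by
  simp only [energyOp_apply, Submodule.coe_sub, Submodule.coe_sum, inner_sub_right, inner_sum,
    Complex.sub_re, Complex.re_sum]
  have h1 : (⟪(ψ : H), (ψ : H)⟫_ℂ).re = ‖ψ‖ ^ 2 := by
    rw [inner_self_eq_norm_sq_to_K]
    norm_cast
  have h2 : ∀ μ, (⟪(ψ : H), (partialU U μ (partialU U μ ψ) : H)⟫_ℂ).re = -‖partialU U μ ψ‖ ^ 2 := by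
    intro μ
    have h := inner_partialU μ ψ (partialU U μ ψ)
    rw [inner_self_eq_norm_sq_to_K] at h
    have h' : ⟪(ψ : H), (partialU U μ (partialU U μ ψ) : H)⟫_ℂ =
      -((‖(partialU U μ ψ : H)‖ : ℂ) ^ 2) := by rw [← neg_eq_iff_eq_neg]; exact h.symm
    rw [h']
    norm_cast
  simp only [h1, h2, Finset.sum_neg_distrib, sub_neg_eq_add]

/-- The basic energy estimate: `⟪ψ, (1 + |P|²) ψ⟫` is the sum of `‖ψ‖²` and of the squared norms
of the first derivatives. -/
theorem sq_add_sq_le_energyOp (ψ : smoothVectors U) :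
    ‖ψ‖ ^ 2 + ∑ μ, ‖partialU U μ ψ‖ ^ 2 ≤ ‖ψ‖ * ‖energyOp U ψ‖ := by
  rw [← re_inner_energyOp]
  exact (Complex.re_le_norm _).trans (norm_inner_le_norm (ψ : H) (energyOp U ψ : H))

theorem norm_le_energyOp (ψ : smoothVectors U) : ‖ψ‖ ≤ ‖energyOp U ψ‖ := by
  have h := sq_add_sq_le_energyOp ψ
  have h2 : 0 ≤ ∑ μ, ‖partialU U μ ψ‖ ^ 2 := Finset.sum_nonneg fun μ _ => sq_nonneg _
  rcases (norm_nonneg ψ).eq_or_lt with h0 | h0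
  · rw [← h0]; exact norm_nonneg _
  · nlinarith

theorem norm_partialU_le (μ : Fin (n + 2)) (ψ : smoothVectors U) :
    ‖partialU U μ ψ‖ ≤ ‖energyOp U ψ‖ := by
  have h := sq_add_sq_le_energyOp ψ
  have h2 := Finset.single_le_sum (f := fun μ => ‖partialU U μ ψ‖ ^ 2)
    (fun μ _ => sq_nonneg _) (Finset.mem_univ μ)
  have h3 := norm_le_energyOp ψ
  refine abs_le_of_sq_le_sq' ?_ (norm_nonneg _) |>.2
  nlinarith [norm_nonneg ψ, norm_nonneg (energyOp U ψ), sq_nonneg ‖ψ‖]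

theorem norm_energyOp_pow_mono {k l : ℕ} (h : k ≤ l) (ψ : smoothVectors U) :
    ‖(energyOp U ^ k) ψ‖ ≤ ‖(energyOp U ^ l) ψ‖ := by
  induction l, h using Nat.le_induction with
  | base => exact le_rfl
  | succ l _ ih =>
    refine ih.trans ?_
    rw [energyOp_pow_succ_apply]
    exact norm_le_energyOp _

theorem norm_energyOp_pow_partialU_le (k : ℕ) (μ : Fin (n + 2)) (ψ : smoothVectors U) :
    ‖(energyOp U ^ k) (partialU U μ ψ)‖ ≤ ‖(energyOp U ^ (k + 1)) ψ‖ := by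
  rw [energyOp_pow_partialU, energyOp_pow_succ_apply]
  exact norm_partialU_le _ _

theorem norm_energyOp_pow_smoothAct (k : ℕ) (x : Mink n) (ψ : smoothVectors U) :
    ‖(energyOp U ^ k) (smoothAct U (trans x) ψ)‖ = ‖(energyOp U ^ k) ψ‖ := by
  rw [energyOp_pow_smoothAct]
  exact norm_map _ _

end SmoothVectors

section Density

open Filter Topology MeasureTheory Poincare
open scoped Convolution

variable {n : ℕ} {H : Type*} [NormedAddCommGroup H] [InnerProductSpace ℂ H]
  {U : Poincare n →* (H ≃ₗᵢ[ℂ] H)}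

/-- The scalar products with the unit vectors of a dense subspace determine the norm. -/
theorem isNorming_inner {D : Submodule ℂ H} (hD : Dense (D : Set H)) :
    IsNorming {l : H →L[ℝ] ℂ | ∃ φ ∈ D, ‖φ‖ ≤ 1 ∧ l = (innerSL ℂ φ).restrictScalars ℝ} := by
  refine ⟨?_, fun v M hM h => ?_⟩
  · rintro l ⟨φ, -, hφ, rfl⟩
    refine ContinuousLinearMap.opNorm_le_bound _ zero_le_one fun x => ?_
    refine (norm_inner_le_norm φ x).trans ?_
    gcongr
  · have h1 : ∀ φ ∈ D, ‖⟪φ, v⟫_ℂ‖ ≤ M * ‖φ‖ := by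
      intro φ hφ
      rcases eq_or_ne φ 0 with rfl | h0
      · simp
      have hpos : 0 < ‖φ‖ := norm_pos_iff.2 h0
      have := h _ ⟨((‖φ‖⁻¹ : ℝ) : ℂ) • φ, D.smul_mem _ hφ, by
        rw [norm_smul, Complex.norm_real, norm_inv, norm_norm, inv_mul_cancel₀ hpos.ne'], rfl⟩
      simp only [ContinuousLinearMap.coe_restrictScalars', innerSL_apply_apply, inner_smul_left,
        norm_mul, Complex.conj_ofReal, Complex.norm_real, norm_inv, norm_norm] at this
      rwa [inv_mul_le_iff₀ hpos, mul_comm] at this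
    have h2 : ∀ φ, ‖⟪φ, v⟫_ℂ‖ ≤ M * ‖φ‖ := by
      have hc : IsClosed {φ : H | ‖⟪φ, v⟫_ℂ‖ ≤ M * ‖φ‖} :=
        isClosed_le (by fun_prop) (by fun_prop)
      intro φ
      have := hc.closure_subset_iff.2 h1 (hD φ)
      exact this
    have h3 := h2 v
    rw [inner_self_eq_norm_sq_to_K, norm_pow] at h3
    simp only [RCLike.norm_ofReal, abs_norm] at h3
    rcases (norm_nonneg v).eq_or_lt with h0 | h0
    · rw [← h0]; exact hM
    · nlinarith

theorem ext_inner_dense {D : Submodule ℂ H} (hD : Dense (D : Set H)) {v w : H}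
    (h : ∀ φ ∈ D, ⟪φ, v⟫_ℂ = ⟪φ, w⟫_ℂ) : v = w := by
  rw [← sub_eq_zero, ← norm_le_zero_iff]
  refine (isNorming_inner hD).le_of_forall _ _ le_rfl ?_
  rintro l ⟨φ, hφ, -, rfl⟩
  simp [inner_sub_right, h φ hφ]

theorem continuous_trans : Continuous (trans : Mink n → Poincare n) := by
  rw [continuous_induced_rng]
  exact continuous_const.prodMk continuous_id

theorem continuous_orbit (hU : ∀ ψ : H, Continuous fun g => U g ψ) (ψ : H) :
    Continuous (orbit U ψ) := (hU ψ).comp continuous_trans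

/-- Gårding's theorem: the smooth vectors are dense. They contain the averages of all vectors
over the translations with smooth weights. -/
theorem dense_smoothVectors [CompleteSpace H] (hU : ∀ ψ : H, Continuous fun g => U g ψ) :
    Dense (smoothVectors U : Set H) := by
  intro ψ
  have hc := continuous_orbit hU ψ
  let f : ℕ → ContDiffBump (0 : Mink n) := fun k =>
    ⟨1 / (k + 2 : ℝ), 1 / (k + 1 : ℝ), by positivity, by
      apply one_div_lt_one_div_of_lt <;> [positivity; linarith]⟩
  have hf : Tendsto (fun k => (f k).rOut) atTop (𝓝 0) := tendsto_one_div_add_atTop_nhds_zero_nat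
  let g : ℕ → Mink n → H := fun k =>
    ((f k).normed volume ⋆[ContinuousLinearMap.lsmul ℝ ℝ, volume] orbit U ψ)
  have hlim : Tendsto (fun k => g k 0) atTop (𝓝 ψ) := by
    have := ContDiffBump.convolution_tendsto_right_of_continuous (μ := volume) hf hc 0
    rwa [orbit_zero] at this
  refine mem_closure_of_tendsto hlim (Eventually.of_forall fun k => ?_)
  show ContDiff ℝ ∞ (orbit U (g k 0))
  have e : orbit U (g k 0) = g k := by
    funext y
    have hint : Integrable (fun t : Mink n => (f k).normed volume t • orbit U ψ (0 - t)) := by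
      refine Continuous.integrable_of_hasCompactSupport ?_ ?_
      · have := (f k).continuous_normed (μ := volume)
        fun_prop
      · exact (f k).hasCompactSupport_normed.smul_right
    have h1 := ((U (trans y)).toContinuousLinearEquiv : H →L[ℂ] H).integral_comp_comm hint
    refine h1.symm.trans (integral_congr_ae (Eventually.of_forall fun t => ?_))
    show U (trans y) ((f k).normed volume t • orbit U ψ (0 - t)) = _
    rw [← Complex.coe_smul, map_smul, orbit_apply_trans, zero_sub, ← sub_eq_add_neg,
      Complex.coe_smul]
    rfl
  rw [e]
  exact (f k).hasCompactSupport_normed.contDiff_convolution_left _ (f k).contDiff_normed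
    hc.locallyIntegrable

theorem hasFDerivAt_inner_map_trans (φ : smoothVectors U) (η : H) (x : Mink n) :
    HasFDerivAt (fun x => ⟪(φ : H), U (trans x) η⟫_ℂ)
      (∑ μ, (coord μ).smulRight (-⟪(partialU U μ φ : H), U (trans x) η⟫_ℂ)) x := by
  have h1 : HasFDerivAt (fun x : Mink n => orbit U (φ : H) (-x))
      (-∑ μ, (coord μ).smulRight (orbit U (partialU U μ φ : H) (-x))) x := by
    have := (hasFDerivAt_orbit φ (-x)).comp x (hasFDerivAt_id x).neg
    refine this.congr_fderiv ?_
    ext y; simp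
  have h2 := h1.inner ℂ (hasFDerivAt_const η x)
  simp only [inner_map_trans]
  refine h2.congr_fderiv ?_
  ext y
  simp only [orbit, fderivInnerCLM_apply, ContinuousLinearMap.comp_apply,
    ContinuousLinearMap.prod_apply, neg_apply, zero_apply, sum_apply,
    ContinuousLinearMap.smulRight_apply, inner_zero_right, inner_neg_left, sum_inner, zero_add,
    smul_neg, Finset.sum_neg_distrib]
  congr 1
  refine Finset.sum_congr rfl fun μ _ => ?_
  rw [← Complex.coe_smul, inner_smul_left, Complex.conj_ofReal, Complex.real_smul]

/-- Vectors which are weakly differentiable to all orders are smooth. -/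
theorem mem_smoothVectors_of_weak (hD : Dense (smoothVectors U : Set H)) {ι : Type*} {η : ι → H}
    {s : Fin (n + 2) → ι → ι}
    (h : ∀ i μ (φ : smoothVectors U), ⟪(partialU U μ φ : H), η i⟫_ℂ = -⟪(φ : H), η (s μ i)⟫_ℂ)
    (i : ι) : η i ∈ smoothVectors U := by
  have hder := hasFDerivAt_of_weak (isNorming_inner hD)
    (a := fun i x => orbit U (η i) x) (s := s) (ℓ := coord)
    (fun i => ⟨‖η i‖, fun z => (norm_map _ _).le⟩) (by
      rintro i l ⟨φ, hφ, -, rfl⟩ z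
      refine (hasFDerivAt_inner_map_trans ⟨φ, hφ⟩ (η i) z).congr_fderiv ?_
      refine Finset.sum_congr rfl fun μ _ => ?_
      congr 1
      rw [inner_map_trans, ← coe_smoothAct, ← partialU_smoothAct, h, neg_neg, coe_smoothAct,
        ← inner_map_trans]
      rfl)
  exact contDiff_family hder i

/-- A bounded solution of `Δ f = f` is not positive, by the maximum principle for
`f - ε (|x|² + 2 d)`. -/
theorem bounded_eigenfunction_nonpos {f : Mink n → ℝ} {f₁ f₂ : Fin (n + 2) → Mink n → ℝ} {M : ℝ}
    (hc : Continuous f) (hM : ∀ x, f x ≤ M)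
    (h1 : ∀ μ x t, HasDerivAt (fun t : ℝ => f (x + t • EuclideanSpace.single μ 1))
      (f₁ μ (x + t • EuclideanSpace.single μ 1)) t)
    (h2 : ∀ μ x t, HasDerivAt (fun t : ℝ => f₁ μ (x + t • EuclideanSpace.single μ 1))
      (f₂ μ (x + t • EuclideanSpace.single μ 1)) t)
    (hsum : ∀ x, ∑ μ, f₂ μ x = f x) : f 0 ≤ 0 := by
  have key : ∀ ε : ℝ, 0 < ε → f 0 ≤ ε * (2 * (n + 2)) := by
    intro ε hε
    let g : Mink n → ℝ := fun x => f x - ε * (‖x‖ ^ 2 + 2 * (n + 2))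
    have hg : Continuous g := by fun_prop
    have hlim : Tendsto g (cocompact (Mink n)) atBot := by
      have h3 : Tendsto (fun x : Mink n => M - ε * (‖x‖ ^ 2 + 2 * (n + 2))) (cocompact (Mink n))
          atBot := by
        refine tendsto_atBot_add_const_left _ M ?_ |>.congr fun x => (sub_eq_add_neg _ _).symm
        refine tendsto_neg_atTop_atBot.comp ?_
        refine Tendsto.const_mul_atTop hε ?_
        refine tendsto_atTop_add_const_right _ _ ?_
        exact (tendsto_pow_atTop two_ne_zero).comp (tendsto_norm_cocompact_atTop (E := Mink n))
      refine tendsto_atBot_mono (fun x => ?_) h3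
      have := hM x
      simp only [g]
      linarith
    -- at a maximum `x` of `g`, the second derivatives of `f` are at most those of the barrier
    obtain ⟨x, hx⟩ := hg.exists_forall_ge hlim
    have hsec : ∀ μ, f₂ μ x ≤ 2 * ε := by
      intro μ
      by_contra hlt
      push Not at hlt
      set e : Mink n := EuclideanSpace.single μ 1
      let φ : ℝ → ℝ := fun t => g (x + t • e)
      have hn : ∀ t : ℝ, ‖x + t • e‖ ^ 2 = ‖x‖ ^ 2 + 2 * t * x μ + t ^ 2 := by
        intro t
        rw [norm_add_sq_real, inner_smul_right, norm_smul]
        simp [e, EuclideanSpace.inner_single_right]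
        ring
      have hφ1 : ∀ t, HasDerivAt φ (f₁ μ (x + t • e) - ε * (2 * x μ + 2 * t)) t := by
        intro t
        have hq : HasDerivAt (fun t : ℝ => ε * (‖x‖ ^ 2 + 2 * t * x μ + t ^ 2 + 2 * (n + 2)))
            (ε * (2 * x μ + 2 * t)) t := by
          have ha : HasDerivAt (fun t : ℝ => 2 * t * x μ) (2 * x μ) t := by
            simpa using ((hasDerivAt_id t).const_mul 2).mul_const (x μ)
          have hb : HasDerivAt (fun t : ℝ => t ^ 2) (2 * t) t := by
            simpa using hasDerivAt_pow 2 t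
          have := (((ha.const_add (‖x‖ ^ 2)).add hb).add_const (2 * (n + 2) : ℝ)).const_mul ε
          exact this
        have := (h1 μ x t).sub hq
        refine this.congr_of_eventuallyEq (Eventually.of_forall fun t => ?_)
        simp only [φ, g, hn]
        rfl
      have hd : deriv φ = fun t => f₁ μ (x + t • e) - ε * (2 * x μ + 2 * t) :=
        funext fun t => (hφ1 t).deriv
      have hdd : HasDerivAt (deriv φ) (f₂ μ x - 2 * ε) 0 := by
        rw [hd]
        have ha : HasDerivAt (fun t : ℝ => ε * (2 * x μ + 2 * t)) (2 * ε) 0 := by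
          have := (((hasDerivAt_id (0 : ℝ)).const_mul 2).const_add (2 * x μ)).const_mul ε
          simpa [mul_comm] using this
        have := (h2 μ x 0).sub ha
        simp only [zero_smul, add_zero] at this
        exact this
      have hmax : IsLocalMax φ 0 := Eventually.of_forall fun t => by
        simpa [φ] using hx (x + t • e)
      -- a positive second derivative would make the maximum a minimum, hence `φ` locally constant
      have hmin : IsLocalMin φ 0 := by
        refine isLocalMin_of_deriv_deriv_pos ?_ hmax.deriv_eq_zero (hφ1 0).continuousAt
        rw [hdd.deriv]
        linarith
      have hconst : φ =ᶠ[𝓝 0] fun _ => φ 0 := by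
        filter_upwards [hmax, hmin] with t ha hb
        exact le_antisymm ha hb
      have h4 := hconst.deriv.deriv_eq
      rw [hdd.deriv] at h4
      simp at h4
      linarith
    have h5 : f x ≤ ε * (2 * (n + 2)) := by
      rw [← hsum x]
      refine (Finset.sum_le_sum fun μ _ => hsec μ).trans (le_of_eq ?_)
      simp
      ring
    have h6 : g 0 ≤ g x := hx 0
    simp only [g, norm_zero] at h6
    nlinarith [sq_nonneg ‖x‖]
  by_contra hlt
  push Not at hlt
  have h7 := key (f 0 / (4 * (n + 2))) (by positivity)
  have h8 : f 0 / (4 * (n + 2)) * (2 * (n + 2)) = f 0 / 2 := by field_simp; ring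
  rw [h8] at h7
  linarith

/-- The operator `1 + |P|²` has dense range. If `η` is orthogonal to all
`(1 + |P|²) U x φ`, then `x ↦ ⟪η, U x φ⟫` is a bounded solution of `Δ f = f`, hence zero. -/
theorem inner_eq_zero_of_inner_energyOp {η : H} {φ : smoothVectors U}
    (h : ∀ x, ⟪η, (energyOp U (smoothAct U (trans x) φ) : H)⟫_ℂ = 0) : ⟪η, (φ : H)⟫_ℂ = 0 := by
  have hd : ∀ (φ : smoothVectors U) (μ : Fin (n + 2)) (x : Mink n) (t : ℝ),
      HasDerivAt (fun t : ℝ => (⟪η, orbit U (φ : H) (x + t • EuclideanSpace.single μ 1)⟫_ℂ).re)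
      (⟪η, orbit U (partialU U μ φ : H) (x + t • EuclideanSpace.single μ 1)⟫_ℂ).re t := by
    intro φ μ x t
    have h1 : HasDerivAt (fun t : ℝ => x + t • (EuclideanSpace.single μ 1 : Mink n))
        (EuclideanSpace.single μ 1) t := by
      simpa using ((hasDerivAt_id t).smul_const (EuclideanSpace.single μ 1 : Mink n)).const_add x
    have h2 := ((hasFDerivAt_orbit φ (x + t • EuclideanSpace.single μ 1))).comp_hasDerivAt t h1
    have h3 := (Complex.reCLM.comp ((innerSL ℂ η).restrictScalars ℝ)).hasFDerivAt.comp_hasDerivAt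
      t h2
    refine h3.congr_deriv ?_
    simp [coord_apply]
  have main : ∀ φ : smoothVectors U,
      (∀ x, ⟪η, (energyOp U (smoothAct U (trans x) φ) : H)⟫_ℂ = 0) → (⟪η, (φ : H)⟫_ℂ).re ≤ 0 := by
    intro φ h
    have := bounded_eigenfunction_nonpos (f := fun x => (⟪η, orbit U (φ : H) x⟫_ℂ).re)
      (f₁ := fun μ x => (⟪η, orbit U (partialU U μ φ : H) x⟫_ℂ).re)
      (f₂ := fun μ x => (⟪η, orbit U (partialU U μ (partialU U μ φ) : H) x⟫_ℂ).re)
      (M := ‖η‖ * ‖φ‖) ?_ ?_ (hd φ) (fun μ => hd (partialU U μ φ) μ) ?_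
    · simpa [orbit_zero] using this
    · have := (contDiff_orbit φ).continuous
      fun_prop
    · intro x
      refine (Complex.re_le_norm _).trans ((norm_inner_le_norm _ _).trans (le_of_eq ?_))
      rw [orbit, norm_map]
      rfl
    · intro x
      have h4 := h x
      rw [energyOp_apply] at h4
      simp only [partialU_smoothAct, Submodule.coe_sub, Submodule.coe_sum, coe_smoothAct,
        inner_sub_right, inner_sum] at h4
      rw [sub_eq_zero] at h4
      rw [← Complex.re_sum]
      exact congrArg Complex.re h4.symm
  -- the choice of this multiple of `φ` turns the real part into the square of the modulus
  have h5 := main ((starRingEnd ℂ ⟪η, (φ : H)⟫_ℂ) • φ) fun x => by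
    rw [map_smul, map_smul, Submodule.coe_smul, inner_smul_right, h, mul_zero]
  rw [Submodule.coe_smul, inner_smul_right, mul_comm, Complex.mul_conj, Complex.ofReal_re] at h5
  exact Complex.normSq_eq_zero.1 (le_antisymm h5 (Complex.normSq_nonneg _))

/-- The powers of `1 + |P|²` have dense range on the smooth vectors. This takes the place of the
resolvents `(1 + |P|²)^(-m)`. -/
theorem dense_range_energyOp_pow [CompleteSpace H] (hD : Dense (smoothVectors U : Set H)) (k : ℕ) :
    Dense (Set.range fun φ : smoothVectors U => ((energyOp U ^ k) φ : H)) := by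
  let R : Submodule ℂ H :=
    LinearMap.range ((smoothVectors U).subtype ∘ₗ (energyOp U ^ k : Op U))
  have hR : (R : Set H) = Set.range fun φ : smoothVectors U => ((energyOp U ^ k) φ : H) := by
    ext; simp [R]
  rw [← hR, Submodule.dense_iff_topologicalClosure_eq_top,
    Submodule.topologicalClosure_eq_top_iff, Submodule.eq_bot_iff]
  intro η hη
  rw [Submodule.mem_orthogonal'] at hη
  have hη' : ∀ φ : smoothVectors U, ⟪η, ((energyOp U ^ k) φ : H)⟫_ℂ = 0 := fun φ =>
    hη _ ⟨φ, rfl⟩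
  have : ∀ φ : smoothVectors U, ⟪η, (φ : H)⟫_ℂ = 0 := by
    clear hη hR R
    induction k with
    | zero => exact hη'
    | succ k ih =>
      refine ih fun φ => inner_eq_zero_of_inner_energyOp fun x => ?_
      rw [← energyOp_pow_smoothAct, ← energyOp_pow_succ_apply]
      exact hη' _
  refine ext_inner_dense hD fun φ hφ => ?_
  rw [inner_zero_right, ← inner_conj_symm, this ⟨φ, hφ⟩, map_zero]

end Density

/-! ### Smooth operators -/

section SmoothOperators

open Filter Topology MeasureTheory Poincare

variable {n : ℕ} {H : Type*} [NormedAddCommGroup H] [InnerProductSpace ℂ H]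
  {U : Poincare n →* (H ≃ₗᵢ[ℂ] H)}

/-- The commutator with `partialU U μ`. -/
noncomputable def ad (U : Poincare n →* (H ≃ₗᵢ[ℂ] H)) (μ : Fin (n + 2)) : Op U →ₗ[ℂ] Op U where
  toFun F := partialU U μ * F - F * partialU U μ
  map_add' F G := by rw [mul_add, add_mul]; abel
  map_smul' c F := by rw [mul_smul_comm, smul_mul_assoc, RingHom.id_apply, smul_sub]

theorem ad_def (μ : Fin (n + 2)) (F : Op U) :
    ad U μ F = partialU U μ * F - F * partialU U μ := rfl

theorem ad_apply (μ : Fin (n + 2)) (F : Op U) (ψ : smoothVectors U) :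
    ad U μ F ψ = partialU U μ (F ψ) - F (partialU U μ ψ) := rfl

theorem ad_mul (μ : Fin (n + 2)) (F G : Op U) :
    ad U μ (F * G) = ad U μ F * G + F * ad U μ G := by
  simp only [ad_def, mul_sub, sub_mul, mul_assoc]
  abel

/-- Iterated commutators with the operators `partialU U μ`. -/
noncomputable def adWord (U : Poincare n →* (H ≃ₗᵢ[ℂ] H)) : List (Fin (n + 2)) → Op U →ₗ[ℂ] Op U
  | [] => LinearMap.id
  | μ :: w => adWord U w ∘ₗ ad U μ

/-- The commutator of `1 + |P|²` with `F`, ordered such that the generators stand on the right of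
the commutators of `F`. -/
theorem energyOp_mul (F : Op U) : energyOp U * F = F * energyOp U -
    ∑ μ, ((2 : ℂ) • (ad U μ F * partialU U μ) + ad U μ (ad U μ F)) := by
  have h : ∀ μ, (2 : ℂ) • (ad U μ F * partialU U μ) + ad U μ (ad U μ F) =
      partialU U μ * partialU U μ * F - F * (partialU U μ * partialU U μ) := by
    intro μ
    simp only [ad_def, two_smul, mul_sub, sub_mul, mul_assoc]
    abel
  simp only [h, Finset.sum_sub_distrib, energyOp, sub_mul, mul_sub, one_mul, mul_one,
    Finset.sum_mul, Finset.mul_sum]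
  abel

theorem energyOp_apply_op (F : Op U) (ψ : smoothVectors U) : energyOp U (F ψ) =
    F (energyOp U ψ) - ∑ μ, ((2 : ℂ) • ad U μ F (partialU U μ ψ) + ad U μ (ad U μ F) ψ) := by
  have h := DFunLike.congr_fun (energyOp_mul F) ψ
  have e : (∑ μ, ((2 : ℂ) • (ad U μ F * partialU U μ) + ad U μ (ad U μ F))) ψ =
      ∑ μ, ((2 : ℂ) • ad U μ F (partialU U μ ψ) + ad U μ (ad U μ F) ψ) := by
    rw [LinearMap.sum_apply]
    rfl
  rw [← e]
  exact h

theorem coe_alpha_trans (x : Mink n) (F : Op U) (ψ : smoothVectors U) :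
    alpha U (trans x) F ψ = smoothAct U (trans x) (F (smoothAct U (trans (-x)) ψ)) := by
  have : (smoothAct U (trans x)).symm ψ = smoothAct U (trans (-x)) ψ := by
    ext
    rw [coe_smoothAct_symm, coe_smoothAct, trans_inv]
  rw [← this]
  rfl

/-- The condition which defines `smoothOps`, for a fixed power of `1 + |P|²`. -/
def IsSmoothForm (m : ℕ) (F : Op U) : Prop :=
  ∃ B : Mink n → H →L[ℂ] H, ContDiff ℝ ∞ B ∧ ∀ (x : Mink n) (φ ψ : smoothVectors U),
    ⟪(((energyOp U ^ m) φ : smoothVectors U) : H),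
      B x (((energyOp U ^ m) ψ : smoothVectors U) : H)⟫_ℂ
    = ⟪(φ : H), ((alpha U (trans x) F ψ : smoothVectors U) : H)⟫_ℂ

theorem mem_smoothOps_iff {F : Op U} : F ∈ smoothOps U ↔ ∃ m, IsSmoothForm m F := Iff.rfl

theorem inner_alpha_trans (x : Mink n) (F : Op U) (φ ψ : smoothVectors U) :
    ⟪(φ : H), (alpha U (trans x) F ψ : H)⟫_ℂ =
      ⟪(smoothAct U (trans (-x)) φ : H), (F (smoothAct U (trans (-x)) ψ) : H)⟫_ℂ := by
  rw [coe_alpha_trans, coe_smoothAct, inner_map_trans]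
  rfl

theorem hasFDerivAt_orbit_neg (φ : smoothVectors U) (x : Mink n) :
    HasFDerivAt (fun x : Mink n => orbit U (φ : H) (-x))
      (-∑ μ, (coord μ).smulRight (orbit U (partialU U μ φ : H) (-x))) x := by
  have := (hasFDerivAt_orbit φ (-x)).comp x (hasFDerivAt_id x).neg
  refine this.congr_fderiv ?_
  ext y; simp

/-- The derivative of the bounded form of `α_x(F)` in the direction `μ` is the bounded form of the
commutator. -/
theorem IsSmoothForm.comm {m : ℕ} {F : Op U} (h : IsSmoothForm m F) (μ : Fin (n + 2)) :
    IsSmoothForm m (ad U μ F) := by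
  obtain ⟨B, hB, hF⟩ := h
  refine ⟨fun x => fderiv ℝ B x (EuclideanSpace.single μ 1),
    (hB.fderiv_right (m := ∞) (by simp)).clm_apply contDiff_const, fun x φ ψ => ?_⟩
  set φ' := (energyOp U ^ m) φ with hφ'
  set ψ' := (energyOp U ^ m) ψ with hψ'
  have hF0 : ∀ φ ψ : smoothVectors U, ⟪((energyOp U ^ m) φ : H), B 0 ((energyOp U ^ m) ψ : H)⟫_ℂ =
      ⟪(φ : H), (F ψ : H)⟫_ℂ := by
    intro φ ψ
    rw [hF, inner_alpha_trans]
    simp [smoothAct, trans_zero]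
  -- only `B 0` is needed, since the translations may be applied to the vectors
  have hfun : (fun x => ⟪(φ' : H), B x (ψ' : H)⟫_ℂ) =
      fun x => ⟪orbit U (φ' : H) (-x), B 0 (orbit U (ψ' : H) (-x))⟫_ℂ := by
    funext x
    rw [hφ', hψ', hF, inner_alpha_trans, ← hF0, energyOp_pow_smoothAct, energyOp_pow_smoothAct]
    rfl
  let E : (H →L[ℂ] H) →L[ℝ] ℂ :=
    ((innerSL ℂ (φ' : H)).restrictScalars ℝ).comp
      ((ContinuousLinearMap.apply ℂ H (ψ' : H)).restrictScalars ℝ)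
  have h2 : HasFDerivAt (fun x => ⟪(φ' : H), B x (ψ' : H)⟫_ℂ) (E.comp (fderiv ℝ B x)) x :=
    E.hasFDerivAt.comp x (hB.differentiable (by simp) x).hasFDerivAt
  let B0 : H →L[ℝ] H := (B 0).restrictScalars ℝ
  have h3 := (hasFDerivAt_orbit_neg φ' x).inner ℂ
    (B0.hasFDerivAt.comp x (hasFDerivAt_orbit_neg ψ' x))
  have h4 := DFunLike.congr_fun (h2.unique (h3.congr_of_eventuallyEq
    (Eventually.of_forall fun x => congrFun hfun x)))
    (EuclideanSpace.single μ (1 : ℝ) : Mink n)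
  have e1 : (E.comp (fderiv ℝ B x)) (EuclideanSpace.single μ (1 : ℝ)) =
    ⟪(φ' : H), (fderiv ℝ B x (EuclideanSpace.single μ 1)) (ψ' : H)⟫_ℂ := rfl
  rw [e1] at h4
  rw [h4]
  have e2 : ∀ χ : smoothVectors U, (-∑ ν, (coord ν).smulRight (orbit U (partialU U ν χ : H) (-x)))
      (EuclideanSpace.single μ (1 : ℝ) : Mink n) = -orbit U (partialU U μ χ : H) (-x) := by
    intro χ
    simp [coord_apply]
  have e3 : ∀ χ : smoothVectors U, orbit U (partialU U μ ((energyOp U ^ m) χ) : H) (-x) =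
      ((energyOp U ^ m) (partialU U μ (smoothAct U (trans (-x)) χ)) : H) := by
    intro χ
    rw [energyOp_pow_partialU, energyOp_pow_smoothAct, partialU_smoothAct]
    rfl
  have e4 : ∀ χ : smoothVectors U, orbit U ((energyOp U ^ m) χ : H) (-x) =
      ((energyOp U ^ m) (smoothAct U (trans (-x)) χ) : H) := by
    intro χ
    rw [energyOp_pow_smoothAct]
    rfl
  simp only [ContinuousLinearMap.comp_apply, ContinuousLinearMap.prod_apply, fderivInnerCLM_apply,
    e2, B0, ContinuousLinearMap.coe_restrictScalars', map_neg, inner_neg_left, inner_neg_right,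
    Function.comp_apply]
  rw [hφ', hψ', e3, e3, e4, e4, hF0, hF0, inner_partialU, inner_alpha_trans, ad_apply,
    Submodule.coe_sub, inner_sub_right]
  ring

/-- Bounds for the quadratic form of an operator and its iterated commutators. -/
def FormTame (k l : ℕ) (F : Op U) : Prop :=
  ∀ w, ∃ C : ℝ, ∀ φ ψ : smoothVectors U,
    ‖⟪(φ : H), (adWord U w F ψ : H)⟫_ℂ‖ ≤ C * (‖(energyOp U ^ k) φ‖ * ‖(energyOp U ^ l) ψ‖)

theorem FormTame.comm {k l : ℕ} {F : Op U} (h : FormTame k l F) (μ : Fin (n + 2)) :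
    FormTame k l (ad U μ F) := fun w => h (μ :: w)

theorem IsSmoothForm.formTame {m : ℕ} {F : Op U} (h : IsSmoothForm m F) : FormTame m m F := by
  intro w
  induction w generalizing F with
  | nil =>
    obtain ⟨B, hB, hF⟩ := h
    refine ⟨‖B 0‖, fun φ ψ => ?_⟩
    have := hF 0 φ ψ
    have e : alpha U (trans 0) F ψ = F ψ := by
      ext
      simp [alpha, smoothAct, trans_zero]
    rw [e] at this
    show ‖⟪(φ : H), (F ψ : H)⟫_ℂ‖ ≤ _
    rw [← this]
    refine (norm_inner_le_norm _ _).trans ?_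
    calc _ ≤ ‖(energyOp U ^ m) φ‖ * (‖B 0‖ * ‖(energyOp U ^ m) ψ‖) := by
          gcongr
          · exact le_rfl
          · exact (B 0).le_opNorm _
      _ = _ := by ring
  | cons μ w ih => exact ih (h.comm μ)

/-- Form bounds may be moved from the left vector to the right one: a factor `1 + |P|²` on the left
is commuted through `F`, and the commutators satisfy the same bounds. The vectors
`(1 + |P|²) φ` suffice since the powers of `1 + |P|²` have dense range. -/
theorem FormTame.shift [CompleteSpace H] (hD : Dense (smoothVectors U : Set H)) {k l : ℕ}
    {F : Op U} (h : FormTame (k + 1) l F) : FormTame k (l + 1) F := by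
  have main : ∀ F : Op U, FormTame (k + 1) l F → ∃ C : ℝ, ∀ φ ψ : smoothVectors U,
      ‖⟪(φ : H), (F ψ : H)⟫_ℂ‖ ≤ C * (‖(energyOp U ^ k) φ‖ * ‖(energyOp U ^ (l + 1)) ψ‖) := by
    intro F h
    obtain ⟨C₀, h₀⟩ := h []
    choose C₁ h₁ using fun μ => h [μ]
    choose C₂ h₂ using fun μ => h [μ, μ]
    -- the bound for left vectors in the range of `1 + |P|²`
    have key : ∀ φ ψ : smoothVectors U, ‖⟪(energyOp U φ : H), (F ψ : H)⟫_ℂ‖ ≤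
        (|C₀| + ∑ μ, (2 * |C₁ μ| + |C₂ μ|)) *
          (‖(energyOp U ^ (k + 1)) φ‖ * ‖(energyOp U ^ (l + 1)) ψ‖) := by
      intro φ ψ
      set X := ‖(energyOp U ^ (k + 1)) φ‖
      set Y := ‖(energyOp U ^ (l + 1)) ψ‖
      have b0 : ‖⟪(φ : H), (F (energyOp U ψ) : H)⟫_ℂ‖ ≤ |C₀| * (X * Y) := by
        refine (h₀ φ (energyOp U ψ)).trans ?_
        rw [← energyOp_pow_succ_apply']
        gcongr
        exact le_abs_self _
      have b1 : ∀ μ, ‖⟪(φ : H), (ad U μ F (partialU U μ ψ) : H)⟫_ℂ‖ ≤ |C₁ μ| * (X * Y) := by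
        intro μ
        refine (h₁ μ φ (partialU U μ ψ)).trans ?_
        gcongr
        · exact le_abs_self _
        · exact norm_energyOp_pow_partialU_le _ _ _
      have b2 : ∀ μ, ‖⟪(φ : H), (ad U μ (ad U μ F) ψ : H)⟫_ℂ‖ ≤ |C₂ μ| * (X * Y) := by
        intro μ
        refine (h₂ μ φ ψ).trans ?_
        gcongr
        · exact le_abs_self _
        · exact norm_energyOp_pow_mono (Nat.le_succ l) ψ
      rw [inner_energyOp, energyOp_apply_op]
      simp only [Submodule.coe_sub, Submodule.coe_sum, Submodule.coe_add, Submodule.coe_smul,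
        inner_sub_right, inner_sum, inner_add_right, inner_smul_right]
      refine (norm_sub_le _ _).trans ?_
      rw [add_mul, Finset.sum_mul]
      refine add_le_add b0 ((norm_sum_le _ _).trans (Finset.sum_le_sum fun μ _ => ?_))
      refine (norm_add_le _ _).trans ?_
      rw [norm_mul, add_mul, mul_assoc]
      refine add_le_add ?_ (b2 μ)
      have : ‖(2 : ℂ)‖ = 2 := by simp
      rw [this]
      exact mul_le_mul_of_nonneg_left (b1 μ) zero_le_two
    refine ⟨|C₀| + ∑ μ, (2 * |C₁ μ| + |C₂ μ|), fun φ ψ => ?_⟩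
    -- approximate `φ` by `energyOp U (f j)`
    obtain ⟨v, hv, hlim⟩ := mem_closure_iff_seq_limit.1
      (dense_range_energyOp_pow hD (k + 1) ((energyOp U ^ k) φ : H))
    choose f hf using hv
    have hlim1 : Tendsto (fun j => ((energyOp U ^ (k + 1)) (f j) : H)) atTop
        (𝓝 ((energyOp U ^ k) φ : H)) := hlim.congr fun j => (hf j).symm
    have hlim2 : Tendsto (fun j => (energyOp U (f j) : H)) atTop (𝓝 (φ : H)) := by
      rw [tendsto_iff_norm_sub_tendsto_zero] at hlim1 ⊢
      refine squeeze_zero (fun _ => norm_nonneg _) (fun j => ?_) hlim1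
      have h1 := norm_energyOp_pow_mono (Nat.zero_le k) (energyOp U (f j) - φ)
      rw [map_sub, map_sub, ← energyOp_pow_succ_apply'] at h1
      exact h1
    refine le_of_tendsto_of_tendsto ((hlim2.inner (tendsto_const_nhds (x := (F ψ : H)))).norm)
      ((hlim1.norm.mul_const ‖(energyOp U ^ (l + 1)) ψ‖).const_mul _)
      (Eventually.of_forall fun j => key (f j) ψ)
  intro w
  induction w generalizing F with
  | nil => exact main F h
  | cons μ w ih => exact ih (h.comm μ)

/-- The operators which satisfy `‖[∂, [∂, ..., F]] ψ‖ ≤ C ‖(1 + |P|²)^l ψ‖` for all iterated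
commutators. -/
def tame (U : Poincare n →* (H ≃ₗᵢ[ℂ] H)) (l : ℕ) : Submodule ℂ (Op U) where
  carrier := {F | ∀ w, ∃ C : ℝ, ∀ ψ : smoothVectors U,
    ‖adWord U w F ψ‖ ≤ C * ‖(energyOp U ^ l) ψ‖}
  add_mem' := by
    intro F G hF hG w
    obtain ⟨C, hC⟩ := hF w
    obtain ⟨C', hC'⟩ := hG w
    refine ⟨C + C', fun ψ => ?_⟩
    rw [map_add, LinearMap.add_apply, add_mul]
    exact (norm_add_le _ _).trans (add_le_add (hC ψ) (hC' ψ))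
  zero_mem' := fun w => ⟨0, fun ψ => by simp⟩
  smul_mem' := by
    intro c F hF w
    obtain ⟨C, hC⟩ := hF w
    refine ⟨‖c‖ * C, fun ψ => ?_⟩
    rw [map_smul, LinearMap.smul_apply, norm_smul, mul_assoc]
    exact mul_le_mul_of_nonneg_left (hC ψ) (norm_nonneg c)

theorem ad_mem_tame {l : ℕ} {F : Op U} (h : F ∈ tame U l) (μ : Fin (n + 2)) :
    ad U μ F ∈ tame U l := fun w => h (μ :: w)

theorem exists_bound_of_mem_tame {l : ℕ} {F : Op U} (h : F ∈ tame U l) :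
    ∃ C : ℝ, ∀ ψ : smoothVectors U, ‖F ψ‖ ≤ C * ‖(energyOp U ^ l) ψ‖ := h []

/-- A set of operators with bounds which is closed under commutators consists of tame ones. -/
theorem mem_tame_of_closed {l : ℕ} {S : Set (Op U)} (hS : ∀ F ∈ S, ∀ μ, ad U μ F ∈ S)
    (hb : ∀ F ∈ S, ∃ C : ℝ, ∀ ψ : smoothVectors U, ‖F ψ‖ ≤ C * ‖(energyOp U ^ l) ψ‖) {F : Op U}
    (hF : F ∈ S) : F ∈ tame U l := by
  intro w
  induction w generalizing F with
  | nil => exact hb F hF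
  | cons μ w ih => exact ih (hS F hF μ)

theorem tame_mono {k l : ℕ} (hkl : k ≤ l) : tame U k ≤ tame U l := by
  intro F hF w
  obtain ⟨C, hC⟩ := hF w
  refine ⟨|C|, fun ψ => (hC ψ).trans ?_⟩
  exact mul_le_mul (le_abs_self C) (norm_energyOp_pow_mono hkl ψ) (norm_nonneg _) (abs_nonneg C)

/-- A form bound without energy factor on the left vector is an operator bound. -/
theorem FormTame.mem_tame {l : ℕ} {F : Op U} (h : FormTame 0 l F) : F ∈ tame U l := by
  intro w
  obtain ⟨C, hC⟩ := h w
  refine ⟨|C|, fun ψ => ?_⟩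
  -- the left vector is chosen to be the image of `ψ`
  have h1 := hC (adWord U w F ψ) ψ
  rw [inner_self_eq_norm_sq_to_K, norm_pow] at h1
  simp only [RCLike.norm_ofReal, abs_norm] at h1
  have h2 : ‖adWord U w F ψ‖ * ‖adWord U w F ψ‖ ≤
      (|C| * ‖(energyOp U ^ l) ψ‖) * ‖adWord U w F ψ‖ := by
    calc ‖adWord U w F ψ‖ * ‖adWord U w F ψ‖ = ‖(adWord U w F ψ : H)‖ ^ 2 := (sq _).symm
      _ ≤ C * (‖adWord U w F ψ‖ * ‖(energyOp U ^ l) ψ‖) := h1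
      _ ≤ |C| * (‖adWord U w F ψ‖ * ‖(energyOp U ^ l) ψ‖) := by gcongr; exact le_abs_self C
      _ = _ := by ring
  rcases (norm_nonneg (adWord U w F ψ)).eq_or_lt with h0 | h0
  · rw [← h0]; positivity
  · exact le_of_mul_le_mul_right h2 h0

/-- Smooth operators are tame: all form bounds are moved to the right vector. -/
theorem exists_mem_tame_of_mem_smoothOps [CompleteSpace H]
    (hD : Dense (smoothVectors U : Set H)) {F : Op U} (h : F ∈ smoothOps U) :
    ∃ l, F ∈ tame U l := by
  obtain ⟨m, hm⟩ := mem_smoothOps_iff.1 h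
  have key : ∀ k l, FormTame k l F → FormTame 0 (l + k) F := by
    intro k
    induction k with
    | zero => exact fun l h => h
    | succ k ih =>
      intro l h
      have := ih (l + 1) (h.shift hD)
      rwa [add_assoc, add_comm 1 k] at this
  exact ⟨m + m, (key m m hm.formTame).mem_tame⟩

/-- The operators `F` which map the domain of `(1 + |P|²)^(l + k)` to the one of
`(1 + |P|²)^k`, with bounds. -/
def OpBound (l : ℕ) (F : Op U) : Prop :=
  ∀ k, ∃ C : ℝ, ∀ ψ : smoothVectors U, ‖(energyOp U ^ k) (F ψ)‖ ≤ C * ‖(energyOp U ^ (l + k)) ψ‖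

/-- Bounds for the commutators yield bounds in all Sobolev norms, by induction on the power of
`1 + |P|²` which is commuted through `F`. -/
theorem opBound_of_mem_tame {l : ℕ} {F : Op U} (h : F ∈ tame U l) : OpBound l F := by
  intro k
  induction k generalizing F with
  | zero => exact exists_bound_of_mem_tame h
  | succ k ih =>
    obtain ⟨C₀, h₀⟩ := ih h
    choose C₁ h₁ using fun μ => ih (ad_mem_tame h μ)
    choose C₂ h₂ using fun μ => ih (ad_mem_tame (ad_mem_tame h μ) μ)
    refine ⟨|C₀| + ∑ μ, (2 * |C₁ μ| + |C₂ μ|), fun ψ => ?_⟩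
    set Y := ‖(energyOp U ^ (l + (k + 1))) ψ‖
    have b0 : ‖(energyOp U ^ k) (F (energyOp U ψ))‖ ≤ |C₀| * Y := by
      refine (h₀ (energyOp U ψ)).trans ?_
      rw [← energyOp_pow_succ_apply']
      gcongr
      · exact le_abs_self _
      · exact le_rfl
    have b1 : ∀ μ, ‖(energyOp U ^ k) (ad U μ F (partialU U μ ψ))‖ ≤ |C₁ μ| * Y := by
      intro μ
      refine (h₁ μ (partialU U μ ψ)).trans ?_
      gcongr
      · exact le_abs_self _
      · exact norm_energyOp_pow_partialU_le _ _ _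
    have b2 : ∀ μ, ‖(energyOp U ^ k) (ad U μ (ad U μ F) ψ)‖ ≤ |C₂ μ| * Y := by
      intro μ
      refine (h₂ μ ψ).trans ?_
      gcongr
      · exact le_abs_self _
      · exact norm_energyOp_pow_mono (Nat.le_succ _) ψ
    rw [energyOp_pow_succ_apply', energyOp_apply_op, map_sub, map_sum]
    refine (norm_sub_le _ _).trans ?_
    rw [add_mul, Finset.sum_mul]
    refine add_le_add b0 ((norm_sum_le _ _).trans (Finset.sum_le_sum fun μ _ => ?_))
    rw [map_add, map_smul]
    refine (norm_add_le _ _).trans ?_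
    rw [norm_smul, add_mul, mul_assoc]
    refine add_le_add ?_ (b2 μ)
    have : ‖(2 : ℂ)‖ = 2 := by simp
    rw [this]
    exact mul_le_mul_of_nonneg_left (b1 μ) zero_le_two

theorem OpBound.mul {l l' : ℕ} {F G : Op U} (hF : OpBound l F) (hG : OpBound l' G) :
    OpBound (l + l') (F * G) := by
  intro k
  obtain ⟨C, hC⟩ := hF k
  obtain ⟨C', hC'⟩ := hG (l + k)
  refine ⟨|C| * C', fun ψ => (hC (G ψ)).trans ?_⟩
  rw [mul_assoc, show l + l' + k = l' + (l + k) by omega]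
  have h1 := hC' ψ
  calc C * ‖(energyOp U ^ (l + k)) (G ψ)‖ ≤ |C| * ‖(energyOp U ^ (l + k)) (G ψ)‖ := by
        gcongr; exact le_abs_self C
    _ ≤ _ := by gcongr

theorem opBound_partialU (μ : Fin (n + 2)) : OpBound 1 (partialU U μ) := fun k =>
  ⟨1, fun ψ => by rw [one_mul, add_comm]; exact norm_energyOp_pow_partialU_le k μ ψ⟩

theorem one_mem_tame : (1 : Op U) ∈ tame U 0 := by
  refine mem_tame_of_closed (S := {F | F = 0 ∨ F = 1}) ?_ ?_ (Or.inr rfl)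
  · rintro F (rfl | rfl) μ
    · exact Or.inl (map_zero _)
    · left; rw [ad_def, mul_one, one_mul, sub_self]
  · rintro F (rfl | rfl)
    · exact ⟨0, fun ψ => by simp⟩
    · exact ⟨1, fun ψ => by simp⟩

theorem mul_mem_tame {l l' : ℕ} {F G : Op U} (hF : F ∈ tame U l) (hG : G ∈ tame U l') :
    F * G ∈ tame U (l + l') := by
  let P : Set (Op U) := {A | ∃ F ∈ tame U l, ∃ G ∈ tame U l', A = F * G}
  have hFG : F * G ∈ P := ⟨F, hF, G, hG, rfl⟩
  -- by the Leibniz rule the span of the products is closed under commutators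
  refine mem_tame_of_closed (S := Submodule.span ℂ P) ?_ ?_ (Submodule.subset_span hFG)
  · intro A hA μ
    induction hA using Submodule.span_induction with
    | mem A hA =>
      obtain ⟨F, hF, G, hG, rfl⟩ := hA
      rw [ad_mul]
      exact Submodule.add_mem _ (Submodule.subset_span ⟨_, ad_mem_tame hF μ, _, hG, rfl⟩)
        (Submodule.subset_span ⟨_, hF, _, ad_mem_tame hG μ, rfl⟩)
    | zero => rw [map_zero]; exact Submodule.zero_mem _
    | add A B _ _ hA hB => rw [map_add]; exact Submodule.add_mem _ hA hB
    | smul c A _ hA => rw [map_smul]; exact Submodule.smul_mem _ _ hA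
  · intro A hA
    induction hA using Submodule.span_induction with
    | mem A hA =>
      obtain ⟨F, hF, G, hG, rfl⟩ := hA
      exact ((opBound_of_mem_tame hF).mul (opBound_of_mem_tame hG)) 0
    | zero => exact ⟨0, fun ψ => by simp⟩
    | add A B _ _ hA hB =>
      obtain ⟨C, hC⟩ := hA
      obtain ⟨C', hC'⟩ := hB
      refine ⟨C + C', fun ψ => ?_⟩
      rw [add_mul]
      exact (norm_add_le _ _).trans (add_le_add (hC ψ) (hC' ψ))
    | smul c A _ hA =>
      obtain ⟨C, hC⟩ := hA
      refine ⟨‖c‖ * C, fun ψ => ?_⟩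
      rw [LinearMap.smul_apply, norm_smul, mul_assoc]
      exact mul_le_mul_of_nonneg_left (hC ψ) (norm_nonneg c)

end SmoothOperators

section TranslatedOperators

open Filter Topology MeasureTheory Poincare

variable {n : ℕ} {H : Type*} [NormedAddCommGroup H] [InnerProductSpace ℂ H]
  {U : Poincare n →* (H ≃ₗᵢ[ℂ] H)}

/-- The function `(u, v) ↦ U(u) F U(v) ψ`. -/
noncomputable def sandwich (F : Op U) (ψ : smoothVectors U) (z : Mink n × Mink n) : H :=
  U (trans z.1) (F (smoothAct U (trans z.2) ψ))

/-- An operator `F` with an energy bound is of the form `A (1 + |P|²)^l` with a bounded operator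
`A`. -/
theorem exists_extension [CompleteSpace H] (hD : Dense (smoothVectors U : Set H)) {l : ℕ} {F : Op U}
    (hF : ∃ C : ℝ, ∀ ψ : smoothVectors U, ‖F ψ‖ ≤ C * ‖(energyOp U ^ l) ψ‖) :
    ∃ A : H →L[ℂ] H, ∀ ψ : smoothVectors U, A ((energyOp U ^ l) ψ : H) = F ψ := by
  let f : smoothVectors U →ₗ[ℂ] H := (smoothVectors U).subtype ∘ₗ F
  let e : smoothVectors U →ₗ[ℂ] H := (smoothVectors U).subtype ∘ₗ (energyOp U ^ l : Op U)
  have hd : DenseRange e := dense_range_energyOp_pow hD l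
  exact ⟨f.extendOfNorm e, fun ψ => LinearMap.extendOfNorm_eq (f := f) (e := e) hd hF ψ⟩

theorem norm_sandwich (F : Op U) (ψ : smoothVectors U) (z : Mink n × Mink n) :
    ‖sandwich F ψ z‖ = ‖F (smoothAct U (trans z.2) ψ)‖ := norm_map _ _

variable [CompleteSpace H]

/-- The matrix elements of `U(u) F U(v) ψ` are differentiable, since `F` is the product of a bounded
operator and a power of `1 + |P|²`, which may be applied to `ψ`. -/
theorem hasFDerivAt_inner_sandwich (hD : Dense (smoothVectors U : Set H)) {l : ℕ} {F : Op U}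
    (hF : OpBound l F) (φ ψ : smoothVectors U) (z : Mink n × Mink n) :
    HasFDerivAt (fun z => ⟪(φ : H), sandwich F ψ z⟫_ℂ)
      (∑ μ, ((coord μ).comp (ContinuousLinearMap.fst ℝ (Mink n) (Mink n))).smulRight
          ⟪(φ : H), sandwich (partialU U μ * F) ψ z⟫_ℂ +
        ∑ μ, ((coord μ).comp (ContinuousLinearMap.snd ℝ (Mink n) (Mink n))).smulRight
          ⟪(φ : H), sandwich (F * partialU U μ) ψ z⟫_ℂ) z := by
  obtain ⟨A, hA⟩ := exists_extension hD (hF 0)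
  let A' : H →L[ℝ] H := A.restrictScalars ℝ
  have h1 : HasFDerivAt (fun z : Mink n × Mink n => orbit U (φ : H) (-z.1))
      ((-∑ μ, (coord μ).smulRight (orbit U (partialU U μ φ : H) (-z.1))).comp
        (ContinuousLinearMap.fst ℝ (Mink n) (Mink n))) z :=
    (hasFDerivAt_orbit_neg φ z.1).comp z (ContinuousLinearMap.fst ℝ (Mink n) (Mink n)).hasFDerivAt
  have h2 : HasFDerivAt (fun z : Mink n × Mink n =>
      A' (orbit U ((energyOp U ^ l) ψ : H) z.2))
      (A'.comp ((∑ μ, (coord μ).smulRight (orbit U (partialU U μ ((energyOp U ^ l) ψ) : H) z.2)).comp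
        (ContinuousLinearMap.snd ℝ (Mink n) (Mink n)))) z :=
    A'.hasFDerivAt.comp z ((hasFDerivAt_orbit _ z.2).comp z
      (ContinuousLinearMap.snd ℝ (Mink n) (Mink n)).hasFDerivAt)
  have e1 : ∀ (ψ : smoothVectors U) (y : Mink n), A' (orbit U ((energyOp U ^ l) ψ : H) y) =
      (F (smoothAct U (trans y) ψ) : H) := by
    intro ψ y
    have : orbit U ((energyOp U ^ l) ψ : H) y = ((energyOp U ^ l) (smoothAct U (trans y) ψ) : H) := by
      rw [energyOp_pow_smoothAct]; rfl
    rw [this]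
    exact hA _
  have h3 := h1.inner ℂ h2
  have e2 : (fun z : Mink n × Mink n => ⟪orbit U (φ : H) (-z.1),
      A' (orbit U ((energyOp U ^ l) ψ : H) z.2)⟫_ℂ) = fun z => ⟪(φ : H), sandwich F ψ z⟫_ℂ := by
    funext z
    rw [e1, sandwich, inner_map_trans]
    rfl
  rw [e2] at h3
  refine h3.congr_fderiv ?_
  refine ContinuousLinearMap.ext fun y => ?_
  have e3 : ∀ μ, A' (orbit U (partialU U μ ((energyOp U ^ l) ψ) : H) z.2) =
      ((F * partialU U μ) (smoothAct U (trans z.2) ψ) : H) := by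
    intro μ
    rw [← energyOp_pow_partialU, e1, ← partialU_smoothAct]
    rfl
  have e4 : ∀ μ, ⟪orbit U (partialU U μ φ : H) (-z.1), (F (smoothAct U (trans z.2) ψ) : H)⟫_ℂ =
      -⟪orbit U (φ : H) (-z.1), (partialU U μ (F (smoothAct U (trans z.2) ψ)) : H)⟫_ℂ := by
    intro μ
    have := inner_partialU μ (smoothAct U (trans (-z.1)) φ) (F (smoothAct U (trans z.2) ψ))
    rw [partialU_smoothAct] at this
    exact this
  simp only [ContinuousLinearMap.comp_apply, ContinuousLinearMap.prod_apply, fderivInnerCLM_apply,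
    neg_apply, sum_apply, add_apply, ContinuousLinearMap.smulRight_apply, map_sum,
    inner_neg_left, sum_inner, inner_sum, e1, ContinuousLinearMap.coe_fst',
    ContinuousLinearMap.coe_snd', map_smul, e3]
  rw [add_comm, ← Finset.sum_neg_distrib]
  congr 1
  · refine Finset.sum_congr rfl fun μ _ => ?_
    rw [← Complex.coe_smul, inner_smul_left, Complex.conj_ofReal, e4, Complex.real_smul, sandwich,
      inner_map_trans]
    simp only [mul_neg, neg_neg]
    rfl
  · refine Finset.sum_congr rfl fun μ _ => ?_
    rw [← Complex.coe_smul, inner_smul_right, Complex.real_smul, sandwich, inner_map_trans]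
    rfl

/-- The indices of the functions `sandwich F ψ`. -/
abbrev SandwichIndex (U : Poincare n →* (H ≃ₗᵢ[ℂ] H)) : Type _ :=
  {F : Op U // ∃ l, OpBound l F} × smoothVectors U

/-- The partial derivatives of the functions `sandwich F ψ`. -/
noncomputable def sandwichShift :
    Fin (n + 2) ⊕ Fin (n + 2) → SandwichIndex U → SandwichIndex U
  | Sum.inl μ, i => (⟨partialU U μ * i.1.1, i.1.2.imp' (fun l => 1 + l)
      fun _ h => (opBound_partialU μ).mul h⟩, i.2)
  | Sum.inr μ, i => (i.1, partialU U μ i.2)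

/-- The coordinates of the space of the pairs `(u, v)`. -/
noncomputable def pairCoord : Fin (n + 2) ⊕ Fin (n + 2) → Mink n × Mink n →L[ℝ] ℝ
  | Sum.inl μ => (coord μ).comp (ContinuousLinearMap.fst ℝ (Mink n) (Mink n))
  | Sum.inr μ => (coord μ).comp (ContinuousLinearMap.snd ℝ (Mink n) (Mink n))

theorem norm_pairCoord_le (k : Fin (n + 2) ⊕ Fin (n + 2)) :
    ‖(pairCoord k : Mink n × Mink n →L[ℝ] ℝ)‖ ≤ 1 := by
  refine ContinuousLinearMap.opNorm_le_bound _ zero_le_one fun z => ?_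
  rw [one_mul]
  rcases k with μ | μ
  · exact (PiLp.norm_apply_le z.1 μ).trans (norm_fst_le z)
  · exact (PiLp.norm_apply_le z.2 μ).trans (norm_snd_le z)

theorem exists_norm_sandwich_le {l : ℕ} {F : Op U} (hF : OpBound l F) :
    ∃ C : ℝ, ∀ (ψ : smoothVectors U) z, ‖sandwich F ψ z‖ ≤ C * ‖(energyOp U ^ l) ψ‖ := by
  obtain ⟨C, hC⟩ := hF 0
  refine ⟨C, fun ψ z => ?_⟩
  rw [norm_sandwich]
  have := hC (smoothAct U (trans z.2) ψ)
  rwa [norm_energyOp_pow_smoothAct] at this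

theorem sandwich_mul_partialU (F : Op U) (μ : Fin (n + 2)) (ψ : smoothVectors U)
    (z : Mink n × Mink n) : sandwich (F * partialU U μ) ψ z = sandwich F (partialU U μ ψ) z := by
  simp only [sandwich]
  rw [← partialU_smoothAct]
  rfl

theorem hasFDerivAt_sandwich_aux (hD : Dense (smoothVectors U : Set H)) (i : SandwichIndex U)
    (z : Mink n × Mink n) : HasFDerivAt (sandwich i.1.1 i.2)
      (∑ k, (pairCoord k).smulRight
        (sandwich (sandwichShift k i).1.1 (sandwichShift k i).2 z)) z := by
  refine hasFDerivAt_of_weak (isNorming_inner hD)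
    (a := fun (i : SandwichIndex U) z => sandwich i.1.1 i.2 z) (s := sandwichShift)
    (ℓ := pairCoord) (fun i => ?_) ?_ i z
  · obtain ⟨l, hl⟩ := i.1.2
    obtain ⟨C, hC⟩ := exists_norm_sandwich_le hl
    exact ⟨_, hC i.2⟩
  · rintro i _ ⟨φ, hφ, -, rfl⟩ z
    obtain ⟨l, hl⟩ := i.1.2
    refine (hasFDerivAt_inner_sandwich hD hl ⟨φ, hφ⟩ i.2 z).congr_fderiv ?_
    rw [Fintype.sum_sum_type]
    congr 1
    refine Finset.sum_congr rfl fun μ _ => ?_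
    rw [sandwich_mul_partialU]
    rfl

theorem hasFDerivAt_sandwich (hD : Dense (smoothVectors U : Set H)) {l : ℕ} {F : Op U}
    (hF : OpBound l F) (ψ : smoothVectors U) (z : Mink n × Mink n) :
    HasFDerivAt (sandwich F ψ) (∑ μ, ((coord μ).comp
          (ContinuousLinearMap.fst ℝ (Mink n) (Mink n))).smulRight
          (sandwich (partialU U μ * F) ψ z) +
        ∑ μ, ((coord μ).comp (ContinuousLinearMap.snd ℝ (Mink n) (Mink n))).smulRight
          (sandwich (F * partialU U μ) ψ z)) z := by
  refine (hasFDerivAt_sandwich_aux hD (⟨F, l, hF⟩, ψ) z).congr_fderiv ?_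
  rw [Fintype.sum_sum_type]
  congr 1
  refine Finset.sum_congr rfl fun μ _ => ?_
  rw [sandwich_mul_partialU]
  rfl

theorem contDiff_sandwich (hD : Dense (smoothVectors U : Set H)) {l : ℕ} {F : Op U}
    (hF : OpBound l F) (ψ : smoothVectors U) : ContDiff ℝ ∞ (sandwich F ψ) :=
  contDiff_family (hasFDerivAt_sandwich_aux hD) (⟨F, l, hF⟩, ψ)

theorem exists_norm_iteratedFDeriv_sandwich_le (hD : Dense (smoothVectors U : Set H)) (j : ℕ) :
    ∀ {l : ℕ} {F : Op U}, OpBound l F → ∃ C : ℝ, 0 ≤ C ∧ ∀ (ψ : smoothVectors U) z,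
      ‖iteratedFDeriv ℝ j (sandwich F ψ) z‖ ≤ C * ‖(energyOp U ^ (l + j)) ψ‖ := by
  induction j with
  | zero =>
    intro l F hF
    obtain ⟨C, hC⟩ := exists_norm_sandwich_le hF
    refine ⟨|C|, abs_nonneg _, fun ψ z => ?_⟩
    rw [norm_iteratedFDeriv_zero]
    refine (hC ψ z).trans ?_
    gcongr
    · exact le_abs_self _
    · exact le_rfl
  | succ j ih =>
    intro l F hF
    choose C₁ h₁0 h₁ using fun μ : Fin (n + 2) => ih ((opBound_partialU μ).mul hF)
    obtain ⟨C₂, h₂0, h₂⟩ := ih hF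
    refine ⟨∑ μ, C₁ μ + ∑ _μ : Fin (n + 2), C₂,
      add_nonneg (Finset.sum_nonneg fun μ _ => h₁0 μ) (Finset.sum_nonneg fun μ _ => h₂0),
      fun ψ z => ?_⟩
    refine (norm_iteratedFDeriv_succ_family_le (hasFDerivAt_sandwich_aux hD)
      (⟨F, l, hF⟩, ψ) j z).trans ?_
    rw [Fintype.sum_sum_type, add_mul, Finset.sum_mul, Finset.sum_mul]
    refine add_le_add (Finset.sum_le_sum fun μ _ => ?_) (Finset.sum_le_sum fun μ _ => ?_)
    · refine (mul_le_of_le_one_left (norm_nonneg _) (norm_pairCoord_le _)).trans ?_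
      refine (h₁ μ ψ z).trans (le_of_eq ?_)
      rw [show 1 + l + j = l + (j + 1) by omega]
    · refine (mul_le_of_le_one_left (norm_nonneg _) (norm_pairCoord_le _)).trans ?_
      refine (h₂ (partialU U μ ψ) z).trans ?_
      exact mul_le_mul_of_nonneg_left (norm_energyOp_pow_partialU_le _ _ _) h₂0

theorem exists_symBound_sandwich (hD : Dense (smoothVectors U : Set H)) (K : ℕ) {l : ℕ} {F : Op U}
    (hF : OpBound l F) : ∃ C : ℝ, 0 ≤ C ∧ ∀ ψ : smoothVectors U,
      SymBound K (C * ‖(energyOp U ^ (l + K)) ψ‖) (sandwich F ψ) := by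
  choose C h0 hC using fun j => exists_norm_iteratedFDeriv_sandwich_le hD j hF
  refine ⟨∑ j ∈ Finset.range (K + 1), C j, Finset.sum_nonneg fun j _ => h0 j,
    fun ψ j hj z => (hC j ψ z).trans ?_⟩
  have h1 := Finset.single_le_sum (f := C) (fun j _ => h0 j)
    (Finset.mem_range.2 (Nat.lt_succ_of_le hj))
  exact mul_le_mul h1 (norm_energyOp_pow_mono (by omega) ψ) (norm_nonneg _)
    (Finset.sum_nonneg fun j _ => h0 j)

/-- The functions `(u, v) ↦ U(u) F U(v) ψ` are symbols, so that the oscillatory integrals which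
define warped convolutions exist. -/
theorem isSymbol_sandwich (hD : Dense (smoothVectors U : Set H)) {l : ℕ} {F : Op U}
    (hF : OpBound l F) (ψ : smoothVectors U) : IsSymbol (sandwich F ψ) :=
  isSymbol_of_symBound (contDiff_sandwich hD hF ψ) fun K =>
    (exists_symBound_sandwich hD K hF).imp' _ fun _ h => h.2 ψ

/-- The partial derivatives of `x ↦ α_x(F) ψ` are given by the commutators of `F`. -/
theorem hasFDerivAt_alpha (hD : Dense (smoothVectors U : Set H)) {l : ℕ} {F : Op U}
    (hF : F ∈ tame U l) (ψ : smoothVectors U) (x : Mink n) :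
    HasFDerivAt (fun x => (alpha U (trans x) F ψ : H))
      (∑ μ, (coord μ).smulRight (alpha U (trans x) (ad U μ F) ψ : H)) x := by
  have h1 : HasFDerivAt (fun x : Mink n => (x, -x))
      ((ContinuousLinearMap.id ℝ (Mink n)).prod (-ContinuousLinearMap.id ℝ (Mink n))) x :=
    (hasFDerivAt_id x).prodMk (hasFDerivAt_id x).neg
  have h2 := (hasFDerivAt_sandwich hD (opBound_of_mem_tame hF) ψ (x, -x)).comp x h1
  have e : (sandwich F ψ ∘ fun x : Mink n => (x, -x)) = fun x => (alpha U (trans x) F ψ : H) := by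
    funext x
    rw [coe_alpha_trans]
    rfl
  rw [e] at h2
  refine h2.congr_fderiv ?_
  ext1 y
  simp only [ContinuousLinearMap.comp_apply, ContinuousLinearMap.prod_apply, add_apply, sum_apply,
    ContinuousLinearMap.smulRight_apply, ContinuousLinearMap.coe_fst',
    ContinuousLinearMap.coe_snd', ContinuousLinearMap.id_apply, neg_apply, map_neg, neg_smul]
  rw [← Finset.sum_add_distrib]
  refine Finset.sum_congr rfl fun μ _ => ?_
  rw [← sub_eq_add_neg, ← smul_sub, coe_alpha_trans, coe_smoothAct]
  congr 1
  simp only [sandwich]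
  rw [← map_sub]
  rfl

/-- Tame operators are smooth. -/
theorem mem_smoothOps_of_mem_tame (hD : Dense (smoothVectors U : Set H)) {l : ℕ} {F : Op U}
    (hF : F ∈ tame U l) : F ∈ smoothOps U := by
  choose A hA using fun F : tame U l => exists_extension hD (exists_bound_of_mem_tame F.2)
  let V : Mink n → H →L[ℂ] H := fun x => ((U (trans x)).toContinuousLinearEquiv : H →L[ℂ] H)
  let a : tame U l → Mink n → H →L[ℂ] H := fun F x => (V x).comp ((A F).comp (V (-x)))
  have ha : ∀ F x (ψ : smoothVectors U), a F x ((energyOp U ^ l) ψ : H) =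
      (alpha U (trans x) F.1 ψ : H) := by
    intro F x ψ
    have : V (-x) ((energyOp U ^ l) ψ : H) =
        ((energyOp U ^ l) (smoothAct U (trans (-x)) ψ) : H) := by
      rw [energyOp_pow_smoothAct]; rfl
    show V x (A F (V (-x) _)) = _
    rw [this, hA, coe_alpha_trans]
    rfl
  have hnorm : ∀ F x, ‖a F x‖ ≤ ‖A F‖ := by
    intro F x
    refine ContinuousLinearMap.opNorm_le_bound _ (norm_nonneg _) fun v => ?_
    calc ‖U (trans x) (A F (U (trans (-x)) v))‖ = ‖A F (U (trans (-x)) v)‖ := norm_map _ _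
      _ ≤ ‖A F‖ * ‖U (trans (-x)) v‖ := (A F).le_opNorm _
      _ = ‖A F‖ * ‖v‖ := by rw [norm_map]
  let N : Set ((H →L[ℂ] H) →L[ℝ] ℂ) := {L | ∃ φ ψ : smoothVectors U, ‖(φ : H)‖ ≤ 1 ∧
    ‖((energyOp U ^ l) ψ : H)‖ ≤ 1 ∧ L = ((innerSL ℂ (φ : H)).restrictScalars ℝ).comp
      ((ContinuousLinearMap.apply ℂ H ((energyOp U ^ l) ψ : H)).restrictScalars ℝ)}
  -- the matrix elements with right vectors in the range of `(1 + |P|²)^l` determine the norm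
  have hN : IsNorming N := by
    refine ⟨?_, fun T M hM h => ?_⟩
    · rintro L ⟨φ, ψ, hφ, hψ, rfl⟩
      refine ContinuousLinearMap.opNorm_le_bound _ zero_le_one fun T => ?_
      rw [one_mul]
      show ‖⟪(φ : H), T ((energyOp U ^ l) ψ : H)⟫_ℂ‖ ≤ ‖T‖
      refine (norm_inner_le_norm _ _).trans ?_
      calc ‖(φ : H)‖ * ‖T ((energyOp U ^ l) ψ : H)‖ ≤ 1 * (‖T‖ * 1) := by
            gcongr
            exact (T.le_opNorm _).trans (by gcongr)
        _ = ‖T‖ := by ring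
    · have h1 : ∀ ψ : smoothVectors U, ‖((energyOp U ^ l) ψ : H)‖ ≤ 1 →
          ‖T ((energyOp U ^ l) ψ : H)‖ ≤ M := by
        intro ψ hψ
        refine (isNorming_inner hD).le_of_forall _ _ hM ?_
        rintro _ ⟨φ, hφ, hφ1, rfl⟩
        exact h _ ⟨⟨φ, hφ⟩, ψ, hφ1, hψ, rfl⟩
      have h2 : ∀ ψ : smoothVectors U, ‖T ((energyOp U ^ l) ψ : H)‖ ≤
          M * ‖((energyOp U ^ l) ψ : H)‖ := by
        intro ψ
        set r := ‖((energyOp U ^ l) ψ : H)‖ with hr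
        rcases (norm_nonneg ((energyOp U ^ l) ψ : H)).eq_or_lt with h0 | h0
        · have : ((energyOp U ^ l) ψ : H) = 0 := norm_eq_zero.1 h0.symm
          rw [this, map_zero, norm_zero]
          positivity
        · have h3 := h1 (((r⁻¹ : ℝ) : ℂ) • ψ) (by
            rw [map_smul, Submodule.coe_smul, norm_smul, Complex.norm_real, norm_inv, hr,
              norm_norm, inv_mul_cancel₀ h0.ne'])
          rw [map_smul, Submodule.coe_smul, map_smul, norm_smul, Complex.norm_real, norm_inv, hr,
              norm_norm, inv_mul_le_iff₀ h0, mul_comm] at h3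
          exact h3
      refine ContinuousLinearMap.opNorm_le_bound _ hM fun v => ?_
      have hc : IsClosed {v : H | ‖T v‖ ≤ M * ‖v‖} := isClosed_le (by fun_prop) (by fun_prop)
      refine hc.closure_subset_iff.2 ?_ (dense_range_energyOp_pow hD l v)
      rintro _ ⟨ψ, rfl⟩
      exact h2 ψ
  have hder := hasFDerivAt_of_weak hN (a := a) (ℓ := coord)
    (s := fun μ F => ⟨ad U μ F.1, ad_mem_tame F.2 μ⟩) (fun F => ⟨_, hnorm F⟩) (by
      rintro F _ ⟨φ, ψ, -, -, rfl⟩ x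
      have h := ((innerSL ℂ (φ : H)).restrictScalars ℝ).hasFDerivAt.comp x
        (hasFDerivAt_alpha hD F.2 ψ x)
      refine (h.congr_of_eventuallyEq (Eventually.of_forall fun x => ?_)).congr_fderiv ?_
      · exact congrArg (fun v => ⟪(φ : H), v⟫_ℂ) (ha F x ψ)
      · ext1 y
        have e : ∀ μ, a ⟨ad U μ F.1, ad_mem_tame F.2 μ⟩ x ((energyOp U ^ l) ψ : H) =
          (alpha U (trans x) (ad U μ F.1) ψ : H) := fun μ => ha _ x ψ
        simp [e])
  have hs := contDiff_family hder ⟨F, hF⟩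
  -- `T` is the operator `(1 + |P|²)^(-l)`
  obtain ⟨T, hT⟩ := exists_extension hD (l := l) (F := (1 : Op U))
    ⟨1, fun ψ => by rw [one_mul]; exact norm_energyOp_pow_mono (Nat.zero_le l) ψ⟩
  refine ⟨l, fun x => (ContinuousLinearMap.adjoint T).comp (a ⟨F, hF⟩ x), ?_, fun x φ ψ => ?_⟩
  · exact (((ContinuousLinearMap.compL ℂ H H H (ContinuousLinearMap.adjoint T)).restrictScalars
      ℝ).contDiff).comp hs
  · rw [ContinuousLinearMap.comp_apply, ContinuousLinearMap.adjoint_inner_right, hT, ha]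
    rfl

end TranslatedOperators

/-! ### Invariance properties of oscillatory integrals -/

section OscillatoryInvariance

open MeasureTheory Filter Topology

variable {Z : Type*} [NormedAddCommGroup Z] [NormedSpace ℝ Z]
  {V : Type*} [NormedAddCommGroup V] [NormedSpace ℂ V]
  [FiniteDimensional ℝ Z] [MeasurableSpace Z] [BorelSpace Z] {μ : Measure Z} [μ.IsAddHaarMeasure]
  [CompleteSpace V]

/-- A linear map which preserves a nondegenerate quadratic form is injective, so it may be
substituted in oscillatory integrals. -/
theorem osc_comp_clm_of_invariant {q : Z → ℝ} (hq : IsPhase q)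
    (h1 : osc q μ (fun _ => (1 : ℂ)) ≠ 0) (T : Z →L[ℝ] Z) (hT : ∀ z, q (T z) = q z) {a : Z → V}
    (ha : IsSymbol a) : osc q μ (fun z => a (T z)) = osc q μ a := by
  have hinj : Function.Injective (T : Z →ₗ[ℝ] Z) := by
    obtain ⟨β, h, hnd⟩ := hq
    rw [← LinearMap.ker_eq_bot, LinearMap.ker_eq_bot']
    intro k hk
    have hk : T k = 0 := hk
    refine hnd k fun w => ?_
    have e1 : q (k + w) = q w := by rw [← hT, map_add, hk, zero_add, hT]
    have e2 : q k = 0 := by rw [← hT, hk, h]; simp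
    rw [h] at e1 e2
    rw [h] at e1
    simp only [map_add, add_apply] at e1
    linarith
  let e : Z ≃L[ℝ] Z := (LinearEquiv.ofInjectiveEndo (T : Z →ₗ[ℝ] Z) hinj).toContinuousLinearEquiv
  exact osc_comp_equiv_of_invariant hq h1 e hT ha

theorem osc_const {q : Z → ℝ} (hq : IsPhase q) (v : V) :
    osc q μ (fun _ => v) = osc q μ (fun _ => (1 : ℂ)) • v := by
  have := osc_clm (μ := μ) hq (ContinuousLinearMap.toSpanSingleton ℂ v) (isSymbol_const (1 : ℂ))
  simpa using this

theorem IsPhase.neg {q : Z → ℝ} (hq : IsPhase q) : IsPhase fun z => -q z := by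
  obtain ⟨β, h, hnd⟩ := hq
  refine ⟨-β, fun z => by simp [h], fun k hk => hnd k fun w => ?_⟩
  have := hk w
  simp only [neg_apply] at this
  linarith

/-- Complex conjugation reverses the sign of the phase. -/
theorem conj_osc {q : Z → ℝ} (hq : IsPhase q) {a : Z → ℂ} (ha : IsSymbol a) :
    (starRingEnd ℂ) (osc q μ a) = osc (fun z => -q z) μ (fun z => (starRingEnd ℂ) (a z)) := by
  have ha' : IsSymbol fun z => (starRingEnd ℂ) (a z) :=
    ha.clm_comp (Complex.conjCLE : ℂ →L[ℝ] ℂ)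
  refine tendsto_nhds_unique_of_eventuallyEq
    ((Complex.continuous_conj.tendsto _).comp (tendsto_oscReg_stdCutoff (μ := μ) hq ha))
    (tendsto_oscReg_stdCutoff (μ := μ) hq.neg ha') (Eventually.of_forall fun ε => ?_)
  simp only [oscReg, Function.comp_apply]
  rw [← integral_conj]
  refine integral_congr_ae (Eventually.of_forall fun z => ?_)
  have e2 : (starRingEnd ℂ) (stdCutoff Z (ε • z)) = stdCutoff Z (ε • z) := by simp [stdCutoff]
  have e3 : (starRingEnd ℂ) (oscFactor q z) = oscFactor (fun z => -q z) z := by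
    simp only [oscFactor, ← Complex.exp_conj]
    congr 1
    simp
  simp only [smul_eq_mul, map_mul, e2, e3]

end OscillatoryInvariance

section MinkOscillatory

open MeasureTheory Filter Topology Poincare

variable {n : ℕ} {V : Type*} [NormedAddCommGroup V] [NormedSpace ℂ V] [CompleteSpace V]

theorem osc_minkPhase_one_ne_zero :
    osc minkPhase volume (fun _ : Mink n × Mink n => (1 : ℂ)) ≠ 0 := by
  rw [osc_minkPhase_one]
  have : ((2 * Real.pi) ^ (n + 2) : ℝ) ≠ 0 := by positivity
  exact_mod_cast this

theorem osc_mink_comp (T : Mink n × Mink n →L[ℝ] Mink n × Mink n)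
    (hT : ∀ z, minkPhase (T z) = minkPhase z) {a : Mink n × Mink n → V} (ha : IsSymbol a) :
    osc minkPhase volume (fun z => a (T z)) = osc minkPhase volume a :=
  osc_comp_clm_of_invariant isPhase_minkPhase osc_minkPhase_one_ne_zero T hT ha

/-- The matrix `A` as a continuous linear map. -/
noncomputable def appL (A : Matrix (Fin (n + 2)) (Fin (n + 2)) ℝ) : Mink n →L[ℝ] Mink n :=
  (Matrix.toEuclideanLin A).toContinuousLinearMap

theorem appL_apply (A : Matrix (Fin (n + 2)) (Fin (n + 2)) ℝ) (x : Mink n) :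
    appL A x = app A x := rfl

theorem mdot_add_left (x y z : Mink n) : mdot (x + y) z = mdot x z + mdot y z := by
  simp [← mdotL_apply]

theorem mdot_add_right (x y z : Mink n) : mdot x (y + z) = mdot x y + mdot x z := by
  simp [← mdotL_apply]

theorem mdot_sub_left (x y z : Mink n) : mdot (x - y) z = mdot x z - mdot y z := by
  simp [← mdotL_apply]

theorem mdot_sub_right (x y z : Mink n) : mdot x (y - z) = mdot x y - mdot x z := by
  simp [← mdotL_apply]

theorem mdot_neg_left (x y : Mink n) : mdot (-x) y = -mdot x y := by
  simp [← mdotL_apply]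

theorem mdot_neg_right (x y : Mink n) : mdot x (-y) = -mdot x y := by
  simp [← mdotL_apply]

theorem mdot_smul_left (c : ℝ) (x y : Mink n) : mdot (c • x) y = c * mdot x y := by
  simp [← mdotL_apply]

theorem mdot_smul_right (c : ℝ) (x y : Mink n) : mdot x (c • y) = c * mdot x y := by
  simp [← mdotL_apply]

theorem IsSkew.mdot_app_self {Q : Matrix (Fin (n + 2)) (Fin (n + 2)) ℝ} (hQ : IsSkew Q)
    (p : Mink n) : mdot p (app Q p) = 0 := by
  have := hQ p p
  linarith

theorem IsSkew.mdot_app_left {Q : Matrix (Fin (n + 2)) (Fin (n + 2)) ℝ} (hQ : IsSkew Q)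
    (p q : Mink n) : mdot (app Q p) q = -mdot p (app Q q) := by
  rw [mdot_comm, hQ]

theorem IsSkew.neg {Q : Matrix (Fin (n + 2)) (Fin (n + 2)) ℝ} (hQ : IsSkew Q) : IsSkew (-Q) := by
  have e : ∀ x, app (-Q) x = -app Q x := fun x => by simp [app, Matrix.neg_mulVec]
  intro p q
  rw [e, e, mdot_neg_right, mdot_neg_right, hQ]

/-- Shifts of the space-time variable by `Q p` may be substituted. -/
theorem osc_shift {Q : Matrix (Fin (n + 2)) (Fin (n + 2)) ℝ} (hQ : IsSkew Q)
    {a : Mink n × Mink n → V} (ha : IsSymbol a) :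
    osc minkPhase volume (fun z => a (z.1 + app Q z.2, z.2)) = osc minkPhase volume a := by
  refine osc_mink_comp ((ContinuousLinearMap.fst ℝ (Mink n) (Mink n) +
    (appL Q).comp (ContinuousLinearMap.snd ℝ (Mink n) (Mink n))).prod
      (ContinuousLinearMap.snd ℝ (Mink n) (Mink n))) (fun z => ?_) ha
  simp [minkPhase, mdot_add_right, appL_apply, hQ.mdot_app_self]

/-- The reflection `x ↦ -x` turns the complex conjugate phase into the original one. -/
theorem conj_osc_mink {a : Mink n × Mink n → ℂ} (ha : IsSymbol a) :
    (starRingEnd ℂ) (osc minkPhase volume a) =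
      osc minkPhase volume (fun z => (starRingEnd ℂ) (a (-z.1, z.2))) := by
  let T : (Mink n × Mink n) ≃L[ℝ] (Mink n × Mink n) :=
    (ContinuousLinearEquiv.neg ℝ).prodCongr (ContinuousLinearEquiv.refl ℝ (Mink n))
  have hT : ∀ z, T z = (-z.1, z.2) := fun z => rfl
  have hq : (fun z : Mink n × Mink n => -minkPhase (T z)) = minkPhase := by
    funext z
    simp [minkPhase, hT, mdot_neg_right]
  have ha' : IsSymbol fun z => (starRingEnd ℂ) (a z) :=
    ha.clm_comp (Complex.conjCLE : ℂ →L[ℝ] ℂ)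
  have h1 := osc_comp_equiv (μ := volume) isPhase_minkPhase.neg T ha'
  have h2 := osc_comp_equiv (μ := volume) (isPhase_minkPhase (n := n)).neg T
    (isSymbol_const (1 : ℂ))
  have h3 := conj_osc (μ := volume) (isPhase_minkPhase (n := n)) (isSymbol_const (1 : ℂ))
  rw [hq] at h1 h2
  simp only [map_one] at h3
  rw [← h3, osc_minkPhase_one, Complex.conj_ofReal, ← osc_minkPhase_one] at h2
  have h4 : ((|LinearMap.det (T : (Mink n × Mink n) →ₗ[ℝ] _)|⁻¹ : ℝ) : ℂ) = 1 := by
    have : (((|LinearMap.det (T : (Mink n × Mink n) →ₗ[ℝ] _)|⁻¹ : ℝ) : ℂ) - 1) *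
        osc minkPhase volume (fun _ : Mink n × Mink n => (1 : ℂ)) = 0 := by
      rw [sub_mul, one_mul, sub_eq_zero]
      exact h2.symm
    exact sub_eq_zero.1 ((mul_eq_zero.1 this).resolve_right osc_minkPhase_one_ne_zero)
  rw [h4, one_smul, ← conj_osc isPhase_minkPhase ha] at h1
  exact h1.symm

/-- If the symbol depends on the first variable only, then the oscillatory integral is the value
at zero. This follows by scaling `x ↦ t x`, `p ↦ p / t` with `t → 0`. -/
theorem osc_fst {a : Mink n → V} (ha : IsSymbol a) :
    osc minkPhase volume (fun z : Mink n × Mink n => a z.1) =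
      (((2 * Real.pi) ^ (n + 2) : ℝ) : ℂ) • a 0 := by
  have hs : IsSymbol fun z : Mink n × Mink n => a z.1 :=
    ha.comp_clm (ContinuousLinearMap.fst ℝ (Mink n) (Mink n))
  obtain ⟨M, hM⟩ := ha.symBound (oscOrder (Mink n × Mink n))
  let L : ℝ → Mink n × Mink n →L[ℝ] Mink n := fun t => t • ContinuousLinearMap.fst ℝ _ _
  have hL : ∀ t : ℝ, 0 < t → t ≤ 1 → ‖L t‖ ≤ 1 := by
    intro t h0 h1
    refine ContinuousLinearMap.opNorm_le_bound _ zero_le_one fun z => ?_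
    simp only [L, smul_apply, ContinuousLinearMap.coe_fst', norm_smul,
      Real.norm_of_nonneg h0.le]
    exact mul_le_mul h1 (norm_fst_le z) (norm_nonneg _) zero_le_one
  have h1 : Tendsto (fun t : ℝ => osc minkPhase volume fun z : Mink n × Mink n => a (L t z))
      (𝓝[>] 0) (𝓝 (osc minkPhase volume fun _ : Mink n × Mink n => a 0)) := by
    refine tendsto_osc isPhase_minkPhase (M := M * 1 ^ oscOrder (Mink n × Mink n)) ?_
      (isSymbol_const _) fun z => ?_
    · filter_upwards [Ioc_mem_nhdsGT (zero_lt_one (α := ℝ))] with t ht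
      exact ⟨ha.comp_clm _, SymBound.comp_clm ha.1 hM (hL t ht.1 ht.2) le_rfl⟩
    · apply Tendsto.mono_left _ nhdsWithin_le_nhds
      have hc : Continuous fun t : ℝ => a (L t z) := by
        have := ha.continuous
        show Continuous fun t : ℝ => a (t • z.1)
        fun_prop
      have := hc.tendsto 0
      simpa [L] using this
  rw [osc_const isPhase_minkPhase, osc_minkPhase_one] at h1
  refine tendsto_nhds_unique_of_eventuallyEq tendsto_const_nhds h1 ?_
  filter_upwards [self_mem_nhdsWithin] with t ht
  have ht : 0 < t := ht
  refine (osc_mink_comp ((t • ContinuousLinearMap.fst ℝ (Mink n) (Mink n)).prod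
    (t⁻¹ • ContinuousLinearMap.snd ℝ (Mink n) (Mink n))) (fun z => ?_) hs).symm
  simp only [minkPhase, ContinuousLinearMap.prod_apply, smul_apply, ContinuousLinearMap.coe_fst',
    ContinuousLinearMap.coe_snd', mdot_smul_left, mdot_smul_right]
  field_simp

/-- The variables `x` and `Q p` may be exchanged if `Q²` is a nonzero multiple of the identity on
the range of `Q`. -/
theorem osc_exchange {Q : Matrix (Fin (n + 2)) (Fin (n + 2)) ℝ} (hQ : IsSkew Q) {c : ℝ}
    (hc : c ≠ 0) (hQ3 : Q * Q * Q = c • Q) {s : Mink n × Mink n → V} (hs : IsSymbol s) :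
    osc minkPhase volume (fun z => s (z.1, -app Q z.2)) =
      osc minkPhase volume (fun z => s (app Q z.2, z.1)) := by
  obtain ⟨q, hq⟩ : ∃ q : Mink n →L[ℝ] Mink n, q = appL Q := ⟨_, rfl⟩
  have hqa : ∀ x, app Q x = q x := fun x => by rw [hq]; rfl
  have hq3 : ∀ x, q (q (q x)) = c • q x := by
    intro x
    rw [← hqa, ← hqa, ← hqa, ← app_mul, ← app_mul, hQ3]
    simp [app, Matrix.smul_mulVec]
  have hsk : ∀ x y, mdot (q x) y = -mdot x (q y) := fun x y => by
    rw [← hqa, ← hqa, hQ.mdot_app_left]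
  -- the projection onto the range of `Q`
  let π : Mink n →L[ℝ] Mink n := c⁻¹ • q.comp q
  have hπ : ∀ x, π x = c⁻¹ • q (q x) := fun x => rfl
  have hqπ : ∀ x, q (π x) = q x := fun x => by
    rw [hπ, map_smul, hq3, smul_smul, inv_mul_cancel₀ hc, one_smul]
  have hπq : ∀ x, π (q x) = q x := fun x => by
    rw [hπ, hq3, smul_smul, inv_mul_cancel₀ hc, one_smul]
  have hcπ : ∀ x, q (q x) = c • π x := fun x => by rw [hπ, smul_smul, mul_inv_cancel₀ hc, one_smul]
  have hππ : ∀ x, π (π x) = π x := fun x => by rw [hπ (π x), hqπ, hπ]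
  have hsym : ∀ x y, mdot (π x) y = mdot x (π y) := fun x y => by
    rw [hπ, hπ, mdot_smul_left, mdot_smul_right, hsk, hsk, neg_neg]
  -- the part of `x` outside the range of `Q` can be scaled away
  have main : ∀ s : Mink n × Mink n → V, IsSymbol s →
      osc minkPhase volume (fun z => s (z.1, -q z.2)) =
        osc minkPhase volume (fun z => s (π z.1, -q z.2)) := by
    intro s hs
    have h0 : IsSymbol fun z : Mink n × Mink n => s (z.1, -q z.2) :=
      hs.comp_clm ((ContinuousLinearMap.fst ℝ (Mink n) (Mink n)).prod
        (-q.comp (ContinuousLinearMap.snd ℝ (Mink n) (Mink n))))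
    let L0 : Mink n × Mink n →L[ℝ] Mink n × Mink n :=
      (π.comp (ContinuousLinearMap.fst ℝ (Mink n) (Mink n))).prod
        (-q.comp (ContinuousLinearMap.snd ℝ (Mink n) (Mink n)))
    let L1 : Mink n × Mink n →L[ℝ] Mink n × Mink n :=
      ((ContinuousLinearMap.fst ℝ (Mink n) (Mink n)) -
        π.comp (ContinuousLinearMap.fst ℝ (Mink n) (Mink n))).prod 0
    have hb : IsSymbol fun z => s (L0 z) := hs.comp_clm L0
    obtain ⟨M, hM⟩ := hs.symBound (oscOrder (Mink n × Mink n))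
    have h1 : Tendsto (fun t : ℝ => osc minkPhase volume fun z => s ((L0 + t • L1) z))
        (𝓝[>] 0) (𝓝 (osc minkPhase volume fun z => s (L0 z))) := by
      refine tendsto_osc isPhase_minkPhase
        (M := M * (max (‖L0‖ + ‖L1‖) 1) ^ oscOrder (Mink n × Mink n)) ?_ hb fun z => ?_
      · filter_upwards [Ioc_mem_nhdsGT (zero_lt_one (α := ℝ))] with t ht
        refine ⟨hs.comp_clm _, SymBound.comp_clm hs.1 hM ?_ (le_max_right _ _)⟩
        refine le_trans ((norm_add_le _ _).trans ?_) (le_max_left _ _)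
        rw [norm_smul, Real.norm_of_nonneg ht.1.le]
        gcongr
        exact mul_le_of_le_one_left (norm_nonneg _) ht.2
      · apply Tendsto.mono_left _ nhdsWithin_le_nhds
        have hc : Continuous fun t : ℝ => s ((L0 + t • L1) z) := by
          have := hs.continuous
          show Continuous fun t : ℝ => s (L0 z + t • L1 z)
          fun_prop
        have := hc.tendsto 0
        simpa using this
    refine tendsto_nhds_unique_of_eventuallyEq tendsto_const_nhds h1 ?_
    filter_upwards [self_mem_nhdsWithin] with t ht
    have ht : 0 < t := ht
    have hpr : ∀ r : ℝ, ∀ x, (π + r • (ContinuousLinearMap.id ℝ (Mink n) - π)) x =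
        π x + r • (x - π x) := fun r x => rfl
    have hT := osc_mink_comp
      (((π + t • (ContinuousLinearMap.id ℝ (Mink n) - π)).comp
        (ContinuousLinearMap.fst ℝ (Mink n) (Mink n))).prod
      ((π + t⁻¹ • (ContinuousLinearMap.id ℝ (Mink n) - π)).comp
        (ContinuousLinearMap.snd ℝ (Mink n) (Mink n)))) (fun z => by
        simp only [minkPhase, ContinuousLinearMap.prod_apply, ContinuousLinearMap.comp_apply,
          ContinuousLinearMap.coe_fst', ContinuousLinearMap.coe_snd', hpr, mdot_add_left,
          mdot_add_right, mdot_smul_left, mdot_smul_right, mdot_sub_left, mdot_sub_right, hsym,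
          hππ, sub_self, mul_zero, add_zero]
        field_simp
        ring) h0
    rw [← hT]
    congr 1
    funext z
    congr 1
    refine Prod.ext ?_ ?_
    · rfl
    · show -q (π z.2 + t⁻¹ • (z.2 - π z.2)) = -q z.2 + t • (0 : Mink n)
      rw [map_add, map_smul, map_sub, hqπ, sub_self, smul_zero, smul_zero, add_zero,
        add_zero]
  have hs' : IsSymbol fun z : Mink n × Mink n => s (-z.2, z.1) :=
    hs.comp_clm ((-ContinuousLinearMap.snd ℝ (Mink n) (Mink n)).prod
      (ContinuousLinearMap.fst ℝ (Mink n) (Mink n)))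
  have h1 := main s hs
  have h2 := main _ hs'
  simp only [neg_neg] at h2
  simp only [hqa]
  rw [h1, h2]
  have hb : IsSymbol fun z : Mink n × Mink n => s (π z.1, -q z.2) :=
    hs.comp_clm ((π.comp (ContinuousLinearMap.fst ℝ (Mink n) (Mink n))).prod
        (-q.comp (ContinuousLinearMap.snd ℝ (Mink n) (Mink n))))
  have hT := osc_mink_comp
    ((q.comp (ContinuousLinearMap.snd ℝ (Mink n) (Mink n)) +
      (ContinuousLinearMap.id ℝ (Mink n) - π).comp
        (ContinuousLinearMap.fst ℝ (Mink n) (Mink n))).prod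
    ((-c⁻¹) • q.comp (ContinuousLinearMap.fst ℝ (Mink n) (Mink n)) +
      (ContinuousLinearMap.id ℝ (Mink n) - π).comp
        (ContinuousLinearMap.snd ℝ (Mink n) (Mink n)))) (fun z => by
      have e : mdot (q z.1) (q z.2) = -(c * mdot z.2 (π z.1)) := by
        rw [hsk, hcπ, mdot_smul_right, ← hsym, mdot_comm]
      simp only [minkPhase, ContinuousLinearMap.prod_apply, ContinuousLinearMap.comp_apply,
          ContinuousLinearMap.coe_fst', ContinuousLinearMap.coe_snd', add_apply, smul_apply,
          sub_apply, ContinuousLinearMap.id_apply, mdot_add_left,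
          mdot_add_right, mdot_smul_left, mdot_sub_left, mdot_sub_right, e, hsym,
          hππ, hπq, hsk _ z.1, hsk _ (π z.1), hqπ, sub_self, add_zero]
      field_simp
      ring) hb
  rw [← hT]
  congr 1
  funext z
  congr 1
  refine Prod.ext ?_ ?_
  · show π (q z.2 + (z.1 - π z.1)) = q z.2
    rw [map_add, map_sub, hππ, hπq, sub_self, add_zero]
  · show -q ((-c⁻¹) • q z.1 + (z.2 - π z.2)) = π z.1
    rw [map_add, map_smul, map_sub, hqπ, sub_self, add_zero, neg_smul, neg_neg, hπ]

end MinkOscillatory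

/-! ### Warped convolutions -/

section Warp

open MeasureTheory Filter Topology Poincare

variable {n : ℕ} {H : Type*} [NormedAddCommGroup H] [InnerProductSpace ℂ H] [CompleteSpace H]
  {U : Poincare n →* (H ≃ₗᵢ[ℂ] H)}

/-- The vector `F_Q ψ`, written as `(2π)^(-d) ∬ exp (-i p x) U(x) F U(-Q p) ψ dx dp`. The
substitution `x ↦ x + Q p` yields the integral over `U(x) α_{Qp}(F) ψ`, see `osc_shift`. -/
noncomputable def warpVec (Q : Matrix (Fin (n + 2)) (Fin (n + 2)) ℝ) (F : Op U)
    (ψ : smoothVectors U) : H :=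
  (((2 * Real.pi) ^ (n + 2) : ℝ) : ℂ)⁻¹ •
    osc minkPhase volume (fun z : Mink n × Mink n => sandwich F ψ (z.1, -app Q z.2))

/-- The linear map `(x, p) ↦ (x, -Q p)`. -/
noncomputable def warpArg (Q : Matrix (Fin (n + 2)) (Fin (n + 2)) ℝ) :
    Mink n × Mink n →L[ℝ] Mink n × Mink n :=
  (ContinuousLinearMap.fst ℝ (Mink n) (Mink n)).prod
    (-(appL Q).comp (ContinuousLinearMap.snd ℝ (Mink n) (Mink n)))

variable (hD : Dense (smoothVectors U : Set H)) {Q : Matrix (Fin (n + 2)) (Fin (n + 2)) ℝ}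
include hD

theorem isSymbol_warp {l : ℕ} {F : Op U} (hF : OpBound l F) (ψ : smoothVectors U) :
    IsSymbol fun z : Mink n × Mink n => sandwich F ψ (z.1, -app Q z.2) :=
  (isSymbol_sandwich hD hF ψ).comp_clm (warpArg Q)

theorem inner_warpVec {l : ℕ} {F : Op U} (hF : OpBound l F) (φ : H) (ψ : smoothVectors U) :
    ⟪φ, warpVec Q F ψ⟫_ℂ = (((2 * Real.pi) ^ (n + 2) : ℝ) : ℂ)⁻¹ *
      osc minkPhase volume
        (fun z : Mink n × Mink n => ⟪φ, sandwich F ψ (z.1, -app Q z.2)⟫_ℂ) := by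
  rw [warpVec, inner_smul_right]
  congr 1
  exact (osc_clm isPhase_minkPhase (innerSL ℂ φ) (isSymbol_warp hD hF ψ)).symm

/-- Warped convolutions map smooth vectors to smooth vectors: the derivatives of `warpVec Q F ψ` are
the vectors `warpVec Q (P F) ψ`, where `P` is a product of generators. -/
theorem warpVec_mem_smoothVectors {l : ℕ} {F : Op U} (hF : OpBound l F) (ψ : smoothVectors U) :
    warpVec Q F ψ ∈ smoothVectors U := by
  refine mem_smoothVectors_of_weak hD (ι := {F : Op U // ∃ l, OpBound l F})
    (η := fun F => warpVec Q F.1 ψ)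
    (s := fun μ F => ⟨partialU U μ * F.1, F.2.imp' (fun l => 1 + l)
      fun _ h => (opBound_partialU μ).mul h⟩) (fun F μ φ => ?_) ⟨F, l, hF⟩
  obtain ⟨F, l, hF⟩ := F
  rw [inner_warpVec hD hF, inner_warpVec hD ((opBound_partialU μ).mul hF), ← mul_neg]
  congr 1
  have h := osc_smul (μ := volume) (isPhase_minkPhase (n := n)) (-1)
    ((isSymbol_const (φ : H)).inner
      (isSymbol_warp (Q := Q) hD ((opBound_partialU μ).mul hF) ψ))
  rw [neg_one_smul] at h
  rw [← h]
  congr 1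
  funext z
  have := inner_partialU μ φ (smoothAct U (trans z.1) (F (smoothAct U (trans (-app Q z.2)) ψ)))
  rw [partialU_smoothAct] at this
  rw [neg_one_smul]
  exact this

theorem warpVec_add {l l' : ℕ} {F G : Op U} (hF : OpBound l F) (hG : OpBound l' G)
    (ψ : smoothVectors U) : warpVec Q (F + G) ψ = warpVec Q F ψ + warpVec Q G ψ := by
  rw [warpVec, warpVec, warpVec, ← smul_add,
    ← osc_add isPhase_minkPhase (isSymbol_warp hD hF ψ) (isSymbol_warp hD hG ψ)]
  congr 2
  funext z
  simp [sandwich]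

theorem exists_op_warpVec {l : ℕ} {F : Op U} (hF : OpBound l F) :
    ∃ G : Op U, ∀ ψ, (G ψ : H) = warpVec Q F ψ := by
  refine ⟨⟨⟨fun ψ => ⟨warpVec Q F ψ, warpVec_mem_smoothVectors hD hF ψ⟩, fun φ ψ => ?_⟩,
    fun c ψ => ?_⟩, fun ψ => rfl⟩
  · ext
    show warpVec Q F (φ + ψ) = warpVec Q F φ + warpVec Q F ψ
    rw [warpVec, warpVec, warpVec, ← smul_add,
      ← osc_add isPhase_minkPhase (isSymbol_warp hD hF φ) (isSymbol_warp hD hF ψ)]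
    congr 2
    funext z
    simp [sandwich]
  · ext
    show warpVec Q F (c • ψ) = c • warpVec Q F ψ
    rw [warpVec, warpVec, smul_comm, ← osc_smul isPhase_minkPhase c (isSymbol_warp hD hF ψ)]
    congr 2
    funext z
    simp [sandwich]

omit hD in
theorem map_trans_alpha (F : Op U) (ψ : smoothVectors U) (x y : Mink n) :
    U (trans x) (alpha U (trans y) F ψ : H) = sandwich F ψ (x + y, -y) := by
  rw [coe_alpha_trans, coe_smoothAct, map_trans_trans]
  rfl

/-- The warped convolution exists and is given by the vectors `warpVec Q F ψ`. -/
theorem isWarped_of_warpVec (hQ : IsSkew Q) {l : ℕ} {F G : Op U} (hF : OpBound l F)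
    (hG : ∀ ψ, (G ψ : H) = warpVec Q F ψ) : IsWarped U Q F G := by
  intro ψ χ hχ
  have ha : IsSymbol fun z : Mink n × Mink n => sandwich F ψ (z.1 + app Q z.2, -app Q z.2) :=
    (isSymbol_sandwich hD hF ψ).comp_clm ((ContinuousLinearMap.fst ℝ (Mink n) (Mink n) +
      (appL Q).comp (ContinuousLinearMap.snd ℝ (Mink n) (Mink n))).prod
        (-(appL Q).comp (ContinuousLinearMap.snd ℝ (Mink n) (Mink n))))
  have hc : IsCutoff volume χ
      fun z : Mink n × Mink n => sandwich F ψ (z.1 + app Q z.2, -app Q z.2) :=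
    isCutoff_of_integrable χ.isSymbol hχ χ.integrable ha
  have e : ∀ (ε : ℝ) (z : Mink n × Mink n),
      (χ (ε • z) * Complex.exp (-Complex.I * (mdot z.2 z.1 : ℂ))) •
        U (trans z.1) ((alpha U (trans (app Q z.2)) F ψ : smoothVectors U) : H) =
      oscFactor minkPhase z • (χ (ε • z) • sandwich F ψ (z.1 + app Q z.2, -app Q z.2)) := by
    intro ε z
    rw [map_trans_alpha, smul_smul, mul_comm]
    rfl
  simp only [e]
  refine ⟨fun ε hε => integrable_oscFactor_smul isPhase_minkPhase (hc.integrable ε hε), ?_⟩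
  rw [hG, warpVec, ← osc_shift hQ (isSymbol_warp hD hF ψ)]
  exact (tendsto_oscReg isPhase_minkPhase ha hc).const_smul _

omit hD [CompleteSpace H] in
/-- Warped convolutions are unique, since there is a cutoff and limits are unique. -/
theorem IsWarped.unique {F G G' : Op U} (h : IsWarped U Q F G) (h' : IsWarped U Q F G') :
    G = G' := by
  -- a Schwartz cutoff, without which the defining condition would be empty
  obtain ⟨χ, hχ⟩ : ∃ χ : SchwartzMap (Mink n × Mink n) ℂ, χ 0 = 1 :=
    ⟨hasCompactSupport_stdCutoff.toSchwartzMap contDiff_stdCutoff, stdCutoff_zero⟩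
  ext ψ
  exact tendsto_nhds_unique (h ψ χ hχ).2 (h' ψ χ hχ).2

omit hD [CompleteSpace H] in
theorem IsWarped.warp_eq {F G : Op U} (h : IsWarped U Q F G) : warp U Q F = G := by
  have hex : ∃ G, IsWarped U Q F G := ⟨G, h⟩
  rw [warp, dif_pos hex]
  exact hex.choose_spec.unique h

theorem coe_warp (hQ : IsSkew Q) {l : ℕ} {F : Op U} (hF : OpBound l F) (ψ : smoothVectors U) :
    (warp U Q F ψ : H) = warpVec Q F ψ := by
  obtain ⟨G, hG⟩ := exists_op_warpVec (Q := Q) hD hF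
  rw [(isWarped_of_warpVec hD hQ hF hG).warp_eq, hG]

theorem isWarped_warp (hQ : IsSkew Q) {l : ℕ} {F : Op U} (hF : OpBound l F) :
    IsWarped U Q F (warp U Q F) :=
  isWarped_of_warpVec hD hQ hF fun ψ => coe_warp hD hQ hF ψ

/-- Warping commutes with the derivations `ad U μ`. -/
theorem ad_warp (hQ : IsSkew Q) {l : ℕ} {F : Op U} (hF : F ∈ tame U l) (μ : Fin (n + 2)) :
    ad U μ (warp U Q F) = warp U Q (ad U μ F) := by
  have hb := opBound_of_mem_tame hF
  have hb' := opBound_of_mem_tame (ad_mem_tame hF μ)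
  have h1 : ∀ ψ, (partialU U μ (warp U Q F ψ) : H) = warpVec Q (partialU U μ * F) ψ := by
    intro ψ
    refine ext_inner_dense hD fun φ hφ => ?_
    have h := inner_partialU μ ⟨φ, hφ⟩ (warp U Q F ψ)
    rw [coe_warp hD hQ hb, inner_warpVec hD hb] at h
    rw [← neg_inj, ← h, inner_warpVec hD ((opBound_partialU μ).mul hb), ← mul_neg]
    congr 1
    have h := osc_smul (μ := volume) (isPhase_minkPhase (n := n)) (-1)
      ((isSymbol_const φ).inner
        (isSymbol_warp (Q := Q) hD ((opBound_partialU μ).mul hb) ψ))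
    rw [neg_one_smul] at h
    rw [← h]
    congr 1
    funext z
    have := inner_partialU μ ⟨φ, hφ⟩
      (smoothAct U (trans z.1) (F (smoothAct U (trans (-app Q z.2)) ψ)))
    rw [partialU_smoothAct] at this
    rw [neg_one_smul]
    exact this
  have h2 : ∀ ψ, (warp U Q F (partialU U μ ψ) : H) = warpVec Q (F * partialU U μ) ψ := by
    intro ψ
    rw [coe_warp hD hQ hb, warpVec, warpVec]
    simp only [sandwich_mul_partialU]
  ext ψ
  rw [ad_apply, Submodule.coe_sub, h1, h2, coe_warp hD hQ hb', sub_eq_iff_eq_add,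
    ← warpVec_add hD hb' (hb.mul (opBound_partialU μ)), ad_def, sub_add_cancel]

/-- Warped convolutions of tame operators are tame. The set of all of them is closed under
commutators with the generators, so only the bound of `F_Q` itself is needed. Each derivative of
the symbol costs one power of `1 + |P|²`. -/
theorem warp_mem_tame (hQ : IsSkew Q) {l : ℕ} {F : Op U} (hF : F ∈ tame U l) :
    warp U Q F ∈ tame U (l + oscOrder (Mink n × Mink n)) := by
  refine mem_tame_of_closed (S := {G | ∃ F ∈ tame U l, G = warp U Q F}) ?_ ?_ ⟨F, hF, rfl⟩
  · rintro _ ⟨F, hF, rfl⟩ μ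
    exact ⟨_, ad_mem_tame hF μ, ad_warp hD hQ hF μ⟩
  · rintro _ ⟨F, hF, rfl⟩
    have hb := opBound_of_mem_tame hF
    obtain ⟨C, hC, h⟩ := norm_osc_le (V := H) (μ := volume) (isPhase_minkPhase (n := n))
    obtain ⟨A, hA, hAb⟩ := exists_symBound_sandwich hD (oscOrder (Mink n × Mink n)) hb
    set K := oscOrder (Mink n × Mink n)
    refine ⟨‖(((2 * Real.pi) ^ (n + 2) : ℝ) : ℂ)⁻¹‖ *
      (C * (A * (max ‖warpArg Q‖ 1) ^ K)), fun ψ => ?_⟩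
    have h1 : SymBound K _ fun z => sandwich F ψ (warpArg Q z) :=
      SymBound.comp_clm (contDiff_sandwich hD hb ψ) (hAb ψ) (le_max_left ‖warpArg Q‖ 1)
        (le_max_right _ _)
    have h2 := h _ _ (isSymbol_warp (Q := Q) hD hb ψ) h1
    show ‖(warp U Q F ψ : H)‖ ≤ _
    rw [coe_warp hD hQ hb, warpVec, norm_smul, mul_assoc]
    refine mul_le_mul_of_nonneg_left (h2.trans (le_of_eq ?_)) (norm_nonneg _)
    ring

/-- On the vacuum `F_Q` acts like `F`, since the symbol does not depend on `p`. -/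
theorem warp_vac (hQ : IsSkew Q) {l : ℕ} {F : Op U} (hF : F ∈ tame U l) {Ω : H}
    (hΩ : IsVacuum U Ω) : warp U Q F (vac hΩ) = F (vac hΩ) := by
  have hb := opBound_of_mem_tame hF
  ext
  rw [coe_warp hD hQ hb, warpVec]
  have e : ∀ z : Mink n × Mink n, sandwich F (vac hΩ) z = sandwich F (vac hΩ) (z.1, 0) := by
    intro z
    have : ∀ x, smoothAct U (trans x) (vac hΩ) = vac hΩ := fun x => Subtype.ext (hΩ.invariant _)
    simp only [sandwich, this]
  have e' : ∀ z : Mink n × Mink n, sandwich F (vac hΩ) (z.1, -app Q z.2) =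
      sandwich F (vac hΩ) (z.1, 0) := fun z => e _
  simp only [e']
  have hs : IsSymbol fun x : Mink n => sandwich F (vac hΩ) (x, 0) :=
    (isSymbol_sandwich hD hb (vac hΩ)).comp_clm (ContinuousLinearMap.inl ℝ (Mink n) (Mink n))
  rw [osc_fst hs, smul_smul, inv_mul_cancel₀, one_smul]
  · simp [sandwich, smoothAct, trans_zero]
  · have : ((2 * Real.pi) ^ (n + 2) : ℝ) ≠ 0 := by positivity
    exact_mod_cast this

/-- The symmetric form of the warped convolution, with the operator `U(Q p) F U(x)`. -/
theorem warpVec_eq_right (hQ : IsSkew Q) {c : ℝ} (hc : c ≠ 0) (hQ3 : Q * Q * Q = c • Q) {l : ℕ}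
    {F : Op U} (hF : OpBound l F) (ψ : smoothVectors U) :
    warpVec Q F ψ = (((2 * Real.pi) ^ (n + 2) : ℝ) : ℂ)⁻¹ •
      osc minkPhase volume (fun z : Mink n × Mink n => sandwich F ψ (app Q z.2, z.1)) := by
  rw [warpVec, osc_exchange hQ hc hQ3 (isSymbol_sandwich hD hF ψ)]

omit hD [CompleteSpace H] in
theorem inner_sandwich_of_adjoint {F F' : Op U}
    (h : ∀ φ ψ : smoothVectors U, ⟪(φ : H), (F ψ : H)⟫_ℂ = ⟪(F' φ : H), (ψ : H)⟫_ℂ)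
    (φ ψ : smoothVectors U) (u v : Mink n) :
    ⟪(φ : H), sandwich F ψ (u, v)⟫_ℂ = ⟪sandwich F' φ (-v, -u), (ψ : H)⟫_ℂ := by
  rw [sandwich, inner_map_trans]
  have := h (smoothAct U (trans (-u)) φ) (smoothAct U (trans v) ψ)
  rw [coe_smoothAct] at this
  rw [this, coe_smoothAct, inner_map_trans]
  rfl

/-- The adjoint of `F_Q` is `(F*)_Q`. -/
theorem inner_warp_of_adjoint (hQ : IsSkew Q) {c : ℝ} (hc : c ≠ 0) (hQ3 : Q * Q * Q = c • Q)
    {l l' : ℕ} {F F' : Op U} (hF : OpBound l F) (hF' : OpBound l' F')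
    (h : ∀ φ ψ : smoothVectors U, ⟪(φ : H), (F ψ : H)⟫_ℂ = ⟪(F' φ : H), (ψ : H)⟫_ℂ)
    (φ ψ : smoothVectors U) :
    ⟪(φ : H), (warp U Q F ψ : H)⟫_ℂ = ⟪(warp U Q F' φ : H), (ψ : H)⟫_ℂ := by
  have hs := isSymbol_sandwich hD hF ψ
  have hs2 : IsSymbol fun z : Mink n × Mink n => sandwich F ψ (app Q z.2, z.1) :=
    hs.comp_clm (((appL Q).comp (ContinuousLinearMap.snd ℝ (Mink n) (Mink n))).prod
      (ContinuousLinearMap.fst ℝ (Mink n) (Mink n)))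
  have h1 : ⟪(φ : H), (warp U Q F ψ : H)⟫_ℂ = (((2 * Real.pi) ^ (n + 2) : ℝ) : ℂ)⁻¹ *
      osc minkPhase volume
        (fun z : Mink n × Mink n => ⟪(φ : H), sandwich F ψ (app Q z.2, z.1)⟫_ℂ) := by
    rw [coe_warp hD hQ hF, warpVec_eq_right hD hQ hc hQ3 hF, inner_smul_right]
    congr 1
    exact (osc_clm isPhase_minkPhase (innerSL ℂ (φ : H)) hs2).symm
  rw [h1, ← inner_conj_symm, coe_warp hD hQ hF', inner_warpVec hD hF', map_mul,
    conj_osc_mink ((isSymbol_const (ψ : H)).inner (isSymbol_warp hD hF' φ)), map_inv₀,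
    Complex.conj_ofReal]
  congr 2
  funext z
  rw [inner_conj_symm, inner_sandwich_of_adjoint h]

end Warp

/-! ### Covariance of warped convolutions -/

section Covariance

open MeasureTheory Filter Topology Poincare

variable {n : ℕ}

theorem mdot_eq_dotProduct (x y : Mink n) : mdot x y = x.ofLp ⬝ᵥ (eta n).mulVec y.ofLp := by
  rw [eta, dotProduct, Fin.sum_univ_succ]
  simp [mdot, Matrix.mulVec_diagonal, Fin.succ_ne_zero, sub_eq_add_neg]

namespace Poincare

theorem mat_isometry (g : Poincare n) : g.mat.transpose * eta n * g.mat = eta n := g.lor.2.1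

theorem mdot_app_app (g : Poincare n) (x y : Mink n) :
    mdot (app g.mat x) (app g.mat y) = mdot x y := by
  have h := mat_isometry g
  rw [mdot_eq_dotProduct, mdot_eq_dotProduct x y]
  conv_rhs => rw [← h]
  simp only [app]
  rw [← Matrix.mulVec_mulVec, ← Matrix.mulVec_mulVec, Matrix.dotProduct_mulVec _ g.mat.transpose,
    Matrix.vecMul_transpose]

theorem coe_lor_inv (g : Poincare n) : (g.lor⁻¹).val.val = g.mat⁻¹ := by
  rw [Subgroup.coe_inv, Matrix.coe_units_inv]
  rfl

theorem isUnit_det_mat (g : Poincare n) : IsUnit g.mat.det :=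
  (Matrix.isUnit_iff_isUnit_det _).1 g.lor.val.isUnit

theorem app_mat_inv (g : Poincare n) (x : Mink n) : app g.mat (app g.mat⁻¹ x) = x := by
  rw [← app_mul, Matrix.mul_nonsing_inv _ g.isUnit_det_mat, app_one]

theorem app_inv_mat (g : Poincare n) (x : Mink n) : app g.mat⁻¹ (app g.mat x) = x := by
  rw [← app_mul, Matrix.nonsing_inv_mul _ g.isUnit_det_mat, app_one]

theorem mul_trans (g : Poincare n) (x : Mink n) :
    g * trans x = trans (app g.mat x) * g := by
  rw [trans_mul, coe_lor_inv, app_inv_mat]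

end Poincare

/-- The matrix `Λ Q Λ⁻¹`. -/
noncomputable def conjMat (g : Poincare n) (Q : Matrix (Fin (n + 2)) (Fin (n + 2)) ℝ) :
    Matrix (Fin (n + 2)) (Fin (n + 2)) ℝ := g.mat * Q * g.mat⁻¹

theorem app_conjMat (g : Poincare n) (Q : Matrix (Fin (n + 2)) (Fin (n + 2)) ℝ) (x : Mink n) :
    app (conjMat g Q) x = app g.mat (app Q (app g.mat⁻¹ x)) := by
  rw [conjMat, app_mul, app_mul]

theorem IsSkew.conjMat {Q : Matrix (Fin (n + 2)) (Fin (n + 2)) ℝ} (hQ : IsSkew Q)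
    (g : Poincare n) : IsSkew (conjMat g Q) := by
  intro p q
  have hp := app_mat_inv g p
  have hq := app_mat_inv g q
  rw [app_conjMat, app_conjMat]
  nth_rw 1 [← hq]
  nth_rw 2 [← hp]
  rw [mdot_app_app, mdot_app_app, hQ]

variable {H : Type*} [NormedAddCommGroup H] [InnerProductSpace ℂ H] [CompleteSpace H]
  {U : Poincare n →* (H ≃ₗᵢ[ℂ] H)}

theorem map_map_trans (g : Poincare n) (x : Mink n) (ψ : H) :
    U g (U (trans x) ψ) = U (trans (app g.mat x)) (U g ψ) := by
  show (U g * U (trans x)) ψ = (U (trans _) * U g) ψ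
  rw [← map_mul, ← map_mul, mul_trans]

/-- Covariance: `α_g(F_Q) = (α_g F)_{Λ Q Λ⁻¹}`. -/
theorem alpha_warp (hD : Dense (smoothVectors U : Set H))
    {Q : Matrix (Fin (n + 2)) (Fin (n + 2)) ℝ} (hQ : IsSkew Q) (g : Poincare n) {l l' : ℕ}
    {F : Op U} (hF : OpBound l F) (hgF : OpBound l' (alpha U g F)) :
    alpha U g (warp U Q F) = warp U (conjMat g Q) (alpha U g F) := by
  ext ψ
  have h1 : (alpha U g (warp U Q F) ψ : H) = U g (warp U Q F ((smoothAct U g).symm ψ)) := rfl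
  rw [h1, coe_warp hD hQ hF, coe_warp hD (hQ.conjMat g) hgF, warpVec, warpVec, map_smul]
  congr 1
  have h2 := osc_clm (μ := volume) isPhase_minkPhase
    ((U g).toContinuousLinearEquiv : H →L[ℂ] H) (isSymbol_warp (Q := Q) hD hF ((smoothAct U g).symm ψ))
  refine h2.symm.trans ?_
  rw [← osc_mink_comp (((appL g.mat).comp (ContinuousLinearMap.fst ℝ (Mink n) (Mink n))).prod
    ((appL g.mat).comp (ContinuousLinearMap.snd ℝ (Mink n) (Mink n))))
    (fun z => by simp [minkPhase, appL_apply, mdot_app_app])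
    (isSymbol_warp (Q := conjMat g Q) hD hgF ψ)]
  congr 1
  funext z
  show U g (U (trans z.1) (F (smoothAct U (trans (-app Q z.2)) ((smoothAct U g).symm ψ)))) =
    U (trans (app g.mat z.1)) (U g (F ((smoothAct U g).symm
      (smoothAct U (trans (-app (conjMat g Q) (app g.mat z.2))) ψ))))
  rw [map_map_trans]
  congr 4
  ext
  rw [coe_smoothAct, coe_smoothAct_symm, coe_smoothAct_symm, coe_smoothAct, app_conjMat,
    app_inv_mat]
  apply (U g).injective
  have e : ∀ v : H, U g (U g⁻¹ v) = v := fun v => by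
    show (U g * U g⁻¹) v = v
    rw [← map_mul, mul_inv_cancel, map_one]
    rfl
  rw [map_map_trans, e, e, app_neg]

end Covariance

/-! ### The spectrum condition -/

section Spectrum

open MeasureTheory Filter Topology Poincare

variable {n : ℕ} {H : Type*} [NormedAddCommGroup H] [InnerProductSpace ℂ H]
  {U : Poincare n →* (H ≃ₗᵢ[ℂ] H)}

/-- The Lebesgue measure on the space of the quadruples `((x, p), (y, k))`. -/
noncomputable abbrev pairVolume (n : ℕ) : Measure ((Mink n × Mink n) × (Mink n × Mink n)) :=
  (volume : Measure (Mink n × Mink n)).prod volume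

instance : (pairVolume n).IsAddHaarMeasure :=
  Measure.prod.instIsAddHaarMeasure (volume : Measure (Mink n × Mink n)) volume

/-- Functions whose Fourier transform is concentrated in a sufficiently small ball around a point
of a compact set outside the spectrum are annihilated by the translations. The radius is a
Lebesgue number. -/
theorem exists_radius_of_disjoint_spectrum {C : Set (Mink n)} (hC : IsCompact C)
    (hdisj : ∀ p ∈ C, p ∉ jointSpectrum U) : ∃ r > 0, ∀ p ∈ C, ∀ f : SchwartzMap (Mink n) ℂ,
      (∀ q, r ≤ dist q p → ∫ x : Mink n, f x * Complex.exp (Complex.I * (mdot q x : ℂ)) = 0) →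
      ∀ ψ : H, ∫ x : Mink n, f x • U (trans x) ψ = 0 := by
  have h : ∀ p : C, ∃ N ∈ 𝓝 (p : Mink n), ∀ f : SchwartzMap (Mink n) ℂ,
      (∀ q, q ∉ N → ∫ x : Mink n, f x * Complex.exp (Complex.I * (mdot q x : ℂ)) = 0) →
      ∀ ψ : H, ∫ x : Mink n, f x • U (trans x) ψ = 0 := by
    intro p
    have := hdisj p p.2
    simp only [jointSpectrum, Set.mem_ofPred_eq, not_forall] at this
    obtain ⟨N, hN, h⟩ := this
    refine ⟨N, hN, fun f hf ψ => ?_⟩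
    by_contra hne
    exact h ⟨f, hf, ψ, hne⟩
  choose N hN h using h
  obtain ⟨r, hr, hcov⟩ := lebesgue_number_lemma_of_metric (c := fun p : C => interior (N p)) hC
    (fun _ => isOpen_interior) fun p hp =>
      Set.mem_iUnion.2 ⟨⟨p, hp⟩, mem_interior_iff_mem_nhds.2 (hN ⟨p, hp⟩)⟩
  refine ⟨r, hr, fun p hp f hf ψ => ?_⟩
  obtain ⟨i, hi⟩ := hcov p hp
  refine h i f (fun q hq => hf q ?_) ψ
  by_contra hlt
  exact hq (interior_subset (hi (not_le.1 hlt)))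

/-- The Fourier transform of a function with support in the unit ball is the cutoff for the
space-time variables: modulated and scaled, its Fourier transform has support in a small ball. -/
theorem integral_modulated_eq_zero {b : SchwartzMap (Mink n) ℂ} (hb : ∀ q, 1 ≤ ‖q‖ → b q = 0)
    {p : Mink n} {r : ℝ}
    (h : ∀ f : SchwartzMap (Mink n) ℂ,
      (∀ q, r ≤ dist q p → ∫ x : Mink n, f x * Complex.exp (Complex.I * (mdot q x : ℂ)) = 0) →
      ∀ ψ : H, ∫ x : Mink n, f x • U (trans x) ψ = 0) {ε : ℝ} (hε : 0 < ε) (hεr : ε ≤ r) (ψ : H) :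
    ∫ x : Mink n, (Complex.exp (-Complex.I * (mdot p x : ℂ)) * minkFourier b (ε • x)) •
      U (trans x) ψ = 0 := by
  have hs : ContDiff ℝ ∞ fun q : Mink n => b (ε⁻¹ • (q - p)) :=
    (b.smooth ⊤).comp (by fun_prop : ContDiff ℝ ∞ fun q : Mink n => ε⁻¹ • (q - p))
  have hz : ∀ q : Mink n, ε ≤ dist q p → b (ε⁻¹ • (q - p)) = 0 := by
    intro q hq
    apply hb
    rw [norm_smul, norm_inv, Real.norm_of_nonneg hε.le, ← dist_eq_norm]
    rw [inv_mul_eq_div, le_div_iff₀ hε, one_mul]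
    exact hq
  have hc : HasCompactSupport fun q : Mink n => b (ε⁻¹ • (q - p)) :=
    HasCompactSupport.intro (isCompact_closedBall p ε) fun q hq => hz q (by
      rw [Metric.mem_closedBall, not_le] at hq
      exact hq.le)
  let b' : SchwartzMap (Mink n) ℂ := hc.toSchwartzMap hs
  have hb' : ∀ q, b' q = b (ε⁻¹ • (q - p)) := fun q => rfl
  have h1 : ∀ x, minkFourier b' x = ((ε ^ (n + 2) : ℝ) : ℂ) *
      (Complex.exp (-Complex.I * (mdot p x : ℂ)) * minkFourier b (ε • x)) := by
    intro x
    obtain ⟨G, hG⟩ : ∃ G : Mink n → ℂ, ∀ u, G u = Complex.exp (-Complex.I * (mdot p x : ℂ)) *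
        (Complex.exp (-Complex.I * (mdot u (ε • x) : ℂ)) * b u) := ⟨_, fun _ => rfl⟩
    have e : ∀ q : Mink n, Complex.exp (-Complex.I * (mdot q x : ℂ)) * b' q =
        G (ε⁻¹ • (q - p)) := by
      intro q
      rw [hG, hb', ← mul_assoc, ← Complex.exp_add, mdot_smul_left, mdot_smul_right, mdot_sub_left]
      congr 2
      have : ε⁻¹ * (ε * (mdot q x - mdot p x)) = mdot q x - mdot p x := by field_simp
      rw [this]
      push_cast
      ring
    rw [minkFourier_apply]
    simp_rw [e]
    rw [integral_sub_right_eq_self (μ := volume) (fun q : Mink n => G (ε⁻¹ • q)) p,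
      Measure.integral_comp_inv_smul]
    simp_rw [hG]
    rw [integral_const_mul, ← minkFourier_apply,
      finrank_euclideanSpace_fin, abs_of_pos (by positivity), Complex.real_smul]
  have h2 := h (minkFourier b') (fun q hq => by
    rw [integral_minkFourier, hb', hz q (hεr.trans hq), mul_zero]) ψ
  simp_rw [h1, mul_smul] at h2
  rw [integral_smul, smul_eq_zero] at h2
  simp_rw [mul_smul]
  refine h2.resolve_left ?_
  have : (ε ^ (n + 2) : ℝ) ≠ 0 := by positivity
  exact_mod_cast this

/-- A multiple integral vanishes if the integral over the first variable does. If the function is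
not integrable, then the integral is zero by convention. -/
theorem integral_eq_zero_of_first {f : (Mink n × Mink n) × (Mink n × Mink n) → ℂ}
    (h : ∀ p w, ∫ x, f ((x, p), w) = 0) :
    ∫ w, f w ∂pairVolume n = 0 := by
  by_cases hf : Integrable f (pairVolume n)
  · rw [integral_prod_symm _ hf]
    refine integral_eq_zero_of_ae (Eventually.of_forall fun w => ?_)
    show ∫ z : Mink n × Mink n, f (z, w) = 0
    rw [show (volume : Measure (Mink n × Mink n)) = (volume : Measure (Mink n)).prod volume from rfl]
    by_cases hg : Integrable (fun z => f (z, w)) ((volume : Measure (Mink n)).prod volume)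
    · rw [integral_prod_symm _ hg]
      exact integral_eq_zero_of_ae (Eventually.of_forall fun p => h p w)
    · exact integral_undef hg
  · exact integral_undef hf

/-- A multiple integral vanishes if the integral over the third variable does. If the function is
not integrable, then the integral is zero by convention. -/
theorem integral_eq_zero_of_third {f : (Mink n × Mink n) × (Mink n × Mink n) → ℂ}
    (h : ∀ w k, ∫ y, f (w, (y, k)) = 0) :
    ∫ w, f w ∂pairVolume n = 0 := by
  by_cases hf : Integrable f (pairVolume n)
  · rw [integral_prod _ hf]
    refine integral_eq_zero_of_ae (Eventually.of_forall fun w => ?_)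
    show ∫ z : Mink n × Mink n, f (w, z) = 0
    rw [show (volume : Measure (Mink n × Mink n)) = (volume : Measure (Mink n)).prod volume from rfl]
    by_cases hg : Integrable (fun z => f (w, z)) ((volume : Measure (Mink n)).prod volume)
    · rw [integral_prod_symm _ hg]
      exact integral_eq_zero_of_ae (Eventually.of_forall fun k => h w k)
    · exact integral_undef hg
  · exact integral_undef hf

/-- The Euclidean norm of the spatial part of a momentum. -/
noncomputable def spatialNorm (p : Mink n) : ℝ := Real.sqrt (∑ i : Fin (n + 1), p i.succ ^ 2)

theorem continuous_spatialNorm : Continuous (spatialNorm : Mink n → ℝ) := by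
  unfold spatialNorm
  fun_prop

theorem mem_forwardCone {p : Mink n} : p ∈ forwardCone n ↔ spatialNorm p ≤ p 0 := Iff.rfl

variable [CompleteSpace H]

/-- If the symbol vanishes on compact sets of momenta up to a margin `δ` around the forward cone,
then the integral over `x` or the one over `y` vanishes by the spectrum condition. -/
theorem osc_eq_zero_of_compact (hU : ∀ ψ : H, Continuous fun g => U g ψ)
    (hspec : jointSpectrum U ⊆ forwardCone n) {φ ψ : H}
    {D : (Mink n × Mink n) × (Mink n × Mink n) → ℂ} (hD : IsSymbol D)
    (hl : ∀ p w, ∃ v : H, ∀ x, D ((x, p), w) = ⟪U (trans x) φ, v⟫_ℂ)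
    (hr : ∀ w k, ∃ v : H, ∀ y, D (w, (y, k)) = ⟪v, U (trans y) ψ⟫_ℂ)
    {δ R : ℝ} (hδ : 0 < δ) (hR : ∀ w, D w ≠ 0 → ‖w.1.2‖ ≤ R ∧ ‖w.2.2‖ ≤ R)
    (h0 : ∀ w, spatialNorm w.1.2 ≤ w.1.2 0 + δ → spatialNorm w.2.2 ≤ w.2.2 0 + δ → D w = 0) :
    osc (pairPhase minkPhase) (pairVolume n) D = 0 := by
  obtain ⟨b, hb, hb1⟩ := exists_schwartz_bump (n := n) 1 one_pos
  have hχ0 : minkFourier b 0 = 1 := by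
    rw [minkFourier_apply, ← hb1]
    congr 1
    funext p
    simp [mdot]
  obtain ⟨χ₁, hχ₁⟩ : ∃ χ₁ : SchwartzMap (Mink n) ℂ, χ₁ = minkFourier b := ⟨_, rfl⟩
  rw [← hχ₁] at hχ0
  -- the momenta outside the margin which may contribute to the integral
  let C : Set (Mink n) := Metric.closedBall 0 R ∩ {p | p 0 + δ ≤ spatialNorm p}
  have hCcl : IsClosed C := by
    refine Metric.isClosed_closedBall.inter (isClosed_le ?_ ?_)
    · fun_prop
    · exact continuous_spatialNorm
  have hC : IsCompact C := by
    refine (isCompact_closedBall (0 : Mink n) R).of_isClosed_subset hCcl fun p hp => hp.1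
  obtain ⟨r, hr0, hrC⟩ := exists_radius_of_disjoint_spectrum (U := U) hC fun p hp hps => by
    have h1 := mem_forwardCone.1 (hspec hps)
    have h2 : p 0 + δ ≤ spatialNorm p := hp.2
    linarith
  have hkey : ∀ p ∈ C, ∀ ε : ℝ, 0 < ε → ε ≤ r → ∀ ψ : H,
      ∫ x : Mink n, (Complex.exp (-Complex.I * (mdot p x : ℂ)) * χ₁ (ε • x)) •
        U (trans x) ψ = 0 := by
    intro p hp ε hε hεr ψ
    rw [hχ₁]
    exact integral_modulated_eq_zero hb (hrC p hp) hε hεr ψ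
  have hint : ∀ (p : Mink n) (ε : ℝ), 0 < ε → ∀ ψ : H,
      Integrable fun x : Mink n => (Complex.exp (-Complex.I * (mdot p x : ℂ)) * χ₁ (ε • x)) •
        U (trans x) ψ := by
    intro p ε hε ψ
    have h1 : Integrable (fun x : Mink n => χ₁ (ε • x)) :=
      integrable_comp_pos_smul (χ₁.integrable (μ := volume)) hε
    have h2 : Integrable (fun x : Mink n =>
        Complex.exp (-Complex.I * (mdot p x : ℂ)) * χ₁ (ε • x)) := by
      refine h1.bdd_mul (c := 1) ?_ (Eventually.of_forall fun x => ?_)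
      · refine Continuous.aestronglyMeasurable ?_
        simp only [← mdotL_apply]
        fun_prop
      · rw [Complex.norm_exp]
        simp
    refine h2.smul_bdd ‖ψ‖ (continuous_orbit hU ψ).aestronglyMeasurable
      (Eventually.of_forall fun x => (norm_map _ _).le)
  -- a cutoff in the space-time variables only; the momenta are restricted to a compact set
  let χ : (Mink n × Mink n) × (Mink n × Mink n) → ℂ :=
    fun w => (starRingEnd ℂ) (χ₁ w.1.1) • χ₁ w.2.1
  have hχs : IsSymbol χ := by
    have h1 : IsSymbol fun x : Mink n => (starRingEnd ℂ) (χ₁ x) :=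
      χ₁.isSymbol.clm_comp (Complex.conjCLE : ℂ →L[ℝ] ℂ)
    exact (h1.comp_clm ((ContinuousLinearMap.fst ℝ (Mink n) (Mink n)).comp
      (ContinuousLinearMap.fst ℝ (Mink n × Mink n) (Mink n × Mink n)))).smul
      (χ₁.isSymbol.comp_clm ((ContinuousLinearMap.fst ℝ (Mink n) (Mink n)).comp
      (ContinuousLinearMap.snd ℝ (Mink n × Mink n) (Mink n × Mink n))))
  have hc : IsCutoff (pairVolume n) χ D := by
    refine ⟨hχs, by simp [χ, hχ0], fun ε hε => ?_⟩
    obtain ⟨M, hM⟩ := hD.exists_norm_le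
    let ind : Mink n → ℂ := (Metric.closedBall (0 : Mink n) R).indicator fun _ => 1
    have hind : Integrable ind := by
      refine (integrable_indicator_iff measurableSet_closedBall).2 ?_
      exact integrableOn_const (measure_closedBall_lt_top.ne)
    have hind1 : ∀ p, ‖p‖ ≤ R → ind p = 1 := fun p hp =>
      Set.indicator_of_mem (by simpa using hp) _
    have h1 : Integrable (fun x : Mink n => χ₁ (ε • x)) :=
      integrable_comp_pos_smul (χ₁.integrable (μ := volume)) hε
    have h1' : Integrable (fun x : Mink n => (starRingEnd ℂ) (χ₁ (ε • x))) :=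
      (Complex.conjCLE : ℂ →L[ℝ] ℂ).integrable_comp h1
    have h2 := (h1'.mul_prod hind).mul_prod (h1.mul_prod hind)
    refine (h2.mul_bdd (c := M) hD.continuous.aestronglyMeasurable (Eventually.of_forall hM)).congr
      (Eventually.of_forall fun w => ?_)
    by_cases hw : D w = 0
    · simp [hw]
    · have := hR w hw
      simp [hind1 _ this.1, hind1 _ this.2, χ]
  refine osc_eq_zero (isPhase_minkPhase.pairPhase) hD hc ?_
  filter_upwards [Ioc_mem_nhdsGT hr0] with ε hε
  have hi := integrable_oscFactor_smul (isPhase_minkPhase.pairPhase) (hc.integrable ε hε.1)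
  have hfac : ∀ w : (Mink n × Mink n) × (Mink n × Mink n),
      oscFactor (pairPhase minkPhase) w • (χ (ε • w) • D w) =
      (starRingEnd ℂ) (Complex.exp (-Complex.I * (mdot w.1.2 w.1.1 : ℂ)) * χ₁ (ε • w.1.1)) *
        (Complex.exp (-Complex.I * (mdot w.2.2 w.2.1 : ℂ)) * χ₁ (ε • w.2.1)) * D w := by
    intro w
    have : oscFactor (pairPhase minkPhase) w =
        (starRingEnd ℂ) (Complex.exp (-Complex.I * (mdot w.1.2 w.1.1 : ℂ))) *
          Complex.exp (-Complex.I * (mdot w.2.2 w.2.1 : ℂ)) := by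
      rw [← Complex.exp_conj, ← Complex.exp_add, oscFactor]
      congr 1
      simp [pairPhase, minkPhase]
      ring
    rw [this]
    simp only [χ, smul_eq_mul, map_mul, Prod.smul_fst, Prod.smul_snd]
    ring
  -- if `p ∈ C`, then the `x`-integral vanishes, and otherwise the `y`-integral does so
  let S : Set ((Mink n × Mink n) × (Mink n × Mink n)) := {w | w.1.2 ∈ C}
  have hS : MeasurableSet S :=
    hCcl.measurableSet.preimage (by fun_prop)
  rw [oscReg, ← integral_add_compl hS hi, ← integral_indicator hS, ← integral_indicator hS.compl]
  have hz1 : ∫ w, S.indicator (fun w => oscFactor (pairPhase minkPhase) w • (χ (ε • w) • D w)) w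
      ∂pairVolume n = 0 := by
    refine integral_eq_zero_of_first fun p w => ?_
    by_cases hp : p ∈ C
    · obtain ⟨v, hv⟩ := hl p w
      have e : ∀ x, S.indicator
          (fun w => oscFactor (pairPhase minkPhase) w • (χ (ε • w) • D w)) ((x, p), w) =
          (Complex.exp (-Complex.I * (mdot w.2 w.1 : ℂ)) * χ₁ (ε • w.1)) *
          (starRingEnd ℂ) ⟪v, (Complex.exp (-Complex.I * (mdot p x : ℂ)) * χ₁ (ε • x)) •
            U (trans x) φ⟫_ℂ := by
        intro x
        rw [Set.indicator_of_mem (show ((x, p), w) ∈ S from hp), hfac, hv, inner_smul_right]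
        simp only [map_mul, inner_conj_symm]
        ring
      simp_rw [e]
      rw [integral_const_mul, integral_conj, integral_inner (hint p ε hε.1 φ),
        hkey p hp ε hε.1 hε.2, inner_zero_right, map_zero, mul_zero]
    · have e : ∀ x, S.indicator
          (fun w => oscFactor (pairPhase minkPhase) w • (χ (ε • w) • D w)) ((x, p), w) = 0 :=
        fun x => Set.indicator_of_notMem (show ((x, p), w) ∉ S from hp) _
      simp_rw [e]
      simp
  have hz2 : ∫ w, Sᶜ.indicator (fun w => oscFactor (pairPhase minkPhase) w • (χ (ε • w) • D w)) w
      ∂pairVolume n = 0 := by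
    refine integral_eq_zero_of_third fun w k => ?_
    by_cases hw : w.2 ∈ C
    · have e : ∀ y, Sᶜ.indicator
          (fun w => oscFactor (pairPhase minkPhase) w • (χ (ε • w) • D w)) (w, (y, k)) = 0 :=
        fun y => Set.indicator_of_notMem
          (Set.notMem_compl_iff.2 (show (w, (y, k)) ∈ S from hw)) _
      simp_rw [e]
      simp
    have hind : ∀ y, Sᶜ.indicator
        (fun w => oscFactor (pairPhase minkPhase) w • (χ (ε • w) • D w)) (w, (y, k)) =
        oscFactor (pairPhase minkPhase) (w, (y, k)) •
          (χ (ε • (w, (y, k))) • D (w, (y, k))) :=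
      fun y => Set.indicator_of_mem (show (w, (y, k)) ∈ Sᶜ from hw) _
    simp_rw [hind]
    by_cases hk : k ∈ C
    · obtain ⟨v, hv⟩ := hr w k
      have e : ∀ y, oscFactor (pairPhase minkPhase) (w, (y, k)) •
          (χ (ε • (w, (y, k))) • D (w, (y, k))) =
          (starRingEnd ℂ) (Complex.exp (-Complex.I * (mdot w.2 w.1 : ℂ)) * χ₁ (ε • w.1)) *
          ⟪v, (Complex.exp (-Complex.I * (mdot k y : ℂ)) * χ₁ (ε • y)) • U (trans y) ψ⟫_ℂ := by
        intro y
        rw [hfac, hv, inner_smul_right]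
        ring
      simp_rw [e]
      rw [integral_const_mul, integral_inner (hint k ε hε.1 ψ),
        hkey k hk ε hε.1 hε.2, inner_zero_right, mul_zero]
    · have e : ∀ y, D (w, (y, k)) = 0 := by
        intro y
        by_contra hne
        have h1 := hR _ hne
        refine hne (h0 _ ?_ ?_)
        · by_contra hlt
          exact hw ⟨by simpa using h1.1, (not_le.1 hlt).le⟩
        · by_contra hlt
          exact hk ⟨by simpa using h1.2, (not_le.1 hlt).le⟩
      simp_rw [e]
      simp
  rw [hz1, hz2, add_zero]

/-- The variant of `osc_eq_zero_of_compact` without a compact set of momenta, which is produced by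
cutoffs. -/
theorem osc_eq_zero_of_margin (hU : ∀ ψ : H, Continuous fun g => U g ψ)
    (hspec : jointSpectrum U ⊆ forwardCone n) {φ ψ : H}
    {D : (Mink n × Mink n) × (Mink n × Mink n) → ℂ} (hD : IsSymbol D)
    (hl : ∀ p w, ∃ v : H, ∀ x, D ((x, p), w) = ⟪U (trans x) φ, v⟫_ℂ)
    (hr : ∀ w k, ∃ v : H, ∀ y, D (w, (y, k)) = ⟪v, U (trans y) ψ⟫_ℂ)
    {δ : ℝ} (hδ : 0 < δ)
    (h0 : ∀ w, spatialNorm w.1.2 ≤ w.1.2 0 + δ → spatialNorm w.2.2 ≤ w.2.2 0 + δ → D w = 0) :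
    osc (pairPhase minkPhase) (pairVolume n) D = 0 := by
  -- the momenta are cut off by `g (η w)`, where `η → 0`
  obtain ⟨K, hK⟩ : ∃ K, K = oscOrder ((Mink n × Mink n) × (Mink n × Mink n)) := ⟨_, rfl⟩
  obtain ⟨M, hM⟩ := hD.symBound K
  obtain ⟨g, hg, hgd⟩ : ∃ g : (Mink n × Mink n) × (Mink n × Mink n) → ℂ, IsSymbol g ∧
      ∀ w, g w = stdCutoff (Mink n) w.1.2 • stdCutoff (Mink n) w.2.2 :=
    ⟨_, (isSymbol_stdCutoff.comp_clm ((ContinuousLinearMap.snd ℝ (Mink n) (Mink n)).comp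
      (ContinuousLinearMap.fst ℝ (Mink n × Mink n) (Mink n × Mink n)))).smul
      (isSymbol_stdCutoff.comp_clm ((ContinuousLinearMap.snd ℝ (Mink n) (Mink n)).comp
      (ContinuousLinearMap.snd ℝ (Mink n × Mink n) (Mink n × Mink n)))), fun _ => rfl⟩
  obtain ⟨A, hA⟩ := hg.symBound K
  have hgs : ∀ η : ℝ, IsSymbol fun w => g (η • w) := fun η =>
    hg.comp_clm (η • ContinuousLinearMap.id ℝ ((Mink n × Mink n) × (Mink n × Mink n)))
  have h2 : Tendsto (fun η : ℝ => osc (pairPhase minkPhase) (pairVolume n)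
      fun w => g (η • w) • D w) (𝓝[>] 0)
      (𝓝 (osc (pairPhase minkPhase) (pairVolume n) D)) := by
    refine tendsto_osc (isPhase_minkPhase.pairPhase) (M := 2 ^ K * (A * 1 ^ K * M)) ?_ hD
      fun w => ?_
    · filter_upwards [Ioc_mem_nhdsGT (zero_lt_one (α := ℝ))] with η hη
      have hL : ‖η • ContinuousLinearMap.id ℝ ((Mink n × Mink n) × (Mink n × Mink n))‖ ≤ 1 := by
        refine ContinuousLinearMap.opNorm_le_bound _ zero_le_one fun z => ?_
        show ‖η • z‖ ≤ _
        rw [norm_smul, Real.norm_of_nonneg hη.1.le]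
        gcongr
        exact hη.2
      have h3 := SymBound.comp_clm hg.1 hA hL le_rfl
      have h4 := SymBound.smul ((hgs η).1) hD.1 h3 hM
      rw [← hK]
      exact ⟨(hgs η).smul hD, h4⟩
    · apply Tendsto.mono_left _ nhdsWithin_le_nhds
      have hc : Continuous fun η : ℝ => g (η • w) • D w := by
        have := hg.continuous
        fun_prop
      have h := hc.tendsto 0
      have hg0 : g 0 = 1 := by simp [hgd, stdCutoff_zero]
      rwa [zero_smul, hg0, one_smul] at h
  refine tendsto_nhds_unique_of_eventuallyEq h2 tendsto_const_nhds ?_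
  filter_upwards [self_mem_nhdsWithin] with η hη
  have hη : 0 < η := hη
  obtain ⟨R, hR⟩ : ∃ R, ∀ p : Mink n, stdCutoff (Mink n) p ≠ 0 → ‖p‖ ≤ R := by
    obtain ⟨R, hR⟩ := (hasCompactSupport_stdCutoff (Z := Mink n)).isCompact.isBounded.exists_norm_le
    exact ⟨R, fun p hp => hR p (subset_tsupport _ hp)⟩
  have hRη : ∀ p : Mink n, stdCutoff (Mink n) (η • p) ≠ 0 → ‖p‖ ≤ R / η := by
    intro p hp
    have := hR _ hp
    rw [norm_smul, Real.norm_of_nonneg hη.le] at this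
    rwa [le_div_iff₀ hη, mul_comm]
  refine osc_eq_zero_of_compact hU hspec (φ := φ) (ψ := ψ) ((hgs η).smul hD) (fun p w => ?_)
    (fun w k => ?_) hδ (R := R / η) (fun w hw => ?_) fun w hw1 hw2 => ?_
  · obtain ⟨v, hv⟩ := hl p w
    refine ⟨g (η • ((0, p), w)) • v, fun x => ?_⟩
    rw [inner_smul_right, ← hv, hgd, hgd]
    rfl
  · obtain ⟨v, hv⟩ := hr w k
    refine ⟨(starRingEnd ℂ) (g (η • (w, (0, k)))) • v, fun y => ?_⟩
    rw [inner_smul_left, Complex.conj_conj, ← hv, hgd, hgd]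
    rfl
  · have hgw : g (η • w) ≠ 0 := fun h => hw (by simp [h])
    rw [hgd] at hgw
    exact ⟨hRη _ (left_ne_zero_of_smul hgw), hRη _ (right_ne_zero_of_smul hgw)⟩
  · rw [h0 w hw1 hw2, smul_zero]

/-- An oscillatory integral `∬ exp (i p x - i k y) ⟪U(x) φ, K(p, k) U(y) ψ⟫` vanishes if
`K(p, k) = 0` for all momenta `p`, `k` in the forward cone. The margin required for the spectrum
condition is produced by a shift of the momenta by `δ e₀` with `δ → 0`. -/
theorem osc_eq_zero_of_forwardCone (hU : ∀ ψ : H, Continuous fun g => U g ψ)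
    (hspec : jointSpectrum U ⊆ forwardCone n) {φ ψ : H}
    {D : (Mink n × Mink n) × (Mink n × Mink n) → ℂ} (hD : IsSymbol D)
    (hl : ∀ p w, ∃ v : H, ∀ x, D ((x, p), w) = ⟪U (trans x) φ, v⟫_ℂ)
    (hr : ∀ w k, ∃ v : H, ∀ y, D (w, (y, k)) = ⟪v, U (trans y) ψ⟫_ℂ)
    (h0 : ∀ w, w.1.2 ∈ forwardCone n → w.2.2 ∈ forwardCone n → D w = 0) :
    osc (pairPhase minkPhase) (pairVolume n) D = 0 := by
  let e₀ : Mink n := EuclideanSpace.single 0 1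
  let c : ℝ → (Mink n × Mink n) × (Mink n × Mink n) := fun δ => ((0, δ • e₀), (0, δ • e₀))
  obtain ⟨M, hM⟩ := hD.symBound (oscOrder ((Mink n × Mink n) × (Mink n × Mink n)))
  have hsp : ∀ (δ : ℝ) (p : Mink n), spatialNorm (p + δ • e₀) = spatialNorm p := by
    intro δ p
    simp [spatialNorm, e₀]
  have htm : ∀ (δ : ℝ) (p : Mink n), (p + δ • e₀) 0 = p 0 + δ := by
    intro δ p
    simp [e₀]
  have h1 : Tendsto (fun δ : ℝ => osc (pairPhase minkPhase) (pairVolume n)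
      fun w => D (w + c δ)) (𝓝[>] 0)
      (𝓝 (osc (pairPhase minkPhase) (pairVolume n) D)) := by
    refine tendsto_osc (isPhase_minkPhase.pairPhase) (M := M)
      (Eventually.of_forall fun δ => ⟨hD.comp_add _, hM.comp_add _⟩) hD fun w => ?_
    apply Tendsto.mono_left _ nhdsWithin_le_nhds
    have hc : Continuous fun δ : ℝ => D (w + c δ) := by
      have := hD.continuous
      fun_prop
    have h := hc.tendsto 0
    have hc0 : c 0 = 0 := by simp [c]
    rwa [hc0, add_zero] at h
  refine tendsto_nhds_unique_of_eventuallyEq h1 tendsto_const_nhds ?_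
  filter_upwards [self_mem_nhdsWithin] with δ hδ
  refine osc_eq_zero_of_margin hU hspec (φ := φ) (ψ := ψ) (hD.comp_add _) (fun p w => ?_)
    (fun w k => ?_) hδ fun w hw1 hw2 => h0 _ ?_ ?_
  · obtain ⟨v, hv⟩ := hl (p + δ • e₀) (w + (0, δ • e₀))
    refine ⟨v, fun x => ?_⟩
    rw [← hv]
    simp [c]
  · obtain ⟨v, hv⟩ := hr (w + (0, δ • e₀)) (k + δ • e₀)
    refine ⟨v, fun y => ?_⟩
    rw [← hv]
    simp [c]
  · show spatialNorm (w.1.2 + δ • e₀) ≤ (w.1.2 + δ • e₀) 0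
    rw [hsp, htm]
    exact hw1
  · show spatialNorm (w.2.2 + δ • e₀) ≤ (w.2.2 + δ • e₀) 0
    rw [hsp, htm]
    exact hw2

end Spectrum

/-! ### Commutation of warped convolutions -/

section Commutation

open MeasureTheory Filter Topology Poincare

variable {n : ℕ} {H : Type*} [NormedAddCommGroup H] [InnerProductSpace ℂ H]
  {U : Poincare n →* (H ≃ₗᵢ[ℂ] H)}

/-- `F'` is the restriction of the adjoint of `F` to the domain of the smooth vectors. -/
def IsFormalAdjoint (F F' : Op U) : Prop :=
  ∀ φ ψ : smoothVectors U, ⟪(φ : H), (F ψ : H)⟫_ℂ = ⟪(F' φ : H), (ψ : H)⟫_ℂ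

theorem IsFormalAdjoint.alpha {F F' : Op U} (h : IsFormalAdjoint F F') (g : Poincare n) :
    IsFormalAdjoint (alpha U g F) (alpha U g F') := by
  have key : ∀ v w : H, ⟪v, U g w⟫_ℂ = ⟪U g⁻¹ v, w⟫_ℂ := by
    intro v w
    have e : U g (U g⁻¹ v) = v := by
      show (U g * U g⁻¹) v = v
      rw [← map_mul, mul_inv_cancel, map_one]
      rfl
    rw [← (U g).inner_map_map (U g⁻¹ v), e]
  intro φ ψ
  have h1 := key (φ : H) (F ((smoothAct U g).symm ψ))
  have h2 := h ((smoothAct U g).symm φ) ((smoothAct U g).symm ψ)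
  have h3 := key (ψ : H) (F' ((smoothAct U g).symm φ))
  rw [← inner_conj_symm, ← inner_conj_symm (U g⁻¹ (ψ : H))] at h3
  exact h1.trans (h2.trans ((starRingEnd ℂ).injective h3).symm)

theorem sandwich_sub (F : Op U) (ψ : smoothVectors U) (u x : Mink n) :
    sandwich F ψ (u, x - u) = (alpha U (trans u) F (smoothAct U (trans x) ψ) : H) := by
  rw [coe_alpha_trans, coe_smoothAct, sandwich]
  congr 3
  ext
  show U (trans (x - u)) (ψ : H) = U (trans (-u)) (U (trans x) (ψ : H))
  rw [map_trans_trans, neg_add_eq_sub]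

/-- Translations commute, so they may be exchanged between the two sides of a scalar product. -/
theorem inner_sandwich_swap (F G : Op U) (φ ψ : smoothVectors U) (u v x y : Mink n) :
    ⟪sandwich G φ (-u, x), sandwich F ψ (v, y)⟫_ℂ =
      ⟪sandwich G φ (-v, x), sandwich F ψ (u, y)⟫_ℂ := by
  simp only [sandwich]
  rw [← inner_map_trans, ← inner_map_trans, map_trans_trans, map_trans_trans, add_comm]

variable [CompleteSpace H]

/-- Linear substitutions which preserve the phase `-p x + k y`. -/
theorem osc_pairPhase_comp
    (T : (Mink n × Mink n) × (Mink n × Mink n) →L[ℝ] (Mink n × Mink n) × (Mink n × Mink n))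
    (hT : ∀ w, pairPhase minkPhase (T w) = pairPhase minkPhase w)
    {a : (Mink n × Mink n) × (Mink n × Mink n) → ℂ} (ha : IsSymbol a) :
    osc (pairPhase minkPhase) (pairVolume n) (fun w => a (T w)) =
      osc (pairPhase minkPhase) (pairVolume n) a := by
  refine osc_comp_clm_of_invariant isPhase_minkPhase.pairPhase ?_ T hT ha
  have h := inner_osc_osc (μ := volume) (isPhase_minkPhase (n := n)) (isSymbol_const (1 : ℂ))
    (isSymbol_const (1 : ℂ))
  simp only [inner_self_eq_norm_sq_to_K, norm_one] at h
  have h0 := osc_minkPhase_one_ne_zero (n := n)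
  intro h1
  simp only [map_one, one_pow] at h
  rw [h1] at h
  simp at h
  exact h0 h

variable (hD : Dense (smoothVectors U : Set H)) {Q Q₁ Q₂ : Matrix (Fin (n + 2)) (Fin (n + 2)) ℝ}
include hD

/-- The functions of `((x, p), (y, k))` whose oscillatory integrals are the matrix elements of
products of warped convolutions are symbols. -/
theorem isSymbol_inner_sandwich {l l' : ℕ} {F G : Op U} (hF : OpBound l F) (hG : OpBound l' G)
    (φ ψ : smoothVectors U)
    (S T : (Mink n × Mink n) × (Mink n × Mink n) →L[ℝ] Mink n × Mink n) :
    IsSymbol fun w => ⟪sandwich F φ (S w), sandwich G ψ (T w)⟫_ℂ :=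
  ((isSymbol_sandwich hD hF φ).comp_clm S).inner ((isSymbol_sandwich hD hG ψ).comp_clm T)

/-- Scalar products of warped convolutions as oscillatory integrals over pairs of space-time
points and momenta. -/
theorem inner_warpVec_warpVec (hQ₁ : IsSkew Q₁) (hQ₂ : IsSkew Q₂) {c₁ c₂ : ℝ} (hc₁ : c₁ ≠ 0)
    (hc₂ : c₂ ≠ 0) (h₁ : Q₁ * Q₁ * Q₁ = c₁ • Q₁) (h₂ : Q₂ * Q₂ * Q₂ = c₂ • Q₂) {l l' : ℕ}
    {F G : Op U} (hF : OpBound l F) (hG : OpBound l' G) (φ ψ : smoothVectors U) :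
    ⟪warpVec Q₁ F φ, warpVec Q₂ G ψ⟫_ℂ =
      ((((2 * Real.pi) ^ (n + 2) : ℝ) : ℂ)⁻¹ * (((2 * Real.pi) ^ (n + 2) : ℝ) : ℂ)⁻¹) *
      osc (pairPhase minkPhase) (pairVolume n) (fun w =>
        ⟪sandwich F φ (app Q₁ w.1.2, w.1.1), sandwich G ψ (app Q₂ w.2.2, w.2.1)⟫_ℂ) := by
  have hs : ∀ (Q : Matrix (Fin (n + 2)) (Fin (n + 2)) ℝ) {l : ℕ} {F : Op U} (_ : OpBound l F) ψ,
      IsSymbol fun z : Mink n × Mink n => sandwich F ψ (app Q z.2, z.1) := fun Q l F hF ψ =>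
    (isSymbol_sandwich hD hF ψ).comp_clm
      (((appL Q).comp (ContinuousLinearMap.snd ℝ (Mink n) (Mink n))).prod
      (ContinuousLinearMap.fst ℝ (Mink n) (Mink n)))
  rw [warpVec_eq_right hD hQ₁ hc₁ h₁ hF, warpVec_eq_right hD hQ₂ hc₂ h₂ hG, inner_smul_left,
    inner_smul_right, inner_osc_osc isPhase_minkPhase (hs Q₁ hF φ) (hs Q₂ hG ψ), map_inv₀,
    Complex.conj_ofReal, mul_assoc]

/-- Warped convolutions with opposite matrices commute if the translated operators commute for
all momenta in the forward cone. -/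
theorem warp_mul_warp_neg (hU : ∀ ψ : H, Continuous fun g => U g ψ)
    (hspec : jointSpectrum U ⊆ forwardCone n) (hQ : IsSkew Q) {c : ℝ} (hc : c ≠ 0)
    (hQ3 : Q * Q * Q = c • Q) {l l' m m' : ℕ} {F F' G G' : Op U} (hF : OpBound l F)
    (hF' : OpBound l' F') (hG : OpBound m G) (hG' : OpBound m' G') (hFF : IsFormalAdjoint F F')
    (hGG : IsFormalAdjoint G G')
    (hcomm : ∀ p ∈ forwardCone n, ∀ k ∈ forwardCone n,
      alpha U (trans (app Q p)) F * alpha U (trans (app (-Q) k)) G =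
        alpha U (trans (app (-Q) k)) G * alpha U (trans (app Q p)) F) :
    warp U Q F * warp U (-Q) G = warp U (-Q) G * warp U Q F := by
  have hQ' := hQ.neg
  have hQ3' : -Q * -Q * -Q = c • -Q := by
    rw [smul_neg, ← hQ3]
    noncomm_ring
  have hneg : ∀ x, app (-Q) x = -app Q x := fun x => by simp [app, Matrix.neg_mulVec]
  ext ψ
  refine ext_inner_dense hD fun φ hφ => ?_
  obtain ⟨φ, rfl⟩ : ∃ φ' : smoothVectors U, (φ' : H) = φ := ⟨⟨φ, hφ⟩, rfl⟩
  show ⟪(φ : H), (warp U Q F (warp U (-Q) G ψ) : H)⟫_ℂ =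
    ⟪(φ : H), (warp U (-Q) G (warp U Q F ψ) : H)⟫_ℂ
  rw [inner_warp_of_adjoint hD hQ hc hQ3 hF hF' hFF φ (warp U (-Q) G ψ),
    inner_warp_of_adjoint hD hQ' hc hQ3' hG hG' hGG φ (warp U Q F ψ),
    coe_warp hD hQ hF', coe_warp hD hQ' hG,
    coe_warp hD hQ' hG', coe_warp hD hQ hF,
    inner_warpVec_warpVec hD hQ hQ' hc hc hQ3 hQ3' hF' hG,
    inner_warpVec_warpVec hD hQ' hQ hc hc hQ3' hQ3 hG' hF]
  congr 1
  simp only [hneg]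
  -- the coordinates `x`, `y`, `Q p` and `Q k`
  let X : (Mink n × Mink n) × (Mink n × Mink n) →L[ℝ] Mink n :=
    (ContinuousLinearMap.fst ℝ (Mink n) (Mink n)).comp
      (ContinuousLinearMap.fst ℝ (Mink n × Mink n) (Mink n × Mink n))
  let P : (Mink n × Mink n) × (Mink n × Mink n) →L[ℝ] Mink n :=
    (ContinuousLinearMap.snd ℝ (Mink n) (Mink n)).comp
      (ContinuousLinearMap.fst ℝ (Mink n × Mink n) (Mink n × Mink n))
  let Y : (Mink n × Mink n) × (Mink n × Mink n) →L[ℝ] Mink n :=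
    (ContinuousLinearMap.fst ℝ (Mink n) (Mink n)).comp
      (ContinuousLinearMap.snd ℝ (Mink n × Mink n) (Mink n × Mink n))
  let K : (Mink n × Mink n) × (Mink n × Mink n) →L[ℝ] Mink n :=
    (ContinuousLinearMap.snd ℝ (Mink n) (Mink n)).comp
      (ContinuousLinearMap.snd ℝ (Mink n × Mink n) (Mink n × Mink n))
  let QP := (appL Q).comp P
  let QK := (appL Q).comp K
  -- the substitutions `x ↦ x - Q p` and `y ↦ y + Q k`
  have e1 : osc (pairPhase minkPhase) (pairVolume n) (fun w =>
        ⟪sandwich F' φ (app Q w.1.2, w.1.1), sandwich G ψ (-app Q w.2.2, w.2.1)⟫_ℂ) =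
      osc (pairPhase minkPhase) (pairVolume n) (fun w =>
        ⟪sandwich F' φ (app Q w.1.2, w.1.1 - app Q w.1.2),
          sandwich G ψ (-app Q w.2.2, w.2.1 - -app Q w.2.2)⟫_ℂ) := by
    refine (osc_pairPhase_comp (((X - QP).prod P).prod ((Y - -QK).prod K)) (fun w => ?_)
      (isSymbol_inner_sandwich hD hF' hG φ ψ (QP.prod X) ((-QK).prod Y))).symm
    show -mdot w.1.2 (w.1.1 - app Q w.1.2) + mdot w.2.2 (w.2.1 - -app Q w.2.2) =
      -mdot w.1.2 w.1.1 + mdot w.2.2 w.2.1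
    rw [sub_neg_eq_add, mdot_sub_right, mdot_add_right, hQ.mdot_app_self, hQ.mdot_app_self,
      sub_zero, add_zero]
  -- `Q p` and `Q k` are exchanged, so that both integrals have the same translations; then the
  -- substitutions are `x ↦ x + Q k` and `y ↦ y - Q p`
  have e2 : osc (pairPhase minkPhase) (pairVolume n) (fun w =>
        ⟪sandwich G' φ (-app Q w.1.2, w.1.1), sandwich F ψ (app Q w.2.2, w.2.1)⟫_ℂ) =
      osc (pairPhase minkPhase) (pairVolume n) (fun w =>
        ⟪sandwich G' φ (-app Q w.2.2, w.1.1 - -app Q w.2.2),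
          sandwich F ψ (app Q w.1.2, w.2.1 - app Q w.1.2)⟫_ℂ) := by
    refine Eq.trans ?_ (osc_pairPhase_comp (((X - -QK).prod P).prod ((Y - QP).prod K)) (fun w => ?_)
      (isSymbol_inner_sandwich hD hG' hF φ ψ ((-QK).prod X) (QP.prod Y))).symm
    rotate_left
    · show -mdot w.1.2 (w.1.1 - -app Q w.2.2) + mdot w.2.2 (w.2.1 - app Q w.1.2) =
        -mdot w.1.2 w.1.1 + mdot w.2.2 w.2.1
      rw [sub_neg_eq_add, mdot_sub_right, mdot_add_right, hQ w.1.2]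
      ring
    · congr 1
      funext w
      exact inner_sandwich_swap F G' φ ψ _ _ _ _
  have s1 : IsSymbol fun w : (Mink n × Mink n) × (Mink n × Mink n) =>
      ⟪sandwich F' φ (app Q w.1.2, w.1.1 - app Q w.1.2),
          sandwich G ψ (-app Q w.2.2, w.2.1 - -app Q w.2.2)⟫_ℂ :=
    isSymbol_inner_sandwich hD hF' hG φ ψ (QP.prod (X - QP)) ((-QK).prod (Y - -QK))
  have s2 : IsSymbol fun w : (Mink n × Mink n) × (Mink n × Mink n) =>
      ⟪sandwich G' φ (-app Q w.2.2, w.1.1 - -app Q w.2.2),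
          sandwich F ψ (app Q w.1.2, w.2.1 - app Q w.1.2)⟫_ℂ :=
    isSymbol_inner_sandwich hD hG' hF φ ψ ((-QK).prod (X - -QK)) (QP.prod (Y - QP))
  rw [e1, e2]
  simp only [sandwich_sub] at s1 s2 ⊢
  have s3 := (isSymbol_const (-1 : ℂ)).smul s2
  have s4 := s1.add s3
  -- the difference of the two symbols is a matrix element of the commutator
  have hz := osc_eq_zero_of_forwardCone hU hspec (φ := (φ : H)) (ψ := (ψ : H)) s4
    (fun p w => ?_) (fun w k => ?_) fun w hp hk => ?_
  · rw [osc_add isPhase_minkPhase.pairPhase s1 s3, osc_smul isPhase_minkPhase.pairPhase _ s2,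
      neg_one_smul, add_neg_eq_zero] at hz
    exact hz
  · refine ⟨(alpha U (trans (app Q p)) F (alpha U (trans (-app Q w.2)) G
      (smoothAct U (trans w.1) ψ)) : H) - (alpha U (trans (-app Q w.2)) G
      (alpha U (trans (app Q p)) F (smoothAct U (trans w.1) ψ)) : H), fun x => ?_⟩
    rw [inner_sub_right]
    have h1 := hFF.alpha (trans (app Q p)) (smoothAct U (trans x) φ)
      (alpha U (trans (-app Q w.2)) G (smoothAct U (trans w.1) ψ))
    have h2 := hGG.alpha (trans (-app Q w.2)) (smoothAct U (trans x) φ)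
      (alpha U (trans (app Q p)) F (smoothAct U (trans w.1) ψ))
    rw [coe_smoothAct] at h1 h2
    rw [h1, h2, smul_eq_mul, neg_one_mul, sub_eq_add_neg]
  · refine ⟨(alpha U (trans (-app Q k)) G' (alpha U (trans (app Q w.2)) F'
      (smoothAct U (trans w.1) φ)) : H) - (alpha U (trans (app Q w.2)) F'
      (alpha U (trans (-app Q k)) G' (smoothAct U (trans w.1) φ)) : H), fun y => ?_⟩
    rw [inner_sub_left]
    have h1 := hGG.alpha (trans (-app Q k))
      (alpha U (trans (app Q w.2)) F' (smoothAct U (trans w.1) φ)) (smoothAct U (trans y) ψ)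
    have h2 := hFF.alpha (trans (app Q w.2))
      (alpha U (trans (-app Q k)) G' (smoothAct U (trans w.1) φ)) (smoothAct U (trans y) ψ)
    rw [coe_smoothAct] at h1 h2
    rw [← h1, ← h2, smul_eq_mul, neg_one_mul, sub_eq_add_neg]
  · have h1 := hFF.alpha (trans (app Q w.1.2)) (smoothAct U (trans w.1.1) φ)
      (alpha U (trans (-app Q w.2.2)) G (smoothAct U (trans w.2.1) ψ))
    have h2 := hGG.alpha (trans (-app Q w.2.2)) (smoothAct U (trans w.1.1) φ)
      (alpha U (trans (app Q w.1.2)) F (smoothAct U (trans w.2.1) ψ))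
    have h3 := DFunLike.congr_fun (hcomm _ hp _ hk) (smoothAct U (trans w.2.1) ψ)
    rw [hneg] at h3
    have h3 : alpha U (trans (app Q w.1.2)) F (alpha U (trans (-app Q w.2.2)) G
      (smoothAct U (trans w.2.1) ψ)) = alpha U (trans (-app Q w.2.2)) G
      (alpha U (trans (app Q w.1.2)) F (smoothAct U (trans w.2.1) ψ)) := h3
    rw [← h1, ← h2, h3, smul_eq_mul, neg_one_mul, add_neg_cancel]

end Commutation

/-! ### Geometry of wedges -/

section Wedges

open Filter Topology Poincare

variable {n : ℕ}

namespace Poincare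

theorem mat_mul (g h : Poincare n) : (g * h).mat = g.mat * h.mat := rfl

theorem image_mul (g h : Poincare n) (S : Set (Mink n)) :
    (g * h).image S = g.image (h.image S) := by
  rw [image, image, image, Set.image_image]
  congr 1
  funext x
  rw [mat_mul, app_mul, app_add, add_assoc]
  rfl

theorem image_one (S : Set (Mink n)) : (1 : Poincare n).image S = S := by
  have : (fun x : Mink n => app (1 : Poincare n).mat x + (1 : Poincare n).tr) = id := by
    funext x
    show app (1 : Matrix (Fin (n + 2)) (Fin (n + 2)) ℝ) x + 0 = x
    rw [app_one, add_zero]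
  rw [image, this, Set.image_id]

theorem image_subset_image_iff (g : Poincare n) {S T : Set (Mink n)} :
    g.image S ⊆ g.image T ↔ S ⊆ T := by
  refine ⟨fun h => ?_, fun h => Set.image_mono h⟩
  have h' : (g⁻¹).image (g.image S) ⊆ (g⁻¹).image (g.image T) := Set.image_mono h
  rwa [← image_mul, ← image_mul, inv_mul_cancel, image_one, image_one] at h'

theorem image_trans (x : Mink n) (S : Set (Mink n)) : (trans x).image S = (fun y => y + x) '' S := by
  rw [image]
  congr 1
  funext y
  show app (1 : Matrix (Fin (n + 2)) (Fin (n + 2)) ℝ) y + x = y + x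
  rw [app_one]

/-- Poincare transformations as homeomorphisms. -/
noncomputable def toHomeomorph (g : Poincare n) : Mink n ≃ₜ Mink n where
  toFun x := app g.mat x + g.tr
  invFun x := app g.mat⁻¹ (x - g.tr)
  left_inv x := by
    show app g.mat⁻¹ (app g.mat x + g.tr - g.tr) = x
    rw [add_sub_cancel_right, app_inv_mat]
  right_inv x := by
    show app g.mat (app g.mat⁻¹ (x - g.tr)) + g.tr = x
    rw [app_mat_inv, sub_add_cancel]
  continuous_toFun := (appL g.mat).continuous.add continuous_const
  continuous_invFun := (appL g.mat⁻¹).continuous.comp (continuous_id.sub continuous_const)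

/-- The first row of a Lorentz matrix satisfies `Λ₀₀² - ∑ᵢ Λ₀ᵢ² = 1`, since the transpose is a
Lorentz matrix as well. -/
theorem sum_sq_row (g : Poincare n) :
    ∑ i : Fin (n + 1), g.mat 0 i.succ ^ 2 = g.mat 0 0 ^ 2 - 1 := by
  have := isometry_col (A := g.mat.transpose)
    (by rw [Matrix.transpose_transpose]; exact isometry_transpose g.mat_isometry)
  simpa using this

theorem mat_zero_zero_pos (g : Poincare n) : 0 < g.mat 0 0 := g.lor.2.2.1

end Poincare

theorem app_apply (A : Matrix (Fin (n + 2)) (Fin (n + 2)) ℝ) (x : Mink n) (i : Fin (n + 2)) :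
    app A x i = ∑ j, A i j * x j := rfl

theorem app_smul (A : Matrix (Fin (n + 2)) (Fin (n + 2)) ℝ) (c : ℝ) (x : Mink n) :
    app A (c • x) = c • app A x := (appL A).map_smul c x

theorem app_sub (A : Matrix (Fin (n + 2)) (Fin (n + 2)) ℝ) (x y : Mink n) :
    app A (x - y) = app A x - app A y := (appL A).map_sub x y

theorem mat_ext {A B : Matrix (Fin (n + 2)) (Fin (n + 2)) ℝ} (h : ∀ x : Mink n, app A x = app B x) :
    A = B := by
  refine Matrix.mulVec_injective (funext fun v => ?_)
  exact congrArg WithLp.ofLp (h (WithLp.toLp 2 v))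

theorem mem_forwardCone_iff {p : Mink n} : p ∈ forwardCone n ↔ 0 ≤ p 0 ∧ 0 ≤ mdot p p := by
  have hm : mdot p p = p 0 ^ 2 - ∑ i : Fin (n + 1), p i.succ ^ 2 := by
    simp [mdot, sq]
  have hs : 0 ≤ ∑ i : Fin (n + 1), p i.succ ^ 2 := Finset.sum_nonneg fun i _ => sq_nonneg _
  show Real.sqrt _ ≤ p 0 ↔ _
  rw [Real.sqrt_le_iff, hm, sub_nonneg]

/-- Lorentz transformations preserve the forward cone. -/
theorem app_mem_forwardCone (g : Poincare n) {p : Mink n} (hp : p ∈ forwardCone n) :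
    app g.mat p ∈ forwardCone n := by
  obtain ⟨h0, h1⟩ := mem_forwardCone_iff.1 hp
  refine mem_forwardCone_iff.2 ⟨?_, by rwa [mdot_app_app]⟩
  rw [app_apply, Fin.sum_univ_succ]
  -- the Cauchy-Schwarz inequality and `∑ᵢ Λ₀ᵢ² = Λ₀₀² - 1`
  have hcs := Finset.sum_mul_sq_le_sq_mul_sq Finset.univ
    (fun i : Fin (n + 1) => g.mat 0 i.succ) (fun i => p i.succ)
  rw [g.sum_sq_row] at hcs
  have hm : mdot p p = p 0 ^ 2 - ∑ i : Fin (n + 1), p i.succ ^ 2 := by simp [mdot, sq]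
  set S := ∑ i : Fin (n + 1), g.mat 0 i.succ * p i.succ
  set T := ∑ i : Fin (n + 1), p i.succ ^ 2
  have hT : 0 ≤ T := Finset.sum_nonneg fun i _ => sq_nonneg _
  have ha := g.mat_zero_zero_pos
  have hb : 0 ≤ g.mat 0 0 ^ 2 - 1 := by
    rw [← g.sum_sq_row]
    exact Finset.sum_nonneg fun i _ => sq_nonneg _
  have hle : S ^ 2 ≤ (g.mat 0 0 * p 0) ^ 2 := by
    have : T ≤ p 0 ^ 2 := by linarith
    nlinarith [sq_nonneg (p 0)]
  have := abs_le_of_sq_le_sq hle (by positivity)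
  linarith [(abs_le.1 this).1]

/-! The lightlike vectors `(±1, 1, 0, …, 0)` span the edge plane of the standard wedge. -/

/-- The lightlike vector `(s, 1, 0, ...)` for `s = ±1`. -/
noncomputable def lightVec (n : ℕ) (s : ℝ) : Mink n :=
  EuclideanSpace.single 0 s + EuclideanSpace.single 1 1

theorem lightVec_zero (s : ℝ) : lightVec n s 0 = s := by simp [lightVec]

theorem lightVec_one (s : ℝ) : lightVec n s 1 = 1 := by simp [lightVec]

theorem mdot_lightVec (s : ℝ) (x : Mink n) : mdot (lightVec n s) x = s * x 0 - x 1 := by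
  rw [mdot, lightVec_zero, Fin.sum_univ_succ]
  have h : ∀ i : Fin n, lightVec n s i.succ.succ = 0 := fun i => by
    simp [lightVec, Fin.ext_iff]
  simp [h, lightVec_one]

/-- The matrix `Q_κ` in terms of the two lightlike vectors, which are its eigenvectors for the
eigenvalues `κ` and `-κ`. -/
theorem app_stdQ (κ : ℝ) (x : Mink n) : app (stdQ n κ) x =
    (κ / 2) • (mdot (lightVec n 1) x • lightVec n (-1) -
      mdot (lightVec n (-1)) x • lightVec n 1) := by
  rw [mdot_lightVec, mdot_lightVec]
  ext i
  rw [app_apply, Fin.sum_univ_succ, Fin.sum_univ_succ]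
  have hs : ∀ j : Fin n, (j.succ.succ : Fin (n + 2)) ≠ 1 := fun j => by simp [Fin.ext_iff]
  have h2 : ∀ j : Fin n, stdQ n κ i j.succ.succ = 0 := fun j => by
    simp [stdQ, hs]
  simp only [h2, zero_mul, Finset.sum_const_zero, add_zero]
  refine Fin.cases ?_ (fun i => ?_) i
  · simp [stdQ, lightVec]
    ring
  · refine Fin.cases ?_ (fun i => ?_) i
    · simp [stdQ, lightVec]
      ring
    · simp [stdQ, lightVec, hs]

theorem app_rotQ (κ : ℝ) (g : Poincare n) (x : Mink n) : app (rotQ κ g) x =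
    (κ / 2) • (mdot (app g.mat (lightVec n 1)) x • app g.mat (lightVec n (-1)) -
      mdot (app g.mat (lightVec n (-1))) x • app g.mat (lightVec n 1)) := by
  have h : ∀ v : Mink n, mdot v (app g.mat⁻¹ x) = mdot (app g.mat v) x := fun v => by
    rw [← mdot_app_app g v, app_mat_inv]
  show app (conjMat g (stdQ n κ)) x = _
  rw [app_conjMat, app_stdQ, app_smul, app_sub, app_smul, app_smul, h, h]

theorem isSkew_rotQ (κ : ℝ) (g : Poincare n) : IsSkew (rotQ κ g) := by
  intro p q
  rw [app_rotQ, app_rotQ]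
  simp only [mdot_smul_right, mdot_sub_right, mdot_comm _ p, mdot_comm _ q]
  ring

/-- The matrices `Q = Λ Q_κ Λ⁻¹` satisfy `Q³ = κ² Q`, since their eigenvalues are `κ`, `-κ` and
`0`. -/
theorem rotQ_cube (κ : ℝ) (g : Poincare n) :
    rotQ κ g * rotQ κ g * rotQ κ g = (κ ^ 2) • rotQ κ g := by
  have h1 : ∀ s t : ℝ, mdot (app g.mat (lightVec n s)) (app g.mat (lightVec n t)) = s * t - 1 :=
    fun s t => by rw [mdot_app_app, mdot_lightVec, lightVec_zero, lightVec_one]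
  refine mat_ext fun x => ?_
  have e : app ((κ ^ 2) • rotQ κ g) x = (κ ^ 2) • app (rotQ κ g) x := by
    simp [app, Matrix.smul_mulVec]
  rw [e, app_mul, app_mul]
  have h2 : ∀ s : ℝ, s * s = 1 → app (rotQ κ g) (app g.mat (lightVec n s)) =
      (s * κ) • app g.mat (lightVec n s) := by
    intro s hs
    have : s = 1 ∨ s = -1 := by
      rcases mul_self_eq_one_iff.1 hs with h | h
      · exact Or.inl h
      · exact Or.inr h
    rw [app_rotQ]
    simp only [h1]
    rcases this with rfl | rfl <;>
    · norm_num
      try module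
  rw [app_rotQ κ g x]
  simp only [app_smul, app_sub, h2 1 (by norm_num), h2 (-1) (by norm_num)]
  module

theorem rotQ_mul (κ : ℝ) (g h : Poincare n) : rotQ κ (g * h) = conjMat g (rotQ κ h) := by
  rw [rotQ, mat_mul, Matrix.mul_inv_rev, conjMat, rotQ]
  simp only [mul_assoc]

/-- A Lorentz transformation which maps the standard wedge into itself commutes with `Q_κ`: it
rescales the two lightlike vectors in the boundary of the wedge. -/
theorem rotQ_eq_of_image_subset (κ : ℝ) {g : Poincare n}
    (h : g.image (standardWedge n) ⊆ standardWedge n) : rotQ κ g = stdQ n κ := by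
  -- translations do not matter, since the wedge is a closed cone
  have hcone : ∀ x ∈ standardWedge n, app g.mat x ∈ standardWedge n := by
    intro x hx
    have hx : |x 0| ≤ x 1 := hx
    have h1 : ∀ t : ℝ, 0 < t → app g.mat x + t • g.tr ∈ standardWedge n := by
      intro t ht
      have h2 : (t⁻¹ • x) ∈ standardWedge n := by
        show |t⁻¹ * x 0| ≤ t⁻¹ * x 1
        rw [abs_mul, abs_of_pos (inv_pos.2 ht)]
        exact mul_le_mul_of_nonneg_left hx (inv_pos.2 ht).le
      have h3 : |(app g.mat (t⁻¹ • x) + g.tr) 0| ≤ (app g.mat (t⁻¹ • x) + g.tr) 1 := h ⟨_, h2, rfl⟩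
      have e : app g.mat x + t • g.tr = t • (app g.mat (t⁻¹ • x) + g.tr) := by
        rw [app_smul, smul_add, smul_smul, mul_inv_cancel₀ ht.ne', one_smul]
      rw [e]
      show |t * _| ≤ t * _
      rw [abs_mul, abs_of_pos ht]
      exact mul_le_mul_of_nonneg_left h3 ht.le
    have hcl : IsClosed (standardWedge n) := isClosed_le (by fun_prop) (by fun_prop)
    have hlim : Tendsto (fun t : ℝ => app g.mat x + t • g.tr) (𝓝[>] 0) (𝓝 (app g.mat x)) := by
      apply Tendsto.mono_left _ nhdsWithin_le_nhds
      have hc : Continuous fun t : ℝ => app g.mat x + t • g.tr := by fun_prop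
      simpa using hc.tendsto 0
    exact hcl.mem_of_tendsto hlim (by
      filter_upwards [self_mem_nhdsWithin] with t ht
      exact h1 t ht)
  -- hence the images of the two lightlike vectors have a time component of the same sign
  have hrow : |g.mat 0 1| < g.mat 0 0 := by
    have h1 := Finset.single_le_sum (f := fun i : Fin (n + 1) => g.mat 0 i.succ ^ 2)
      (fun i _ => sq_nonneg _) (Finset.mem_univ 0)
    rw [g.sum_sq_row] at h1
    have h2 : g.mat 0 1 ^ 2 ≤ g.mat 0 0 ^ 2 - 1 := h1
    exact abs_lt_of_sq_lt_sq (by linarith) g.mat_zero_zero_pos.le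
  have htime : ∀ s : ℝ, app g.mat (lightVec n s) 0 = g.mat 0 0 * s + g.mat 0 1 := by
    intro s
    rw [app_apply, Fin.sum_univ_succ, Fin.sum_univ_succ]
    have h2 : ∀ j : Fin n, lightVec n s j.succ.succ = 0 := fun j => by
      simp [lightVec, Fin.ext_iff]
    simp [h2, lightVec_one, lightVec_zero]
  -- the image is lightlike and in the wedge, hence a multiple of the same lightlike vector
  have key : ∀ s : ℝ, s * s = 1 → app g.mat (lightVec n s) 0 * s > 0 →
      app g.mat (lightVec n s) = (app g.mat (lightVec n s) 0 * s) • lightVec n s := by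
    intro s hs hpos
    have hmem : lightVec n s ∈ standardWedge n := by
      show |lightVec n s 0| ≤ lightVec n s 1
      rw [lightVec_zero, lightVec_one]
      rcases mul_self_eq_one_iff.1 hs with h | h <;> simp [h]
    have hw : |app g.mat (lightVec n s) 0| ≤ app g.mat (lightVec n s) 1 := hcone _ hmem
    have hlight : mdot (app g.mat (lightVec n s)) (app g.mat (lightVec n s)) = 0 := by
      rw [mdot_app_app, mdot_lightVec, lightVec_zero, lightVec_one, hs, sub_self]
    set y := app g.mat (lightVec n s)
    rw [mdot, Fin.sum_univ_succ] at hlight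
    have hy1 : y (Fin.succ 0) = y 1 := rfl
    rw [hy1] at hlight
    have habs : |y 0| = y 0 * s := by
      rcases mul_self_eq_one_iff.1 hs with h | h
      · rw [h] at hpos ⊢
        rw [abs_of_pos (by linarith), mul_one]
      · rw [h] at hpos ⊢
        rw [abs_of_neg (by linarith)]
        ring
    have hsum : 0 ≤ ∑ i : Fin n, y i.succ.succ * y i.succ.succ :=
      Finset.sum_nonneg fun i _ => mul_self_nonneg _
    have hsq : y 0 * y 0 = |y 0| * |y 0| := (abs_mul_abs_self _).symm
    have h0 := abs_nonneg (y 0)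
    have hy1' : y 1 = |y 0| := by nlinarith
    have hrest : ∑ i : Fin n, y i.succ.succ * y i.succ.succ = 0 := by
      rw [hy1'] at hlight
      linarith
    have hz : ∀ i : Fin n, y i.succ.succ = 0 := fun i => by
      have := (Finset.sum_eq_zero_iff_of_nonneg fun i _ => mul_self_nonneg _).1 hrest i
        (Finset.mem_univ i)
      exact mul_self_eq_zero.1 this
    ext i
    refine Fin.cases ?_ (fun i => ?_) i
    · show y 0 = y 0 * s * lightVec n s 0
      rw [lightVec_zero, mul_assoc, hs, mul_one]
    · refine Fin.cases ?_ (fun i => ?_) i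
      · show y 1 = y 0 * s * lightVec n s 1
        rw [lightVec_one, mul_one, hy1', habs]
      · show y i.succ.succ = y 0 * s * lightVec n s i.succ.succ
        rw [hz]
        simp [lightVec, Fin.ext_iff]
  have hab := abs_lt.1 hrow
  have hp := key 1 (by norm_num) (by rw [htime]; linarith)
  have hm := key (-1) (by norm_num) (by rw [htime]; linarith)
  obtain ⟨a, ha⟩ : ∃ a, a = app g.mat (lightVec n 1) 0 * 1 := ⟨_, rfl⟩
  obtain ⟨b, hb⟩ : ∃ b, b = app g.mat (lightVec n (-1)) 0 * -1 := ⟨_, rfl⟩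
  rw [← ha] at hp
  rw [← hb] at hm
  -- the product of the two lightlike vectors is preserved
  have hprod : a * b = 1 := by
    have h1 := mdot_app_app g (lightVec n 1) (lightVec n (-1))
    rw [hp, hm, mdot_smul_left, mdot_smul_right, mdot_lightVec, lightVec_zero, lightVec_one] at h1
    linarith
  refine mat_ext fun x => ?_
  rw [app_rotQ, app_stdQ, hp, hm, mdot_smul_left, mdot_smul_left, smul_smul, smul_smul,
    mul_right_comm, mul_right_comm b, hprod, mul_comm b a, hprod, one_mul, one_mul]

/-- Wedges which are contained in one another have the same matrix `Λ Q_κ Λ⁻¹`. -/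
theorem rotQ_eq_of_subset (κ : ℝ) {g₁ g₂ : Poincare n}
    (h : g₁.image (standardWedge n) ⊆ g₂.image (standardWedge n)) : rotQ κ g₁ = rotQ κ g₂ := by
  obtain ⟨k, rfl⟩ : ∃ k, g₁ = g₂ * k := ⟨g₂⁻¹ * g₁, by group⟩
  rw [image_mul, image_subset_image_iff] at h
  rw [rotQ_mul, rotQ_eq_of_image_subset κ h]
  rfl

/-- The translations by `Q p` with `p` in the forward cone map the wedge into itself. -/
theorem image_trans_rotQ_subset {κ : ℝ} (hκ : 0 < κ) (g : Poincare n) {p : Mink n}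
    (hp : p ∈ forwardCone n) :
    (trans (app (rotQ κ g) p)).image (g.image (standardWedge n)) ⊆ g.image (standardWedge n) := by
  have hinv : (g⁻¹).mat = g.mat⁻¹ := coe_lor_inv g
  have hq : app g.mat⁻¹ p ∈ forwardCone n := by
    rw [← hinv]
    exact app_mem_forwardCone _ hp
  obtain ⟨q, hqd⟩ : ∃ q, q = app g.mat⁻¹ p := ⟨_, rfl⟩
  rw [← hqd] at hq
  have h1 : app (rotQ κ g) p = app g.mat (app (stdQ n κ) q) := by
    rw [hqd]
    exact app_conjMat g _ p
  rw [h1, ← image_mul, ← mul_trans, image_mul, image_subset_image_iff, image_trans]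
  rintro _ ⟨y, hy, rfl⟩
  have hy : |y 0| ≤ y 1 := hy
  have e0 : app (stdQ n κ) q 0 = κ * q 1 := by
    rw [app_stdQ, mdot_lightVec, mdot_lightVec]
    simp [lightVec]
    ring
  have e1 : app (stdQ n κ) q 1 = κ * q 0 := by
    rw [app_stdQ, mdot_lightVec, mdot_lightVec]
    simp [lightVec]
    ring
  have hq1 : |q 1| ≤ q 0 := by
    refine le_trans ?_ hq
    refine Real.abs_le_sqrt ?_
    exact Finset.single_le_sum (f := fun i : Fin (n + 1) => q i.succ ^ 2)
      (fun i _ => sq_nonneg _) (Finset.mem_univ 0)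
  show |y 0 + app (stdQ n κ) q 0| ≤ y 1 + app (stdQ n κ) q 1
  rw [e0, e1]
  refine (abs_add_le _ _).trans (add_le_add hy ?_)
  rw [abs_mul, abs_of_pos hκ]
  exact mul_le_mul_of_nonneg_left hq1 hκ.le

/-! The causal complement of the standard wedge is the image of the wedge under a rotation by `π`
(a reflection in two dimensions). -/

/-- The entries of the rotation by `π` in the plane of the first two space directions. In two
dimensions it is the reflection of the space coordinate. -/
def flipEntry (n : ℕ) (i : Fin (n + 2)) : ℝ := if i.val = 1 ∨ i.val = 2 then -1 else 1

theorem flipEntry_mul_self (i : Fin (n + 2)) : flipEntry n i * flipEntry n i = 1 := by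
  unfold flipEntry
  split_ifs <;> norm_num

/-- The rotation which exchanges the standard wedge and its causal complement. -/
noncomputable def wedgeFlip (n : ℕ) : Poincare n where
  lor := ⟨⟨Matrix.diagonal (flipEntry n), Matrix.diagonal (flipEntry n),
    by simp [Matrix.diagonal_mul_diagonal, flipEntry_mul_self],
    by simp [Matrix.diagonal_mul_diagonal, flipEntry_mul_self]⟩, by
      refine ⟨?_, ?_, ?_⟩
      · show (Matrix.diagonal (flipEntry n)).transpose * eta n * Matrix.diagonal (flipEntry n) = _
        rw [Matrix.diagonal_transpose, eta, Matrix.diagonal_mul_diagonal,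
          Matrix.diagonal_mul_diagonal]
        congr 1
        funext i
        rw [mul_right_comm, flipEntry_mul_self, one_mul]
      · show 0 < Matrix.diagonal (flipEntry n) 0 0
        simp [flipEntry]
      · rcases n with _ | n
        · exact Or.inl rfl
        · right
          show (Matrix.diagonal (flipEntry (n + 1))).det = 1
          rw [Matrix.det_diagonal, Fin.prod_univ_succ, Fin.prod_univ_succ, Fin.prod_univ_succ]
          simp [flipEntry]⟩
  tr := 0

theorem app_wedgeFlip (x : Mink n) (i : Fin (n + 2)) :
    app (wedgeFlip n).mat x i = flipEntry n i * x i := by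
  show (Matrix.diagonal (flipEntry n)).mulVec x.ofLp i = _
  rw [Matrix.mulVec_diagonal]

theorem rotQ_wedgeFlip (κ : ℝ) : rotQ κ (wedgeFlip n) = -stdQ n κ := by
  have h : ∀ s : ℝ, app (wedgeFlip n).mat (lightVec n s) = -lightVec n (-s) := by
    intro s
    ext i
    rw [app_wedgeFlip]
    refine Fin.cases ?_ (fun i => ?_) i
    · simp [flipEntry, lightVec]
    · refine Fin.cases ?_ (fun i => ?_) i
      · simp [flipEntry, lightVec]
      · simp [lightVec, Fin.ext_iff]
  refine mat_ext fun x => ?_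
  have hneg : app (-stdQ n κ) x = -app (stdQ n κ) x := by simp [app, Matrix.neg_mulVec]
  rw [hneg, app_rotQ, app_stdQ, h, h, neg_neg, mdot_neg_left, mdot_neg_left]
  module

/-- The matrix of the causal complement is the opposite one. -/
theorem rotQ_mul_wedgeFlip (κ : ℝ) (g : Poincare n) :
    rotQ κ (g * wedgeFlip n) = -rotQ κ g := by
  rw [rotQ_mul, rotQ_wedgeFlip, conjMat, rotQ, mul_neg, neg_mul]

theorem mem_image_wedgeFlip {x : Mink n} :
    x ∈ (wedgeFlip n).image (standardWedge n) ↔ x 1 ≤ -|x 0| := by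
  have h0 : ∀ y : Mink n, app (wedgeFlip n).mat y 0 = y 0 := fun y => by
    rw [app_wedgeFlip]; simp [flipEntry]
  have h1 : ∀ y : Mink n, app (wedgeFlip n).mat y 1 = -y 1 := fun y => by
    rw [app_wedgeFlip]; simp [flipEntry]
  have htr : (wedgeFlip n).tr = 0 := rfl
  constructor
  · rintro ⟨y, hy, rfl⟩
    have hy : |y 0| ≤ y 1 := hy
    show app (wedgeFlip n).mat y 1 + (0 : ℝ) ≤ -|app (wedgeFlip n).mat y 0 + (0 : ℝ)|
    rw [add_zero, add_zero, h0, h1]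
    linarith
  · intro hx
    refine ⟨app (wedgeFlip n).mat x, ?_, ?_⟩
    · show |app (wedgeFlip n).mat x 0| ≤ app (wedgeFlip n).mat x 1
      rw [h0, h1]
      linarith
    · show app (wedgeFlip n).mat (app (wedgeFlip n).mat x) + (wedgeFlip n).tr = x
      rw [htr, add_zero]
      ext i
      rw [app_wedgeFlip, app_wedgeFlip, ← mul_assoc, flipEntry_mul_self, one_mul]

/-- Both sides are the set of all `x` with `x₁ ≤ -|x₀|`. -/
theorem causalCompl_standardWedge :
    causalCompl (standardWedge n) = (wedgeFlip n).image (standardWedge n) := by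
  have hset : (wedgeFlip n).image (standardWedge n) = {x : Mink n | x 1 ≤ -|x 0|} := by
    ext x
    exact mem_image_wedgeFlip
  rw [hset]
  apply subset_antisymm
  · refine closure_minimal ?_ (isClosed_le (by fun_prop) (by fun_prop))
    intro x hx
    by_contra hlt
    have hlt : -|x 0| < x 1 := not_le.1 hlt
    -- the point of the wedge which is not spacelike to `x`
    let y : Mink n := x - EuclideanSpace.single 0 (x 0) +
      EuclideanSpace.single 1 (max (x 1) 0 - x 1)
    have hy0 : y 0 = 0 := by simp [y]
    have hy1 : y 1 = max (x 1) 0 := by simp [y]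
    have hy : y ∈ standardWedge n := by
      show |y 0| ≤ y 1
      rw [hy0, hy1, abs_zero]
      exact le_max_right _ _
    have h1 := hx y hy
    rw [mdot, Fin.sum_univ_succ] at h1
    have hz : ∀ i : Fin n, (x - y) i.succ.succ = 0 := fun i => by
      simp [y, Fin.ext_iff]
    have e0 : (x - y) 0 = x 0 := by
      show x 0 - y 0 = x 0
      rw [hy0, sub_zero]
    have e1 : (x - y) (Fin.succ 0) = x 1 - max (x 1) 0 := by
      show x 1 - y 1 = _
      rw [hy1]
    simp only [hz, e0, e1, mul_zero, Finset.sum_const_zero, add_zero] at h1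
    rcases le_total 0 (x 1) with h | h
    · rw [max_eq_left h, sub_self, mul_zero, sub_zero] at h1
      exact absurd h1 (not_lt.2 (mul_self_nonneg _))
    · rw [max_eq_right h, sub_zero] at h1
      have : x 0 * x 0 = |x 0| * |x 0| := (abs_mul_abs_self _).symm
      nlinarith [abs_nonneg (x 0)]
  · intro x hx
    have hx : x 1 ≤ -|x 0| := hx
    have hlim : Tendsto (fun t : ℝ => x - t • (EuclideanSpace.single 1 1 : Mink n)) (𝓝[>] 0)
        (𝓝 x) := by
      apply Tendsto.mono_left _ nhdsWithin_le_nhds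
      have hc : Continuous fun t : ℝ => x - t • (EuclideanSpace.single 1 1 : Mink n) := by fun_prop
      simpa using hc.tendsto 0
    -- the points `x - t e₁` are strictly spacelike to the wedge
    refine mem_closure_of_tendsto hlim ?_
    filter_upwards [self_mem_nhdsWithin] with t ht y hy
    have ht : 0 < t := ht
    have hy : |y 0| ≤ y 1 := hy
    rw [mdot, Fin.sum_univ_succ]
    have e0 : (x - t • (EuclideanSpace.single 1 1 : Mink n) - y) 0 = x 0 - y 0 := by simp
    have e1 : (x - t • (EuclideanSpace.single 1 1 : Mink n) - y) (Fin.succ 0) = x 1 - t - y 1 := by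
      show x 1 - t * (EuclideanSpace.single 1 1 : Mink n) 1 - y 1 = _
      simp
    rw [e0, e1]
    have hsum : 0 ≤ ∑ i : Fin n, (x - t • (EuclideanSpace.single 1 1 : Mink n) - y) i.succ.succ *
        (x - t • (EuclideanSpace.single 1 1 : Mink n) - y) i.succ.succ :=
      Finset.sum_nonneg fun i _ => mul_self_nonneg _
    have h1 := abs_sub (x 0) (y 0)
    have h2 : (x 0 - y 0) * (x 0 - y 0) = |x 0 - y 0| * |x 0 - y 0| :=
      (abs_mul_abs_self _).symm
    have h3 : |x 0 - y 0| < -(x 1 - t - y 1) := by linarith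
    nlinarith [abs_nonneg (x 0 - y 0)]

theorem causalCompl_image (g : Poincare n) (S : Set (Mink n)) :
    causalCompl (g.image S) = g.image (causalCompl S) := by
  have h1 : g.image (causalCompl S) = g.toHomeomorph '' closure _ := rfl
  rw [h1, g.toHomeomorph.image_closure, causalCompl]
  congr 1
  ext x
  have hd : ∀ y z : Mink n, mdot (g.toHomeomorph y - g.toHomeomorph z)
      (g.toHomeomorph y - g.toHomeomorph z) = mdot (y - z) (y - z) := by
    intro y z
    have : g.toHomeomorph y - g.toHomeomorph z = app g.mat (y - z) := by
      show app g.mat y + g.tr - (app g.mat z + g.tr) = _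
      rw [app_sub]
      abel
    rw [this, mdot_app_app]
  constructor
  · intro hx
    refine ⟨g.toHomeomorph.symm x, fun z hz => ?_, by simp⟩
    have := hx _ ⟨z, hz, rfl⟩
    rw [← hd, g.toHomeomorph.apply_symm_apply]
    exact this
  · rintro ⟨y, hy, rfl⟩ _ ⟨z, hz, rfl⟩
    have := hy z hz
    rw [← hd] at this
    exact this

/-- The causal complement of a wedge is a wedge. -/
theorem causalCompl_wedge (g : Poincare n) :
    causalCompl (g.image (standardWedge n)) = (g * wedgeFlip n).image (standardWedge n) := by
  rw [causalCompl_image, causalCompl_standardWedge, image_mul]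

end Wedges

/-! ### The deformed wedge algebras -/

section Deformation

open Poincare

variable {n : ℕ} {H : Type*} [NormedAddCommGroup H] [InnerProductSpace ℂ H] [CompleteSpace H]
  {U : Poincare n →* (H ≃ₗᵢ[ℂ] H)}

theorem isWedge_image {W : Set (Mink n)} (hW : IsWedge W) (g : Poincare n) :
    IsWedge (g.image W) := by
  obtain ⟨h, rfl⟩ := hW
  exact ⟨g * h, (image_mul g h _).symm⟩

/-- The automorphism `α_g` of the algebra of operators on the smooth vectors. -/
noncomputable def alphaHom (U : Poincare n →* (H ≃ₗᵢ[ℂ] H)) (g : Poincare n) :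
    Op U →ₐ[ℂ] Op U where
  toFun := alpha U g
  map_one' := by
    ext ψ
    show ((smoothAct U g) ((smoothAct U g).symm ψ) : H) = ψ
    rw [LinearEquiv.apply_symm_apply]
  map_mul' F G := by
    ext ψ
    show ((smoothAct U g) (F (G ((smoothAct U g).symm ψ))) : H) =
      (smoothAct U g) (F ((smoothAct U g).symm ((smoothAct U g) (G ((smoothAct U g).symm ψ)))))
    rw [LinearEquiv.symm_apply_apply]
  map_zero' := by
    ext ψ
    show ((smoothAct U g) 0 : H) = 0
    simp
  map_add' F G := by
    ext ψ
    show ((smoothAct U g) (F _ + G _) : H) = _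
    rw [map_add]
    rfl
  commutes' c := by
    ext ψ
    show ((smoothAct U g) (c • (smoothAct U g).symm ψ) : H) = c • ψ
    rw [map_smul, LinearEquiv.apply_symm_apply]
    rfl

theorem alpha_image_adjoin (g : Poincare n) (S : Set (Op U)) :
    alpha U g '' (Algebra.adjoin ℂ S : Set (Op U)) =
      (Algebra.adjoin ℂ (alpha U g '' S) : Set (Op U)) := by
  have := AlgHom.map_adjoin (alphaHom U g) S
  exact congrArg (fun B : Subalgebra ℂ (Op U) => (B : Set (Op U))) this

/-- The smooth operators form an algebra. -/
theorem mem_smoothOps_of_mem_adjoin (hD : Dense (smoothVectors U : Set H)) {S : Set (Op U)}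
    (hS : ∀ F ∈ S, F ∈ smoothOps U) {F : Op U} (hF : F ∈ Algebra.adjoin ℂ S) :
    F ∈ smoothOps U := by
  suffices h : ∃ l, F ∈ tame U l from mem_smoothOps_of_mem_tame hD h.choose_spec
  induction hF using Algebra.adjoin_induction with
  | mem F hF => exact exists_mem_tame_of_mem_smoothOps hD (hS F hF)
  | algebraMap c =>
    rw [Algebra.algebraMap_eq_smul_one]
    exact ⟨0, Submodule.smul_mem _ c one_mem_tame⟩
  | add F G _ _ hF hG =>
    obtain ⟨l, hl⟩ := hF
    obtain ⟨m, hm⟩ := hG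
    exact ⟨max l m, Submodule.add_mem _ (tame_mono (le_max_left l m) hl)
      (tame_mono (le_max_right l m) hm)⟩
  | mul F G _ _ hF hG =>
    obtain ⟨l, hl⟩ := hF
    obtain ⟨m, hm⟩ := hG
    exact ⟨l + m, mul_mem_tame hl hm⟩

omit [CompleteSpace H] in
theorem exists_formalAdjoint_of_mem_adjoin {S : Set (Op U)}
    (hS : ∀ F ∈ S, ∃ G ∈ S, IsFormalAdjoint F G) {F : Op U} (hF : F ∈ Algebra.adjoin ℂ S) :
    ∃ G ∈ Algebra.adjoin ℂ S, IsFormalAdjoint F G := by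
  induction hF using Algebra.adjoin_induction with
  | mem F hF =>
    obtain ⟨G, hG, h⟩ := hS F hF
    exact ⟨G, Algebra.subset_adjoin hG, h⟩
  | algebraMap c =>
    refine ⟨algebraMap ℂ _ ((starRingEnd ℂ) c), Subalgebra.algebraMap_mem _ _, fun φ ψ => ?_⟩
    show ⟪(φ : H), c • (ψ : H)⟫_ℂ = ⟪(starRingEnd ℂ) c • (φ : H), (ψ : H)⟫_ℂ
    rw [inner_smul_left, inner_smul_right, Complex.conj_conj]
  | add F G _ _ hF hG =>
    obtain ⟨F', hF', hF⟩ := hF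
    obtain ⟨G', hG', hG⟩ := hG
    refine ⟨F' + G', Subalgebra.add_mem _ hF' hG', fun φ ψ => ?_⟩
    show ⟪(φ : H), (F ψ : H) + (G ψ : H)⟫_ℂ = ⟪(F' φ : H) + (G' φ : H), (ψ : H)⟫_ℂ
    rw [inner_add_left, inner_add_right, hF, hG]
  | mul F G _ _ hF hG =>
    obtain ⟨F', hF', hF⟩ := hF
    obtain ⟨G', hG', hG⟩ := hG
    refine ⟨G' * F', Subalgebra.mul_mem _ hG' hF', fun φ ψ => ?_⟩
    show ⟪(φ : H), (F (G ψ) : H)⟫_ℂ = ⟪(G' (F' φ) : H), (ψ : H)⟫_ℂ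
    rw [hF, hG]

theorem warp_mem_smoothOps (hD : Dense (smoothVectors U : Set H))
    {Q : Matrix (Fin (n + 2)) (Fin (n + 2)) ℝ} (hQ : IsSkew Q) {F : Op U} (hF : F ∈ smoothOps U) :
    warp U Q F ∈ smoothOps U := by
  obtain ⟨l, hl⟩ := exists_mem_tame_of_mem_smoothOps hD hF
  exact mem_smoothOps_of_mem_tame hD (warp_mem_tame hD hQ hl)

theorem exists_opBound_of_mem_smoothOps (hD : Dense (smoothVectors U : Set H)) {F : Op U}
    (hF : F ∈ smoothOps U) : ∃ l, OpBound l F :=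
  (exists_mem_tame_of_mem_smoothOps hD hF).imp fun _ h => opBound_of_mem_tame h

omit [CompleteSpace H] in
/-- The deformed algebra does not depend on the Poincare transformation which represents the
wedge. -/
theorem deformed_image (κ : ℝ) (𝔄 : Set (Mink n) → Subalgebra ℂ (Op U)) (g : Poincare n) :
    deformed κ 𝔄 (g.image (standardWedge n)) =
      Algebra.adjoin ℂ (warp U (rotQ κ g) '' (𝔄 (g.image (standardWedge n)) : Set (Op U))) := by
  rw [deformed]
  congr 1
  ext B
  constructor
  · rintro ⟨h, hgh, A, hA, rfl⟩
    exact ⟨A, hA, by rw [rotQ_eq_of_subset κ hgh.subset]⟩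
  · rintro ⟨A, hA, rfl⟩
    exact ⟨g, rfl, A, hA, rfl⟩

variable {Ω : H} {hΩ : IsVacuum U Ω} {𝔄 : Set (Mink n) → Subalgebra ℂ (Op U)}

omit [CompleteSpace H] in
/-- The translations of an operator localized in a wedge by `Q p`, `p` in the forward cone, are
localized in the same wedge. -/
theorem IsWedgeFamily.alpha_trans_mem (h𝔄 : IsWedgeFamily hΩ 𝔄) {κ : ℝ} (hκ : 0 < κ)
    (g : Poincare n) {A : Op U} (hA : A ∈ 𝔄 (g.image (standardWedge n))) {p : Mink n}
    (hp : p ∈ forwardCone n) :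
    alpha U (trans (app (rotQ κ g) p)) A ∈ 𝔄 (g.image (standardWedge n)) := by
  have hW : IsWedge (g.image (standardWedge n)) := ⟨g, rfl⟩
  refine h𝔄.isotony _ _ (isWedge_image hW _) hW (image_trans_rotQ_subset hκ g hp) ?_
  have h := h𝔄.covariance _ hW (trans (app (rotQ κ g) p))
  have : alpha U (trans (app (rotQ κ g) p)) A ∈
      alpha U (trans (app (rotQ κ g) p)) '' (𝔄 (g.image (standardWedge n)) : Set (Op U)) :=
    ⟨A, hA, rfl⟩
  rw [h] at this
  exact this

/-- The generators of the deformed algebras of a wedge and of its causal complement commute. -/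
theorem IsWedgeFamily.warp_commute (h𝔄 : IsWedgeFamily hΩ 𝔄)
    (hU : ∀ ψ : H, Continuous fun g => U g ψ) (hspec : jointSpectrum U ⊆ forwardCone n) {κ : ℝ}
    (hκ : 0 < κ) (g : Poincare n) {A B : Op U} (hA : A ∈ 𝔄 (g.image (standardWedge n)))
    (hB : B ∈ 𝔄 (causalCompl (g.image (standardWedge n)))) :
    warp U (rotQ κ g) A * warp U (-rotQ κ g) B = warp U (-rotQ κ g) B * warp U (rotQ κ g) A := by
  have hD := dense_smoothVectors hU
  have hW : IsWedge (g.image (standardWedge n)) := ⟨g, rfl⟩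
  have hW' : IsWedge (causalCompl (g.image (standardWedge n))) := ⟨_, causalCompl_wedge g⟩
  obtain ⟨A', hA', hAA⟩ := h𝔄.star _ hW A hA
  obtain ⟨B', hB', hBB⟩ := h𝔄.star _ hW' B hB
  obtain ⟨l, hl⟩ := exists_opBound_of_mem_smoothOps hD (h𝔄.smooth _ hW A hA)
  obtain ⟨l', hl'⟩ := exists_opBound_of_mem_smoothOps hD (h𝔄.smooth _ hW A' hA')
  obtain ⟨m, hm⟩ := exists_opBound_of_mem_smoothOps hD (h𝔄.smooth _ hW' B hB)
  obtain ⟨m', hm'⟩ := exists_opBound_of_mem_smoothOps hD (h𝔄.smooth _ hW' B' hB')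
  refine warp_mul_warp_neg hD hU hspec (isSkew_rotQ κ g) (pow_ne_zero 2 hκ.ne') (rotQ_cube κ g)
    hl hl' hm hm' hAA hBB fun p hp k hk => ?_
  refine h𝔄.locality _ hW _ (h𝔄.alpha_trans_mem hκ g hA hp) _ ?_
  rw [causalCompl_wedge] at hB ⊢
  rw [← rotQ_mul_wedgeFlip]
  exact h𝔄.alpha_trans_mem hκ _ hB hk

/-- The deformed algebras have all the properties of the given ones. -/
theorem IsWedgeFamily.deformed (h𝔄 : IsWedgeFamily hΩ 𝔄)
    (hU : ∀ ψ : H, Continuous fun g => U g ψ) (hspec : jointSpectrum U ⊆ forwardCone n) {κ : ℝ}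
    (hκ : 0 < κ) : IsWedgeFamily hΩ (deformed κ 𝔄) where
  smooth := by
    rintro _ ⟨g, rfl⟩ F hF
    have hD := dense_smoothVectors hU
    rw [deformed_image] at hF
    refine mem_smoothOps_of_mem_adjoin hD ?_ hF
    rintro _ ⟨A, hA, rfl⟩
    exact warp_mem_smoothOps hD (isSkew_rotQ κ g) (h𝔄.smooth _ ⟨g, rfl⟩ A hA)
  star := by
    rintro _ ⟨g, rfl⟩ F hF
    have hD := dense_smoothVectors hU
    rw [deformed_image] at hF ⊢
    refine exists_formalAdjoint_of_mem_adjoin ?_ hF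
    rintro _ ⟨A, hA, rfl⟩
    obtain ⟨B, hB, hAB⟩ := h𝔄.star _ ⟨g, rfl⟩ A hA
    obtain ⟨l, hl⟩ := exists_opBound_of_mem_smoothOps hD (h𝔄.smooth _ ⟨g, rfl⟩ A hA)
    obtain ⟨m, hm⟩ := exists_opBound_of_mem_smoothOps hD (h𝔄.smooth _ ⟨g, rfl⟩ B hB)
    exact ⟨_, ⟨B, hB, rfl⟩, inner_warp_of_adjoint hD (isSkew_rotQ κ g) (pow_ne_zero 2 hκ.ne')
      (rotQ_cube κ g) hl hm hAB⟩
  isotony := by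
    rintro _ _ ⟨g, rfl⟩ ⟨h, rfl⟩ hgh
    rw [deformed_image, deformed_image, rotQ_eq_of_subset κ hgh]
    exact Algebra.adjoin_mono (Set.image_mono (h𝔄.isotony _ _ ⟨g, rfl⟩ ⟨h, rfl⟩ hgh))
  covariance := by
    rintro _ ⟨h, rfl⟩ g
    have hD := dense_smoothVectors hU
    have hW : IsWedge (h.image (standardWedge n)) := ⟨h, rfl⟩
    have hc := h𝔄.covariance _ hW g
    rw [deformed_image, alpha_image_adjoin, ← image_mul, deformed_image, image_mul, ← hc,
      Set.image_image, Set.image_image]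
    congr 2
    refine Set.image_congr fun A hA => ?_
    obtain ⟨l, hl⟩ := exists_opBound_of_mem_smoothOps hD (h𝔄.smooth _ hW A hA)
    have hgA : alpha U g A ∈ 𝔄 (g.image (h.image (standardWedge n))) := by
      have : alpha U g A ∈ alpha U g '' (𝔄 (h.image (standardWedge n)) : Set (Op U)) :=
        ⟨A, hA, rfl⟩
      rw [hc] at this
      exact this
    obtain ⟨m, hm⟩ := exists_opBound_of_mem_smoothOps hD
      (h𝔄.smooth _ (isWedge_image hW g) _ hgA)
    rw [alpha_warp hD (isSkew_rotQ κ h) g hl hm, rotQ_mul]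
  locality := by
    rintro _ ⟨g, rfl⟩ A hA B hB
    rw [causalCompl_wedge] at hB
    rw [deformed_image] at hA hB
    refine Algebra.commute_of_mem_adjoin_of_forall_mem_commute hB ?_
    rintro _ ⟨B, hB, rfl⟩
    refine (Algebra.commute_of_mem_adjoin_of_forall_mem_commute hA ?_).symm
    rintro _ ⟨A, hA, rfl⟩
    rw [rotQ_mul_wedgeFlip]
    rw [← causalCompl_wedge] at hB
    exact (h𝔄.warp_commute hU hspec hκ g hA hB).symm
  reehSchlieder := by
    rintro _ ⟨g, rfl⟩
    have hD := dense_smoothVectors hU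
    refine (h𝔄.reehSchlieder _ ⟨g, rfl⟩).mono ?_
    rintro _ ⟨A, hA, rfl⟩
    obtain ⟨l, hl⟩ := exists_mem_tame_of_mem_smoothOps hD (h𝔄.smooth _ ⟨g, rfl⟩ A hA)
    refine ⟨warp U (rotQ κ g) A, ?_, by rw [warp_vac hD (isSkew_rotQ κ g) hl]⟩
    rw [deformed_image]
    exact Algebra.subset_adjoin ⟨A, hA, rfl⟩

end Deformation
end WarpedQFT

theorem mainTheorem1 (n : ℕ) {H : Type*} [NormedAddCommGroup H] [InnerProductSpace ℂ H]
    [CompleteSpace H] [TopologicalSpace.SeparableSpace H]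
    (U : Poincare n →* (H ≃ₗᵢ[ℂ] H)) (hU : ∀ ψ : H, Continuous fun g => U g ψ)
    (hspec : jointSpectrum U ⊆ forwardCone n)
    (Ω : H) (hΩ : IsVacuum U Ω)
    (𝔄 : Set (Mink n) → Subalgebra ℂ (Op U)) (h𝔄 : IsWedgeFamily hΩ 𝔄)
    (κ : ℝ) (hκ : 0 < κ) :
    -- the warped convolutions exist, are smooth operators, and act on the vacuum like `F`
    (∀ Q, IsSkew Q → ∀ F ∈ smoothOps U, IsWarped U Q F (warp U Q F) ∧
      warp U Q F ∈ smoothOps U ∧ warp U Q F (vac hΩ) = F (vac hΩ)) ∧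
    -- the matrices `Λ Q_κ Λ⁻¹` are skew symmetric, and the deformed algebras do not depend on
    -- the choice of the Poincare transformation
    (∀ g : Poincare n, IsSkew (rotQ κ g) ∧
      deformed κ 𝔄 (g.image (standardWedge n)) =
        Algebra.adjoin ℂ (warp U (rotQ κ g) '' (𝔄 (g.image (standardWedge n)) : Set (Op U)))) ∧
    -- the deformed family has all the properties of the given one
    IsWedgeFamily hΩ (deformed κ 𝔄) := by
  have hD := dense_smoothVectors hU
  refine ⟨fun Q hQ F hF => ?_, fun g => ⟨isSkew_rotQ κ g, deformed_image κ 𝔄 g⟩,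
    h𝔄.deformed hU hspec hκ⟩
  obtain ⟨l, hl⟩ := exists_mem_tame_of_mem_smoothOps hD hF
  exact ⟨isWarped_warp hD hQ (opBound_of_mem_tame hl), warp_mem_smoothOps hD hQ hF,
    warp_vac hD hQ hl hΩ⟩
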